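/- Conventions. A continuous action $\alpha\colon G\to\mathrm{Aut}(A)$ of a topological group on a $C^*$-algebra is a homomorphism such that $g\mapsto\alpha_g(a)$ is norm-continuous for every $a\in A$; $A^\alpha=\{a\in A:\alpha_g(a)=a \text{ for all } g\in G\}$ is its fixed point algebra. For compact $G$, the crossed product $A\rtimes_\alpha G$ is the enveloping $C^*$-algebra of the convolution $*$-algebra $C(G,A)$ (normalized Haar measure), with $(f*h)(s)=\int_G f(t)\,\alpha_t(h(t^{-1}s))\,dt$ and $f^*(s)=\alpha_s(f(s^{-1})^*)$; that is, its completion in the largest $C^*$-seminorm dominated by the $L^1$-norm. The action is saturated if the functions $f_{a,b}\colon G\to A$, $f_{a,b}(g)=a\,\alpha_g(b)$, with $a,b\in A$, span a dense subspace of $A\rtimes_\alpha G$. Let $A_\infty=\ell^\infty(\mathbb N,A)/c_0(\mathbb N,A)$, in which $A$ is embedded as constant sequences, with the (not necessarily continuous) action $\alpha_\infty$ induced by applying $\alpha$ entrywise. Let $A_{\infty,\alpha}\subseteq A_\infty$ be the image of the algebra of those bounded sequences $x\in\ell^\infty(\mathbb N,A)$ for which $g\mapsto(\alpha_g(x_n))_{n}$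 is norm-continuous. For an $\alpha$-invariant $C^*$-subalgebra $D\subseteq A$, let $F(D,A)=(A_\infty\cap D')/\mathrm{Ann}(D,A_\infty)$, where $\mathrm{Ann}(D,A_\infty)=\{x\in A_\infty : xd=dx=0 \text{ for all } d\in D\}$, with the induced action $F(\alpha)$, and let $F_\alpha(D,A)$ be the image of $A_{\infty,\alpha}\cap D'$ in $F(D,A)$. When $A$ is $\sigma$-unital and $G$ is a second-countable compact group, $\alpha$ has the Rokhlin property if for every separable $\alpha$-invariant $C^*$-subalgebra $D\subseteq A$ there is a unital equivariant $*$-homomorphism $(C(G),\mathrm{Lt})\to(F_\alpha(D,A),F(\alpha))$, where $\mathrm{Lt}_g(f)(h)=f(g^{-1}h)$. Proposition. Let $G$ be a second-countable compact (Hausdorff) group, let $A$ be a $\sigma$-unital $C^*$-algebra (one with a countable approximate unit), and let $\alpha\colon G\to\mathrm{Aut}(A)$ be a continuous action with the Rokhlin property. Then: (1) $\alpha$ is saturated; (2) $A^\alpha$ and $A\rtimes_\alpha G$ are (strongly) Morita equivalent, i.e. there is an $A^\alpha$-$(A\rtimes_\alpha G)$-imprimitivity bimodule; (3) if $A$ is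 separable, then $A^\alpha$ and $A\rtimes_\alpha G$ are stably isomorphic, i.e. $A^\alpha\otimes\mathcal K\cong(A\rtimes_\alpha G)\otimes\mathcal K$ as $C^*$-algebras, where $\mathcal K$ is the algebra of compact operators on $\ell^2(\mathbb N)$. -/

import Mathlib

noncomputable section

open scoped Topology ENNReal
open Filter MeasureTheory UniformSpace

/-! ### C⋆-seminorms and enveloping C⋆-algebras -/

section Envelope

variable (V : Type*) [NonUnitalRing V] [StarRing V] [Module ℂ V]

/-- A C⋆-seminorm on a complex ⋆-algebra. -/
structure CStarSeminorm extends Seminorm ℂ V where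
  mul_le' : ∀ x y, toFun (x * y) ≤ toFun x * toFun y
  star_mul_self' : ∀ x, toFun (star x * x) = toFun x ^ 2

variable {V}

instance : CoeFun (CStarSeminorm V) (fun _ => V → ℝ) := ⟨fun p => p.toSeminorm⟩

namespace CStarSeminorm

lemma mul_le (p : CStarSeminorm V) (x y : V) : p (x * y) ≤ p x * p y := p.mul_le' x y

lemma star_mul_self (p : CStarSeminorm V) (x : V) : p (star x * x) = p x ^ 2 :=
  p.star_mul_self' x

lemma nonneg (p : CStarSeminorm V) (x : V) : 0 ≤ p x := apply_nonneg p.toSeminorm x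

lemma le_star (p : CStarSeminorm V) (x : V) : p x ≤ p (star x) := by
  rcases (p.nonneg x).eq_or_lt with h | h
  · rw [← h]; exact p.nonneg _
  · have h1 := p.mul_le (star x) x
    rw [p.star_mul_self, sq] at h1
    exact le_of_mul_le_mul_right h1 h

lemma apply_star (p : CStarSeminorm V) (x : V) : p (star x) = p x :=
  le_antisymm (by simpa using p.le_star (star x)) (p.le_star x)

variable (N : V → ℝ)

lemma bddAbove_range (x : V) :
    BddAbove (Set.range fun p : {p : CStarSeminorm V // ∀ y, p y ≤ N y} => p.1 x) :=
  ⟨N x, by rintro _ ⟨p, rfl⟩; exact p.2 x⟩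

lemma le_sup (p : {p : CStarSeminorm V // ∀ y, p y ≤ N y}) (x : V) :
    p.1 x ≤ ⨆ q : {p : CStarSeminorm V // ∀ y, p y ≤ N y}, q.1 x :=
  le_ciSup (bddAbove_range N x) p

lemma sup_nonneg (x : V) : 0 ≤ ⨆ q : {p : CStarSeminorm V // ∀ y, p y ≤ N y}, q.1 x :=
  Real.iSup_nonneg fun p => p.1.nonneg x

/-- The largest C⋆-seminorm that is dominated by `N`: the pointwise supremum of all C⋆-seminorms
dominated by `N`. -/
def largest : CStarSeminorm V where
  toSeminorm := Seminorm.of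
    (fun x => ⨆ p : {p : CStarSeminorm V // ∀ y, p y ≤ N y}, p.1 x)
    (fun x y => Real.iSup_le
      (fun p => (map_add_le_add p.1.toSeminorm x y).trans
        (add_le_add (le_sup N p x) (le_sup N p y)))
      (add_nonneg (sup_nonneg N x) (sup_nonneg N y)))
    (fun c x => by
      rw [Real.mul_iSup_of_nonneg (norm_nonneg c)]
      exact iSup_congr fun p => map_smul_eq_mul p.1.toSeminorm c x)
  mul_le' x y := Real.iSup_le
    (fun p => (p.1.mul_le x y).trans
      (mul_le_mul (le_sup N p x) (le_sup N p y) (p.1.nonneg y) (sup_nonneg N x)))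
    (mul_nonneg (sup_nonneg N x) (sup_nonneg N y))
  star_mul_self' x := by
    apply le_antisymm
    · refine Real.iSup_le (fun p => ?_) (sq_nonneg _)
      rw [p.1.star_mul_self]
      exact pow_le_pow_left₀ (p.1.nonneg x) (le_sup N p x) 2
    · refine (Real.le_sqrt (sup_nonneg N x) (sup_nonneg N _)).1 ?_
      refine Real.iSup_le (fun p => Real.le_sqrt_of_sq_le ?_) (Real.sqrt_nonneg _)
      rw [← p.1.star_mul_self]
      exact le_sup N p _

/-- The vector space `V`, to be seminormed by `p`. -/
def Space (_p : CStarSeminorm V) : Type _ := V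

section Space
variable (p : CStarSeminorm V)

instance : NonUnitalRing p.Space := inferInstanceAs (NonUnitalRing V)
instance : StarRing p.Space := inferInstanceAs (StarRing V)
instance : Module ℂ p.Space := inferInstanceAs (Module ℂ V)
instance [IsScalarTower ℂ V V] : IsScalarTower ℂ p.Space p.Space :=
  inferInstanceAs (IsScalarTower ℂ V V)
instance [SMulCommClass ℂ V V] : SMulCommClass ℂ p.Space p.Space :=
  inferInstanceAs (SMulCommClass ℂ V V)
instance [StarModule ℂ V] : StarModule ℂ p.Space := inferInstanceAs (StarModule ℂ V)

instance : SeminormedAddCommGroup p.Space :=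
  AddGroupSeminorm.toSeminormedAddCommGroup
    (p.toSeminorm.toAddGroupSeminorm : AddGroupSeminorm p.Space)

lemma Space.norm_def (x : p.Space) : ‖x‖ = p.toSeminorm (show V from x) := rfl

instance : NonUnitalSeminormedRing p.Space where
  __ := (inferInstance : SeminormedAddCommGroup p.Space)
  __ := (inferInstance : NonUnitalRing p.Space)
  norm_mul_le x y := p.mul_le x y

instance : NormedSpace ℂ p.Space where
  __ := (inferInstance : Module ℂ p.Space)
  norm_smul_le c x := (map_smul_eq_mul p.toSeminorm c (show V from x)).le

/-- The Hausdorff completion of `V` in the C⋆-seminorm `p`; a C⋆-algebra. -/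
def Completion : Type _ := UniformSpace.Completion p.Space

namespace Completion

instance : NormedAddCommGroup p.Completion :=
  inferInstanceAs (NormedAddCommGroup (UniformSpace.Completion p.Space))
instance : NormedSpace ℂ p.Completion :=
  inferInstanceAs (NormedSpace ℂ (UniformSpace.Completion p.Space))
instance : CompleteSpace p.Completion :=
  inferInstanceAs (CompleteSpace (UniformSpace.Completion p.Space))

/-- The canonical map from `V` to its completion. -/
def of (x : V) : p.Completion := UniformSpace.Completion.coe' (show p.Space from x)

lemma denseRange_of : DenseRange (of p) := UniformSpace.Completion.denseRange_coe (α := p.Space)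

lemma norm_of (x : V) : ‖of p x‖ = p x := UniformSpace.Completion.norm_coe (show p.Space from x)

lemma continuous_of : Continuous (fun x : p.Space => of p x) :=
  UniformSpace.Completion.continuous_coe p.Space

lemma isDenseInducing_of : IsDenseInducing (fun x : p.Space => of p x) :=
  UniformSpace.Completion.isDenseInducing_coe

lemma of_add (x y : V) : of p (x + y) = of p x + of p y :=
  UniformSpace.Completion.coe_add (α := p.Space) x y

lemma of_smul (c : ℂ) (x : V) : of p (c • x) = c • of p x :=
  UniformSpace.Completion.coe_smul (X := p.Space) c x

variable {p} in
@[elab_as_elim]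
lemma induction_on {P : p.Completion → Prop} (x : p.Completion) (hc : IsClosed {x | P x})
    (h : ∀ v, P (of p v)) : P x :=
  UniformSpace.Completion.induction_on x hc h

/-- Multiplication on the completion: the continuous extension of the multiplication of `V`. -/
instance : Mul p.Completion :=
  ⟨Function.curry <| ((isDenseInducing_of p).prodMap (isDenseInducing_of p)).extend
    fun z : p.Space × p.Space => of p (z.1 * z.2)⟩

lemma of_mul (x y : V) : of p (x * y) = of p x * of p y :=
  (((isDenseInducing_of p).prodMap (isDenseInducing_of p)).extend_eq
    ((continuous_of p).comp (continuous_mul (M := p.Space))) (x, y)).symm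

lemma continuous_mul' : Continuous fun z : p.Completion × p.Completion => z.1 * z.2 := by
  let c : p.Space →+ p.Completion := ⟨⟨of p, UniformSpace.Completion.coe_zero⟩, of_add p⟩
  let m := (AddMonoidHom.mul : p.Space →+ p.Space →+ p.Space).compr₂ c
  have hm : Continuous fun z : p.Space × p.Space => m z.1 z.2 :=
    (continuous_of p).comp (continuous_mul (M := p.Space))
  have di : IsDenseInducing c := isDenseInducing_of p
  exact (di.extend_Z_bilin di hm :)

instance : ContinuousMul p.Completion := ⟨continuous_mul' p⟩

/-- The involution on the completion: the continuous extension of the involution of `V`. -/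
instance : Star p.Completion :=
  ⟨(isDenseInducing_of p).extend fun x : p.Space => of p (star x)⟩

lemma uniformContinuous_of_star : UniformContinuous fun x : p.Space => of p (star x) := by
  refine (AddMonoidHomClass.lipschitz_of_bound
    (AddMonoidHom.mk' (fun x : p.Space => of p (star x)) fun x y =>
      (congrArg (of p) (star_add (R := V) x y)).trans (of_add p _ _)) 1 fun x => ?_).uniformContinuous
  rw [one_mul]
  exact ((norm_of p _).trans (p.apply_star x)).le

lemma of_star (x : V) : of p (star x) = star (of p x) :=
  ((isDenseInducing_of p).extend_eq (uniformContinuous_of_star p).continuous x).symm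

lemma continuous_star' : Continuous fun z : p.Completion => star z :=
  (uniformContinuous_uniformly_extend
    (UniformSpace.Completion.isUniformInducing_coe p.Space)
    (denseRange_of p) (uniformContinuous_of_star p)).continuous

instance : ContinuousStar p.Completion := ⟨continuous_star' p⟩

section Laws
variable (a b c : p.Completion) (k : ℂ)

variable {p} in
lemma mul_cont {f g : p.Completion → p.Completion} (hf : Continuous f)
    (hg : Continuous g) : Continuous fun x => f x * g x :=
  (continuous_mul' p).comp (hf.prodMk hg)

variable {p} in
lemma star_cont {f : p.Completion → p.Completion} (hf : Continuous f) :
    Continuous fun x => star (f x) :=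
  (continuous_star' p).comp hf

lemma assoc_aux : a * b * c = a * (b * c) := by
  induction a using induction_on with | hc => exact isClosed_eq (mul_cont (mul_cont continuous_id continuous_const) continuous_const) (mul_cont continuous_id continuous_const) | h a =>
  induction b using induction_on with | hc => exact isClosed_eq (mul_cont (mul_cont continuous_const continuous_id) continuous_const) (mul_cont continuous_const (mul_cont continuous_id continuous_const)) | h b =>
  induction c using induction_on with | hc => exact isClosed_eq (mul_cont continuous_const continuous_id) (mul_cont continuous_const (mul_cont continuous_const continuous_id)) | h c =>
  simp only [← of_mul, mul_assoc]

lemma left_distrib_aux : a * (b + c) = a * b + a * c := by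
  induction a using induction_on with | hc => exact isClosed_eq (mul_cont continuous_id continuous_const) ((mul_cont continuous_id continuous_const).add (mul_cont continuous_id continuous_const)) | h a =>
  induction b using induction_on with | hc => exact isClosed_eq (mul_cont continuous_const (continuous_id.add continuous_const)) ((mul_cont continuous_const continuous_id).add continuous_const) | h b =>
  induction c using induction_on with | hc => exact isClosed_eq (mul_cont continuous_const (continuous_const.add continuous_id)) (continuous_const.add (mul_cont continuous_const continuous_id)) | h c =>
  simp only [← of_mul, ← of_add, mul_add]

lemma right_distrib_aux : (a + b) * c = a * c + b * c := by
  induction a using induction_on with | hc => exact isClosed_eq (mul_cont (continuous_id.add continuous_const) continuous_const) ((mul_cont continuous_id continuous_const).add continuous_const) | h a =>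
  induction b using induction_on with | hc => exact isClosed_eq (mul_cont (continuous_const.add continuous_id) continuous_const) (continuous_const.add (mul_cont continuous_id continuous_const)) | h b =>
  induction c using induction_on with | hc => exact isClosed_eq (mul_cont continuous_const continuous_id) ((mul_cont continuous_const continuous_id).add (mul_cont continuous_const continuous_id)) | h c =>
  simp only [← of_mul, ← of_add, add_mul]

lemma star_star_aux : star (star a) = a := by
  induction a using induction_on with | hc => exact isClosed_eq (star_cont (star_cont continuous_id)) continuous_id | h a =>
  simp only [← of_star, star_star]

lemma star_mul_aux : star (a * b) = star b * star a := by
  induction a using induction_on with | hc => exact isClosed_eq (star_cont (mul_cont continuous_id continuous_const)) (mul_cont continuous_const (star_cont continuous_id)) | h a =>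
  induction b using induction_on with | hc => exact isClosed_eq (star_cont (mul_cont continuous_const continuous_id)) (mul_cont (star_cont continuous_id) continuous_const) | h b =>
  simp only [← of_star, ← of_mul, star_mul]

lemma star_add_aux : star (a + b) = star a + star b := by
  induction a using induction_on with | hc => exact isClosed_eq (star_cont (continuous_id.add continuous_const)) ((star_cont continuous_id).add continuous_const) | h a =>
  induction b using induction_on with | hc => exact isClosed_eq (star_cont (continuous_const.add continuous_id)) (continuous_const.add (star_cont continuous_id)) | h b =>
  simp only [← of_star, ← of_add, star_add]

lemma norm_mul_aux : ‖a * b‖ ≤ ‖a‖ * ‖b‖ := by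
  induction a using induction_on with | hc => exact isClosed_le (mul_cont continuous_id continuous_const).norm (continuous_norm.mul continuous_const) | h a =>
  induction b using induction_on with | hc => exact isClosed_le (mul_cont continuous_const continuous_id).norm (continuous_const.mul continuous_norm) | h b =>
  simpa only [← of_mul, norm_of] using p.mul_le a b

lemma cstar_aux : ‖a‖ * ‖a‖ ≤ ‖star a * a‖ := by
  induction a using induction_on with | hc => exact isClosed_le (continuous_norm.mul continuous_norm) (mul_cont (star_cont continuous_id) continuous_id).norm | h a =>
  simp only [← of_star, ← of_mul, norm_of, p.star_mul_self, sq, le_refl]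

lemma smul_mul_aux [IsScalarTower ℂ V V] : (k • a) * b = k • (a * b) := by
  induction a using induction_on with | hc => exact isClosed_eq (mul_cont (continuous_id.const_smul k) continuous_const) ((mul_cont continuous_id continuous_const).const_smul k) | h a =>
  induction b using induction_on with | hc => exact isClosed_eq (mul_cont continuous_const continuous_id) ((mul_cont continuous_const continuous_id).const_smul k) | h b =>
  simp only [← of_smul, ← of_mul, smul_mul_assoc]

lemma mul_smul_aux [SMulCommClass ℂ V V] : a * (k • b) = k • (a * b) := by
  induction a using induction_on with | hc => exact isClosed_eq (mul_cont continuous_id continuous_const) ((mul_cont continuous_id continuous_const).const_smul k) | h a =>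
  induction b using induction_on with | hc => exact isClosed_eq (mul_cont continuous_const (continuous_id.const_smul k)) ((mul_cont continuous_const continuous_id).const_smul k) | h b =>
  simp only [← of_smul, ← of_mul, mul_smul_comm]

lemma star_smul_aux [StarModule ℂ V] : star (k • a) = star k • star a := by
  induction a using induction_on with | hc => exact isClosed_eq (star_cont (continuous_id.const_smul k)) ((star_cont continuous_id).const_smul (star k)) | h a =>
  simp only [← of_star, ← of_smul, star_smul]

end Laws

instance : NonUnitalNormedRing p.Completion where
  __ := (inferInstance : NormedAddCommGroup p.Completion)
  mul_assoc := assoc_aux p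
  left_distrib := left_distrib_aux p
  right_distrib := right_distrib_aux p
  zero_mul a := by
    have h := right_distrib_aux p 0 0 a
    rwa [add_zero, left_eq_add] at h
  mul_zero a := by
    have h := left_distrib_aux p a 0 0
    rwa [add_zero, left_eq_add] at h
  norm_mul_le := norm_mul_aux p

instance : StarRing p.Completion where
  star_involutive := star_star_aux p
  star_mul := star_mul_aux p
  star_add := star_add_aux p

/-- The completion is a C⋆-algebra. -/
instance [IsScalarTower ℂ V V] [SMulCommClass ℂ V V] [StarModule ℂ V] :
    NonUnitalCStarAlgebra p.Completion where
  __ := (inferInstance : NonUnitalNormedRing p.Completion)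
  __ := (inferInstance : StarRing p.Completion)
  __ := (inferInstance : NormedSpace ℂ p.Completion)
  __ := (inferInstance : CompleteSpace p.Completion)
  norm_mul_self_le := cstar_aux p
  smul_assoc k a b := smul_mul_aux p a b k
  smul_comm k a b := (mul_smul_aux p a b k).symm
  star_smul k a := star_smul_aux p a k

end Completion
end Space

end CStarSeminorm

end Envelope

/-! ### Actions of compact groups and crossed products -/

/-- A continuous action of a topological group `G` on a C⋆-algebra `A`: a homomorphism
`G → Aut(A)` such that `g ↦ α_g(a)` is norm-continuous for every `a`. -/
structure CStarAction (G : Type*) [Group G] [TopologicalSpace G]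
    (A : Type*) [NonUnitalCStarAlgebra A] where
  toHom : G →* (A ≃⋆ₐ[ℂ] A)
  continuous_apply' : ∀ a : A, Continuous fun g => toHom g a

namespace CStarAction

section Basic
variable {G : Type*} [Group G] [TopologicalSpace G] {A : Type*} [NonUnitalCStarAlgebra A]

instance : CoeFun (CStarAction G A) (fun _ => G → (A ≃⋆ₐ[ℂ] A)) := ⟨fun α => α.toHom⟩

variable (α : CStarAction G A)

lemma one_apply (a : A) : α 1 a = a := by rw [map_one]; rfl

lemma mul_apply (g h : G) (a : A) : α (g * h) a = α g (α h a) := by rw [map_mul]; rfl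

lemma norm_apply (g : G) (a : A) : ‖α g a‖ = ‖a‖ :=
  NonUnitalStarAlgHom.norm_map (α g) (α g).injective a

/-- The continuous linear map `α_g`. -/
def clm (g : G) : A →L[ℂ] A :=
  LinearMap.mkContinuous
    { toFun := α g, map_add' := map_add (α g), map_smul' := map_smul (α g) } 1
    fun a => by rw [one_mul]; exact (α.norm_apply g a).le

@[simp] lemma clm_apply (g : G) (a : A) : α.clm g a = α g a := rfl

lemma continuous_joint : Continuous fun z : G × A => α z.1 z.2 := by
  rw [continuous_iff_continuousAt]
  rintro ⟨g, a⟩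
  rw [ContinuousAt, tendsto_iff_norm_sub_tendsto_zero]
  have h1 : Tendsto (fun z : G × A => ‖z.2 - a‖ + ‖α z.1 a - α g a‖) (𝓝 (g, a)) (𝓝 0) := by
    have : Continuous fun z : G × A => ‖z.2 - a‖ + ‖α z.1 a - α g a‖ :=
      (continuous_snd.sub continuous_const).norm.add
        ((((α.continuous_apply' a).comp continuous_fst).sub continuous_const).norm)
    simpa using this.tendsto (g, a)
  refine squeeze_zero (fun _ => norm_nonneg _) (fun z => ?_) h1
  calc ‖α z.1 z.2 - α g a‖ = ‖α z.1 (z.2 - a) + (α z.1 a - α g a)‖ := by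
        rw [map_sub]; congr 1; abel
    _ ≤ _ := (norm_add_le _ _).trans (by rw [norm_apply])

lemma continuous_comp {X : Type*} [TopologicalSpace X] {u : X → G} {v : X → A}
    (hu : Continuous u) (hv : Continuous v) : Continuous fun x => α (u x) (v x) :=
  α.continuous_joint.comp (hu.prodMk hv)

/-- The fixed point algebra `A^α`. -/
def fixedPoints : NonUnitalStarSubalgebra ℂ A where
  carrier := {a | ∀ g, α g a = a}
  add_mem' ha hb g := by rw [map_add, ha g, hb g]
  zero_mem' g := map_zero _
  mul_mem' ha hb g := by rw [map_mul, ha g, hb g]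
  smul_mem' c a ha g := by rw [map_smul, ha g]
  star_mem' ha g := by rw [map_star, ha g]

instance isClosed_fixedPoints : IsClosed (α.fixedPoints : Set A) := by
  have : (α.fixedPoints : Set A) = ⋂ g, {a | α g a = a} := by
    ext a; rw [Set.mem_iInter]; rfl
  rw [this]
  exact isClosed_iInter fun g => isClosed_eq (α.clm g).continuous continuous_id

end Basic

section Crossed
set_option linter.unusedSectionVars false
variable {G : Type*} [Group G] [TopologicalSpace G] [IsTopologicalGroup G] [CompactSpace G]
  [T2Space G] [SecondCountableTopology G] [MeasurableSpace G] [BorelSpace G]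
  {A : Type*} [NonUnitalCStarAlgebra A] (α : CStarAction G A)

variable (G) in
/-- The normalized Haar measure of the compact group `G`. -/
def haarProb : Measure G := Measure.haarMeasure ⊤

instance : (haarProb G).IsHaarMeasure := inferInstanceAs (Measure.haarMeasure ⊤).IsHaarMeasure

/-- The space `C(G, A)` of continuous functions, as the carrier of the convolution ⋆-algebra
of the action `α`. -/
def Conv (_α : CStarAction G A) : Type _ := C(G, A)

namespace Conv

instance : AddCommGroup α.Conv := inferInstanceAs (AddCommGroup C(G, A))
instance : Module ℂ α.Conv := inferInstanceAs (Module ℂ C(G, A))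
instance : FunLike α.Conv G A := inferInstanceAs (FunLike C(G, A) G A)

variable {α}

@[ext] lemma ext {f h : α.Conv} (w : ∀ s, f s = h s) : f = h := ContinuousMap.ext w
lemma continuous (f : α.Conv) : Continuous f := ContinuousMap.continuous (show C(G, A) from f)
@[simp] lemma add_apply (f h : α.Conv) (s : G) : (f + h) s = f s + h s := rfl
@[simp] lemma zero_apply (s : G) : (0 : α.Conv) s = 0 := rfl
@[simp] lemma smul_apply (c : ℂ) (f : α.Conv) (s : G) : (c • f) s = c • f s := rfl

lemma continuous_integrand (f h : α.Conv) :
    Continuous (Function.uncurry fun s t : G => f t * α t (h (t⁻¹ * s))) :=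
  (f.continuous.comp continuous_snd).mul
    (α.continuous_comp continuous_snd (h.continuous.comp (by fun_prop)))

lemma continuous_integrand' (f h : α.Conv) (s : G) :
    Continuous fun t : G => f t * α t (h (t⁻¹ * s)) :=
  (continuous_integrand f h).comp (Continuous.prodMk_right s)

lemma integrable {f : G → A} (hf : Continuous f) : Integrable f (haarProb G) :=
  hf.integrable_of_hasCompactSupport (HasCompactSupport.of_compactSpace f)

/-- Convolution: `(f * h)(s) = ∫ f(t) α_t(h(t⁻¹ s)) dt`. -/
instance : Mul α.Conv where
  mul f h := (⟨fun s => ∫ t, f t * α t (h (t⁻¹ * s)) ∂haarProb G, by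
    simpa using continuous_parametric_integral_of_continuous (μ := haarProb G)
      (continuous_integrand f h) isCompact_univ⟩ : C(G, A))

/-- Involution: `f⋆(s) = α_s(f(s⁻¹)⋆)` (a compact group is unimodular). -/
instance : Star α.Conv where
  star f := (⟨fun s => α s (star (f s⁻¹)),
    α.continuous_comp continuous_id (f.continuous.comp continuous_inv).star⟩ : C(G, A))

lemma mul_apply (f h : α.Conv) (s : G) :
    (f * h) s = ∫ t, f t * α t (h (t⁻¹ * s)) ∂haarProb G := rfl

lemma star_apply (f : α.Conv) (s : G) : (star f) s = α s (star (f s⁻¹)) := rfl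

lemma integral_mul_left' (a : A) {f : G → A} (hf : Continuous f) :
    ∫ t, a * f t ∂haarProb G = a * ∫ t, f t ∂haarProb G :=
  (ContinuousLinearMap.mul ℂ A a).integral_comp_comm (integrable hf)

lemma integral_mul_right' (a : A) {f : G → A} (hf : Continuous f) :
    ∫ t, f t * a ∂haarProb G = (∫ t, f t ∂haarProb G) * a :=
  ((ContinuousLinearMap.mul ℂ A).flip a).integral_comp_comm (integrable hf)

lemma integral_act (g : G) {f : G → A} (hf : Continuous f) :
    ∫ t, α g (f t) ∂haarProb G = α g (∫ t, f t ∂haarProb G) :=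
  (α.clm g).integral_comp_comm (integrable hf)

lemma mul_assoc_aux (f g h : α.Conv) : f * g * h = f * (g * h) := by
  ext s
  simp only [mul_apply]
  have h1 : ∀ t, (∫ r, f r * α r (g (r⁻¹ * t)) ∂haarProb G) * α t (h (t⁻¹ * s)) =
      ∫ r, f r * α r (g (r⁻¹ * t)) * α t (h (t⁻¹ * s)) ∂haarProb G := fun t =>
    (integral_mul_right' _ (continuous_integrand' f g t)).symm
  have h2 : ∀ r, f r * α r (∫ t, g t * α t (h (t⁻¹ * (r⁻¹ * s))) ∂haarProb G) =
      ∫ t, f r * α r (g (r⁻¹ * t)) * α t (h (t⁻¹ * s)) ∂haarProb G := fun r => by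
    have hc := continuous_integrand' g h (r⁻¹ * s)
    rw [← integral_act r hc, ← integral_mul_left' _ (α.continuous_comp continuous_const hc),
      ← integral_mul_left_eq_self _ r⁻¹]
    congr 1 with t
    rw [map_mul, ← CStarAction.mul_apply, mul_inv_cancel_left, mul_assoc]
    congr 4
    group
  simp only [h1, h2]
  refine integral_integral_swap_of_hasCompactSupport ?_ (HasCompactSupport.of_compactSpace _)
  refine Continuous.mul (Continuous.mul (f.continuous.comp continuous_snd)
    (α.continuous_comp continuous_snd (g.continuous.comp (by fun_prop))))
    (α.continuous_comp continuous_fst (h.continuous.comp (by fun_prop)))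

lemma star_mul_aux (f h : α.Conv) : star (f * h) = star h * star f := by
  ext s
  simp only [mul_apply, star_apply]
  have hc := continuous_integrand' f h s⁻¹
  have hs : star (∫ t, f t * α t (h (t⁻¹ * s⁻¹)) ∂haarProb G) =
      ∫ t, star (f t * α t (h (t⁻¹ * s⁻¹))) ∂haarProb G :=
    ((starL' ℝ : A ≃L[ℝ] A).toContinuousLinearMap.integral_comp_comm (integrable hc)).symm
  rw [hs, ← integral_act s hc.star]
  refine Eq.trans ?_ (integral_mul_left_eq_self _ s)
  congr 1 with t
  have e1 : s * t * ((s * t)⁻¹ * s) = s := by group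
  have e2 : ((s * t)⁻¹ * s)⁻¹ = t := by group
  have e3 : t⁻¹ * s⁻¹ = (s * t)⁻¹ := by group
  rw [← CStarAction.mul_apply, e1, e2, e3, star_mul, map_mul, ← map_star, ← CStarAction.mul_apply]

instance : NonUnitalRing α.Conv where
  mul_assoc := mul_assoc_aux
  left_distrib f g h := by
    ext s
    simp only [mul_apply, add_apply, map_add, mul_add]
    exact integral_add (integrable (continuous_integrand' f g s))
      (integrable (continuous_integrand' f h s))
  right_distrib f g h := by
    ext s
    simp only [mul_apply, add_apply, add_mul]
    exact integral_add (integrable (continuous_integrand' f h s))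
      (integrable (continuous_integrand' g h s))
  zero_mul f := by ext s; simp [mul_apply]
  mul_zero f := by ext s; simp [mul_apply]

instance : StarRing α.Conv where
  star_involutive f := by
    ext s
    simp only [star_apply, map_star, star_star, ← CStarAction.mul_apply, mul_inv_cancel,
      CStarAction.one_apply, inv_inv]
  star_mul := star_mul_aux
  star_add f h := by ext s; simp only [star_apply, add_apply, star_add, map_add]

instance : StarModule ℂ α.Conv where
  star_smul c f := by ext s; simp only [star_apply, smul_apply, star_smul, map_smul]

instance : IsScalarTower ℂ α.Conv α.Conv where
  smul_assoc c f h := by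
    ext s
    simp only [smul_eq_mul, mul_apply, smul_apply, smul_mul_assoc]
    exact integral_smul c _

instance : SMulCommClass ℂ α.Conv α.Conv where
  smul_comm c f h := by
    ext s
    simp only [smul_eq_mul, mul_apply, smul_apply, map_smul, mul_smul_comm]
    exact (integral_smul c _).symm

/-- The `L¹`-norm of a continuous function `G → A`. -/
def normL1 (f : α.Conv) : ℝ := ∫ s, ‖f s‖ ∂haarProb G

end Conv

/-- The crossed product `A ⋊_α G`: the enveloping C⋆-algebra of the convolution algebra, that is,
the completion of `C(G, A)` in the largest C⋆-seminorm dominated by the `L¹`-norm. -/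
abbrev CrossedProduct : Type _ :=
  (CStarSeminorm.largest (Conv.normL1 : α.Conv → ℝ)).Completion

/-- The canonical map from `C(G, A)` to `A ⋊_α G`. -/
def toCrossedProduct (f : C(G, A)) : α.CrossedProduct :=
  CStarSeminorm.Completion.of _ (show α.Conv from f)

/-- The function `f_{a,b}(g) = a α_g(b)`. -/
def coeff (a b : A) : C(G, A) :=
  ⟨fun g => a * α g b, continuous_const.mul (α.continuous_apply' b)⟩

/-- The action is saturated: the functions `f_{a,b}`, for `a, b ∈ A`, span a dense subspace
of the crossed product. -/
def IsSaturated : Prop :=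
  Dense (Submodule.span ℂ {x : α.CrossedProduct | ∃ a b : A, x = α.toCrossedProduct (α.coeff a b)} :
    Set α.CrossedProduct)

end Crossed

end CStarAction

/-! ### Stabilization and stable isomorphism -/

section Stabilization
variable (A : Type*) [NonUnitalCStarAlgebra A]

/-- The space of infinite matrices over `A` with finitely many nonzero entries. -/
def finiteMatrices : Submodule ℂ (ℕ → ℕ → A) where
  carrier := {M | ∃ n : ℕ, ∀ i j, n ≤ i ∨ n ≤ j → M i j = 0}
  add_mem' := by
    rintro M M' ⟨n, hn⟩ ⟨m, hm⟩
    refine ⟨max n m, fun i j h => ?_⟩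
    rw [Pi.add_apply, Pi.add_apply, hn i j (by omega), hm i j (by omega), add_zero]
  zero_mem' := ⟨0, fun _ _ _ => rfl⟩
  smul_mem' := by
    rintro c M ⟨n, hn⟩
    exact ⟨n, fun i j h => by rw [Pi.smul_apply, Pi.smul_apply, hn i j h, smul_zero]⟩

/-- The ⋆-algebra `M_∞(A) = ⋃ₙ Mₙ(A)`: infinite matrices over `A` with finitely many nonzero
entries, with matrix multiplication and conjugate transposition. -/
def FiniteMatrix : Type _ := finiteMatrices A

namespace FiniteMatrix
variable {A}

instance : AddCommGroup (FiniteMatrix A) := inferInstanceAs (AddCommGroup (finiteMatrices A))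
instance : Module ℂ (FiniteMatrix A) := inferInstanceAs (Module ℂ (finiteMatrices A))

/-- The `(i, j)` entry. -/
def entry (M : FiniteMatrix A) (i j : ℕ) : A := M.1 i j

@[ext] lemma ext {M M' : FiniteMatrix A} (h : ∀ i j, M.entry i j = M'.entry i j) : M = M' :=
  Subtype.ext (funext fun i => funext fun j => h i j)

lemma exists_bound (M : FiniteMatrix A) : ∃ n : ℕ, ∀ i j, n ≤ i ∨ n ≤ j → M.entry i j = 0 := M.2

@[simp] lemma entry_add (M M' : FiniteMatrix A) (i j : ℕ) :
    (M + M').entry i j = M.entry i j + M'.entry i j := rfl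
@[simp] lemma entry_zero (i j : ℕ) : (0 : FiniteMatrix A).entry i j = 0 := rfl
@[simp] lemma entry_smul (c : ℂ) (M : FiniteMatrix A) (i j : ℕ) :
    (c • M).entry i j = c • M.entry i j := rfl

/-- Matrix multiplication; the sum has finitely many nonzero terms. -/
instance : Mul (FiniteMatrix A) where
  mul M M' := ⟨fun i j => ∑ᶠ k, M.entry i k * M'.entry k j, by
    obtain ⟨n, hn⟩ := M.exists_bound
    obtain ⟨m, hm⟩ := M'.exists_bound
    refine ⟨max n m, fun i j h => ?_⟩
    refine (finsum_congr fun k => ?_).trans finsum_zero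
    rcases h with h | h
    · rw [hn i k (by omega), zero_mul]
    · rw [hm k j (by omega), mul_zero]⟩

/-- The conjugate transpose. -/
instance : Star (FiniteMatrix A) where
  star M := ⟨fun i j => star (M.entry j i), by
    obtain ⟨n, hn⟩ := M.exists_bound
    exact ⟨n, fun i j h => (congrArg star (hn j i h.symm)).trans (star_zero A)⟩⟩

lemma entry_mul (M M' : FiniteMatrix A) (i j : ℕ) :
    (M * M').entry i j = ∑ᶠ k, M.entry i k * M'.entry k j := rfl

@[simp] lemma entry_star (M : FiniteMatrix A) (i j : ℕ) :
    (star M).entry i j = star (M.entry j i) := rfl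

lemma entry_mul_of_le {M M' : FiniteMatrix A} {n : ℕ}
    (h : (∀ i j, n ≤ i ∨ n ≤ j → M.entry i j = 0) ∨ (∀ i j, n ≤ i ∨ n ≤ j → M'.entry i j = 0))
    (i j : ℕ) : (M * M').entry i j = ∑ k ∈ Finset.range n, M.entry i k * M'.entry k j := by
  rw [entry_mul]
  refine finsum_eq_sum_of_support_subset _ fun k hk => ?_
  by_contra hk'
  have hk'' : n ≤ k := by simpa using hk'
  refine hk ?_
  rcases h with h | h
  · simp [h i k (Or.inr hk'')]
  · simp [h k j (Or.inl hk'')]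

instance : NonUnitalRing (FiniteMatrix A) where
  mul_assoc M M' M'' := by
    obtain ⟨n, hn⟩ := M.exists_bound
    obtain ⟨m, hm⟩ := M''.exists_bound
    ext i j
    rw [entry_mul_of_le (Or.inr hm), entry_mul_of_le (Or.inl hn)]
    simp only [entry_mul_of_le (Or.inl hn), entry_mul_of_le (Or.inr hm), Finset.sum_mul,
      Finset.mul_sum, mul_assoc]
    exact Finset.sum_comm
  left_distrib M M' M'' := by
    obtain ⟨n, hn⟩ := M.exists_bound
    ext i j
    simp only [entry_add, entry_mul_of_le (Or.inl hn), mul_add, Finset.sum_add_distrib]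
  right_distrib M M' M'' := by
    obtain ⟨n, hn⟩ := M''.exists_bound
    ext i j
    simp only [entry_add, entry_mul_of_le (Or.inr hn), add_mul, Finset.sum_add_distrib]
  zero_mul M := by ext i j; simp [entry_mul]
  mul_zero M := by ext i j; simp [entry_mul]

instance : StarRing (FiniteMatrix A) where
  star_involutive M := by ext i j; simp
  star_mul M M' := by
    obtain ⟨n, hn⟩ := M.exists_bound
    have hn' : ∀ i j, n ≤ i ∨ n ≤ j → (star M).entry i j = 0 := fun i j h => by
      rw [entry_star, hn j i h.symm, star_zero]
    ext i j
    simp only [entry_star, entry_mul_of_le (Or.inl hn), entry_mul_of_le (Or.inr hn'), star_sum,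
      star_mul]
  star_add M M' := by ext i j; simp

instance : StarModule ℂ (FiniteMatrix A) where
  star_smul c M := by ext i j; simp

instance : IsScalarTower ℂ (FiniteMatrix A) (FiniteMatrix A) where
  smul_assoc c M M' := by
    obtain ⟨n, hn⟩ := M'.exists_bound
    ext i j
    simp only [smul_eq_mul, entry_smul, entry_mul_of_le (Or.inr hn), smul_mul_assoc,
      Finset.smul_sum]

instance : SMulCommClass ℂ (FiniteMatrix A) (FiniteMatrix A) where
  smul_comm c M M' := by
    obtain ⟨n, hn⟩ := M.exists_bound
    ext i j
    simp only [smul_eq_mul, entry_smul, entry_mul_of_le (Or.inl hn), mul_smul_comm,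
      Finset.smul_sum]

/-- The sum of the norms of the entries. -/
def normSum (M : FiniteMatrix A) : ℝ := ∑ᶠ ij : ℕ × ℕ, ‖M.entry ij.1 ij.2‖

end FiniteMatrix

/-- The stabilization `A ⊗ 𝒦` (`𝒦` the compact operators on `ℓ²(ℕ)`): the completion of
`M_∞(A) = ⋃ₙ Mₙ(A)` in its largest C⋆-seminorm, which restricts to the unique C⋆-norm on each
`Mₙ(A)`. (Every C⋆-seminorm on `M_∞(A)` is dominated by the sum of the norms of the entries.) -/
abbrev Stabilization : Type _ :=
  (CStarSeminorm.largest (FiniteMatrix.normSum : FiniteMatrix A → ℝ)).Completion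

/-- Stable isomorphism: `A ⊗ 𝒦 ≅ B ⊗ 𝒦` as C⋆-algebras. -/
def StablyIsomorphic (A : Type*) [NonUnitalCStarAlgebra A] (B : Type*) [NonUnitalCStarAlgebra B] :
    Prop :=
  Nonempty (Stabilization A ≃⋆ₐ[ℂ] Stabilization B)

end Stabilization

/-! ### Morita equivalence -/

/-- An `A`-`B`-imprimitivity bimodule structure on a Banach space `X`: `X` is a full left Hilbert
`A`-module and a full right Hilbert `B`-module, each algebra acts by adjointable operators with
respect to the inner product of the other, and `_A⟨x, y⟩ · z = x · ⟨y, z⟩_B`.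
Here `lact a x = a · x`, `ract b x = x · b`, `linner x y = _A⟨x, y⟩` is linear in `x`, and
`rinner x y = ⟨x, y⟩_B` is linear in `y`. -/
structure ImprimitivityBimodule (A B X : Type*) [NonUnitalCStarAlgebra A]
    [NonUnitalCStarAlgebra B] [NormedAddCommGroup X] [NormedSpace ℂ X] [CompleteSpace X] where
  lact : A →ₗ[ℂ] X →ₗ[ℂ] X
  ract : B →ₗ[ℂ] X →ₗ[ℂ] X
  lact_mul : ∀ a a' x, lact (a * a') x = lact a (lact a' x)
  ract_mul : ∀ b b' x, ract (b * b') x = ract b' (ract b x)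
  lact_ract : ∀ a b x, lact a (ract b x) = ract b (lact a x)
  linner : X → X → A
  rinner : X → X → B
  linner_add_left : ∀ x x' y, linner (x + x') y = linner x y + linner x' y
  linner_smul_left : ∀ (c : ℂ) x y, linner (c • x) y = c • linner x y
  linner_lact : ∀ a x y, linner (lact a x) y = a * linner x y
  star_linner : ∀ x y, star (linner x y) = linner y x
  linner_self_nonneg : ∀ x, ∃ a, linner x x = star a * a
  rinner_add_right : ∀ x y y', rinner x (y + y') = rinner x y + rinner x y'
  rinner_smul_right : ∀ (c : ℂ) x y, rinner x (c • y) = c • rinner x y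
  rinner_ract : ∀ b x y, rinner x (ract b y) = rinner x y * b
  star_rinner : ∀ x y, star (rinner x y) = rinner y x
  rinner_self_nonneg : ∀ x, ∃ b, rinner x x = star b * b
  norm_sq_eq_linner : ∀ x, ‖x‖ ^ 2 = ‖linner x x‖
  norm_sq_eq_rinner : ∀ x, ‖x‖ ^ 2 = ‖rinner x x‖
  linner_full : Dense (Submodule.span ℂ {a | ∃ x y, a = linner x y} : Set A)
  rinner_full : Dense (Submodule.span ℂ {b | ∃ x y, b = rinner x y} : Set B)
  rinner_lact : ∀ a x y, rinner (lact a x) y = rinner x (lact (star a) y)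
  linner_ract : ∀ b x y, linner (ract b x) y = linner x (ract (star b) y)
  lact_linner : ∀ x y z, lact (linner x y) z = ract (rinner y z) x

/-- (Strong) Morita equivalence of C⋆-algebras: there is an imprimitivity bimodule. -/
def MoritaEquivalent.{u, v} (A : Type u) (B : Type v) [NonUnitalCStarAlgebra A]
    [NonUnitalCStarAlgebra B] : Prop :=
  ∃ (X : Type (max u v)) (_ : NormedAddCommGroup X) (_ : NormedSpace ℂ X) (_ : CompleteSpace X),
    Nonempty (ImprimitivityBimodule A B X)

/-- A C⋆-algebra is σ-unital if it has a countable approximate unit (of positive contractions). -/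
def IsSigmaUnital (A : Type*) [NonUnitalCStarAlgebra A] : Prop :=
  ∃ e : ℕ → A, (∀ n, ∃ c, e n = star c * c) ∧ (∀ n, ‖e n‖ ≤ 1) ∧
    (atTop.map e).IsApproximateUnit

/-! ### Quotients of ⋆-algebras -/

section Quotient

/-- A self-adjoint two-sided ideal of a complex ⋆-algebra. -/
structure StarIdeal (R : Type*) [NonUnitalRing R] [StarRing R] [Module ℂ R]
    extends Submodule ℂ R where
  mul_mem_left' : ∀ x y, y ∈ carrier → x * y ∈ carrier
  mul_mem_right' : ∀ x y, x ∈ carrier → x * y ∈ carrier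
  star_mem' : ∀ x, x ∈ carrier → star x ∈ carrier

namespace StarIdeal
variable {R : Type*} [NonUnitalRing R] [StarRing R] [Module ℂ R] (I : StarIdeal R)

/-- The quotient ⋆-algebra `R / I`. -/
def Quotient : Type _ := R ⧸ I.toSubmodule

namespace Quotient

instance : AddCommGroup I.Quotient := inferInstanceAs (AddCommGroup (R ⧸ I.toSubmodule))
instance : Module ℂ I.Quotient := inferInstanceAs (Module ℂ (R ⧸ I.toSubmodule))

/-- The class of an element. -/
def mk (x : R) : I.Quotient := Submodule.Quotient.mk (p := I.toSubmodule) x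

variable {I}

lemma mk_surjective : Function.Surjective (mk I) := Submodule.Quotient.mk_surjective _

lemma mk_eq_mk {x y : R} : mk I x = mk I y ↔ x - y ∈ I.toSubmodule :=
  Submodule.Quotient.eq _

lemma mk_add (x y : R) : mk I (x + y) = mk I x + mk I y := rfl
lemma mk_zero : mk I 0 = 0 := rfl
lemma mk_smul (c : ℂ) (x : R) : mk I (c • x) = c • mk I x := rfl

instance : Mul I.Quotient where
  mul := _root_.Quotient.map₂ (· * ·) fun x x' hx y y' hy => by
    have hx' : x - x' ∈ I.toSubmodule := (Submodule.quotientRel_def _).1 hx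
    have hy' : y - y' ∈ I.toSubmodule := (Submodule.quotientRel_def _).1 hy
    refine (Submodule.quotientRel_def _).2 ?_
    have : x * y - x' * y' = (x - x') * y + x' * (y - y') := by
      rw [sub_mul, mul_sub]; abel
    rw [this]
    exact add_mem (I.mul_mem_right' _ _ hx') (I.mul_mem_left' _ _ hy')

instance : Star I.Quotient where
  star := _root_.Quotient.map star fun x x' hx => by
    have hx' : x - x' ∈ I.toSubmodule := (Submodule.quotientRel_def _).1 hx
    refine (Submodule.quotientRel_def _).2 ?_
    rw [← star_sub]
    exact I.star_mem' _ hx'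

lemma mk_mul (x y : R) : mk I (x * y) = mk I x * mk I y := rfl
lemma mk_star (x : R) : mk I (star x) = star (mk I x) := rfl

instance : NonUnitalRing I.Quotient where
  mul_assoc := by
    rintro a b c
    obtain ⟨a, rfl⟩ := mk_surjective a
    obtain ⟨b, rfl⟩ := mk_surjective b
    obtain ⟨c, rfl⟩ := mk_surjective c
    simp only [← mk_mul, mul_assoc]
  left_distrib := by
    rintro a b c
    obtain ⟨a, rfl⟩ := mk_surjective a
    obtain ⟨b, rfl⟩ := mk_surjective b
    obtain ⟨c, rfl⟩ := mk_surjective c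
    simp only [← mk_mul, ← mk_add, mul_add]
  right_distrib := by
    rintro a b c
    obtain ⟨a, rfl⟩ := mk_surjective a
    obtain ⟨b, rfl⟩ := mk_surjective b
    obtain ⟨c, rfl⟩ := mk_surjective c
    simp only [← mk_mul, ← mk_add, add_mul]
  zero_mul := by
    rintro a
    obtain ⟨a, rfl⟩ := mk_surjective a
    rw [← mk_zero, ← mk_mul, zero_mul]
  mul_zero := by
    rintro a
    obtain ⟨a, rfl⟩ := mk_surjective a
    rw [← mk_zero, ← mk_mul, mul_zero]

instance : StarRing I.Quotient where
  star_involutive := by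
    rintro a
    obtain ⟨a, rfl⟩ := mk_surjective a
    simp only [← mk_star, star_star]
  star_mul := by
    rintro a b
    obtain ⟨a, rfl⟩ := mk_surjective a
    obtain ⟨b, rfl⟩ := mk_surjective b
    simp only [← mk_mul, ← mk_star, star_mul]
  star_add := by
    rintro a b
    obtain ⟨a, rfl⟩ := mk_surjective a
    obtain ⟨b, rfl⟩ := mk_surjective b
    simp only [← mk_add, ← mk_star, star_add]

instance [IsScalarTower ℂ R R] : IsScalarTower ℂ I.Quotient I.Quotient where
  smul_assoc := by
    rintro c a b
    obtain ⟨a, rfl⟩ := mk_surjective a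
    obtain ⟨b, rfl⟩ := mk_surjective b
    simp only [smul_eq_mul, ← mk_mul, ← mk_smul, smul_mul_assoc]

instance [SMulCommClass ℂ R R] : SMulCommClass ℂ I.Quotient I.Quotient where
  smul_comm := by
    rintro c a b
    obtain ⟨a, rfl⟩ := mk_surjective a
    obtain ⟨b, rfl⟩ := mk_surjective b
    simp only [smul_eq_mul, ← mk_mul, ← mk_smul, mul_smul_comm]

instance [StarModule ℂ R] : StarModule ℂ I.Quotient where
  star_smul := by
    rintro c a
    obtain ⟨a, rfl⟩ := mk_surjective a
    simp only [← mk_star, ← mk_smul, star_smul]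

variable (I) in
/-- The quotient map, as a ⋆-homomorphism. -/
def mkHom : R →⋆ₙₐ[ℂ] I.Quotient where
  toFun := mk I
  map_smul' := mk_smul
  map_zero' := mk_zero
  map_add' := mk_add
  map_mul' := mk_mul
  map_star' := mk_star

/-- The ⋆-homomorphism `R / I → S / J` induced by a ⋆-homomorphism `R → S` mapping `I` into `J`. -/
def map {S : Type*} [NonUnitalRing S] [StarRing S] [Module ℂ S] {J : StarIdeal S}
    (f : R →⋆ₙₐ[ℂ] S) (h : ∀ x ∈ I.toSubmodule, f x ∈ J.toSubmodule) :
    I.Quotient →⋆ₙₐ[ℂ] J.Quotient where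
  toFun := _root_.Quotient.map f fun x x' hx => by
    have hx' : x - x' ∈ I.toSubmodule := (Submodule.quotientRel_def _).1 hx
    refine (Submodule.quotientRel_def _).2 ?_
    rw [← map_sub]
    exact h _ hx'
  map_smul' c a := by
    obtain ⟨a, rfl⟩ := mk_surjective a
    exact congrArg (mk J) (map_smul f c a)
  map_zero' := congrArg (mk J) (map_zero f)
  map_add' a b := by
    obtain ⟨a, rfl⟩ := mk_surjective a
    obtain ⟨b, rfl⟩ := mk_surjective b
    exact congrArg (mk J) (map_add f a b)
  map_mul' a b := by
    obtain ⟨a, rfl⟩ := mk_surjective a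
    obtain ⟨b, rfl⟩ := mk_surjective b
    exact congrArg (mk J) (map_mul f a b)
  map_star' a := by
    obtain ⟨a, rfl⟩ := mk_surjective a
    exact congrArg (mk J) (map_star f a)

@[simp] lemma map_mk {S : Type*} [NonUnitalRing S] [StarRing S] [Module ℂ S] {J : StarIdeal S}
    (f : R →⋆ₙₐ[ℂ] S) (h : ∀ x ∈ I.toSubmodule, f x ∈ J.toSubmodule) (x : R) :
    map (I := I) (J := J) f h (mk I x) = mk J (f x) := rfl

end Quotient
end StarIdeal
end Quotient

/-! ### Central sequence algebras and the Rokhlin property -/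

section Sequences
variable (A : Type*) [NonUnitalCStarAlgebra A]

/-- `ℓ^∞(ℕ, A)`. -/
abbrev EllInfty : Type _ := lp (fun _ : ℕ => A) ∞

/-- The ideal `c₀(ℕ, A)` of `ℓ^∞(ℕ, A)`. -/
def cZero : StarIdeal (EllInfty A) where
  carrier := {x | Tendsto (fun n => ‖x n‖) atTop (𝓝 0)}
  add_mem' {x y} hx hy :=
    squeeze_zero (fun _ => norm_nonneg _) (fun n => norm_add_le (x n) (y n))
      (by simpa using hx.add hy)
  zero_mem' := by simp
  smul_mem' c x hx := by
    have h : Tendsto (fun n => ‖c‖ * ‖x n‖) atTop (𝓝 0) := by simpa using hx.const_mul ‖c‖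
    exact h.congr fun n => (norm_smul c (x n)).symm
  mul_mem_left' x y hy := by
    have h : Tendsto (fun n => ‖x‖ * ‖y n‖) atTop (𝓝 0) := by simpa using hy.const_mul ‖x‖
    refine squeeze_zero (fun _ => norm_nonneg _) (fun n => ?_) h
    exact (norm_mul_le (x n) (y n)).trans
      (mul_le_mul_of_nonneg_right (lp.norm_apply_le_norm ENNReal.top_ne_zero x n) (norm_nonneg _))
  mul_mem_right' x y hx := by
    have h : Tendsto (fun n => ‖x n‖ * ‖y‖) atTop (𝓝 0) := by simpa using hx.mul_const ‖y‖
    refine squeeze_zero (fun _ => norm_nonneg _) (fun n => ?_) h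
    exact (norm_mul_le (x n) (y n)).trans
      (mul_le_mul_of_nonneg_left (lp.norm_apply_le_norm ENNReal.top_ne_zero y n) (norm_nonneg _))
  star_mem' x hx := hx.congr fun n => (norm_star (x n)).symm

/-- The sequence algebra `A_∞ = ℓ^∞(ℕ, A) / c₀(ℕ, A)`. -/
abbrev SeqAlg : Type _ := (cZero A).Quotient

variable {A}

/-- The class in `A_∞` of the constant sequence `a`. -/
def constSeq (a : A) : SeqAlg A :=
  StarIdeal.Quotient.mk (cZero A)
    ⟨fun _ => a, memℓp_infty ⟨‖a‖, by rintro _ ⟨_, rfl⟩; exact le_rfl⟩⟩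

/-- The relative commutant `A_∞ ∩ D'`, where `D ⊆ A` is identified with constant sequences. -/
def relCommutant (D : NonUnitalStarSubalgebra ℂ A) : NonUnitalStarSubalgebra ℂ (SeqAlg A) where
  carrier := {x | ∀ d ∈ D, x * constSeq d = constSeq d * x}
  add_mem' hx hy d hd := by rw [add_mul, mul_add, hx d hd, hy d hd]
  zero_mem' d _ := by rw [zero_mul, mul_zero]
  mul_mem' {x y} hx hy d hd := by rw [mul_assoc, hy d hd, ← mul_assoc, hx d hd, mul_assoc]
  smul_mem' c x hx d hd := by rw [smul_mul_assoc, mul_smul_comm, hx d hd]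
  star_mem' {x} hx d hd := by
    have h := congrArg star (hx (star d) (star_mem hd))
    rw [star_mul, star_mul] at h
    have hs : star (constSeq (star d)) = constSeq d := by
      rw [constSeq, constSeq, ← StarIdeal.Quotient.mk_star]
      congr 1
      exact Subtype.ext (funext fun _ => star_star d)
    rw [hs] at h
    exact h.symm

/-- The annihilator `Ann(D, A_∞)`, an ideal of `A_∞ ∩ D'`. -/
def annihilator (D : NonUnitalStarSubalgebra ℂ A) : StarIdeal (relCommutant D) where
  carrier := {x | ∀ d ∈ D, x.1 * constSeq d = 0 ∧ constSeq d * x.1 = 0}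
  add_mem' {x y} hx hy d hd := by
    change (x.1 + y.1) * _ = 0 ∧ _ * (x.1 + y.1) = 0
    rw [add_mul, mul_add, (hx d hd).1, (hx d hd).2, (hy d hd).1, (hy d hd).2, add_zero]
    exact ⟨rfl, rfl⟩
  zero_mem' d _ := ⟨zero_mul _, mul_zero _⟩
  smul_mem' c x hx d hd := by
    change (c • x.1) * _ = 0 ∧ _ * (c • x.1) = 0
    rw [smul_mul_assoc, mul_smul_comm, (hx d hd).1, (hx d hd).2, smul_zero]
    exact ⟨rfl, rfl⟩
  mul_mem_left' x y hy d hd := by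
    change (x.1 * y.1) * _ = 0 ∧ _ * (x.1 * y.1) = 0
    rw [mul_assoc, (hy d hd).1, ← mul_assoc, ← x.2 d hd, mul_assoc, (hy d hd).2, mul_zero]
    exact ⟨rfl, rfl⟩
  mul_mem_right' x y hx d hd := by
    change (x.1 * y.1) * _ = 0 ∧ _ * (x.1 * y.1) = 0
    rw [mul_assoc, y.2 d hd, ← mul_assoc, (hx d hd).1, ← mul_assoc, (hx d hd).2, zero_mul]
    exact ⟨rfl, rfl⟩
  star_mem' x hx d hd := by
    have h := hx (star d) (star_mem hd)
    have hs : star (constSeq (star d)) = constSeq d := by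
      rw [constSeq, constSeq, ← StarIdeal.Quotient.mk_star]
      congr 1
      exact Subtype.ext (funext fun _ => star_star d)
    change star x.1 * _ = 0 ∧ _ * star x.1 = 0
    rw [← hs, ← star_mul, ← star_mul, h.1, h.2, star_zero]
    exact ⟨rfl, rfl⟩

/-- `F(D, A) = (A_∞ ∩ D') / Ann(D, A_∞)`. -/
abbrev CentralSeqAlg (D : NonUnitalStarSubalgebra ℂ A) : Type _ := (annihilator D).Quotient

end Sequences

namespace CStarAction

section RokhlinProperty
variable {G : Type*} [Group G] [TopologicalSpace G] {A : Type*} [NonUnitalCStarAlgebra A]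
  (α : CStarAction G A)

/-- The automorphism `α^∞_g` of `ℓ^∞(ℕ, A)`, acting entrywise. -/
def ellInftyHom (g : G) : EllInfty A →⋆ₙₐ[ℂ] EllInfty A where
  toFun x := ⟨fun n => α g (x n), memℓp_infty ⟨‖x‖, by
    rintro _ ⟨n, rfl⟩
    exact (α.norm_apply g (x n)).le.trans (lp.norm_apply_le_norm ENNReal.top_ne_zero x n)⟩⟩
  map_smul' c x := Subtype.ext (funext fun n => map_smul (α g) c (x n))
  map_zero' := Subtype.ext (funext fun _ => map_zero (α g))
  map_add' x y := Subtype.ext (funext fun n => map_add (α g) (x n) (y n))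
  map_mul' x y := Subtype.ext (funext fun n => map_mul (α g) (x n) (y n))
  map_star' x := Subtype.ext (funext fun n => map_star (α g) (x n))

/-- The automorphism `(α_∞)_g` of `A_∞` induced by `α^∞_g`. -/
def seqHom (g : G) : SeqAlg A →⋆ₙₐ[ℂ] SeqAlg A :=
  StarIdeal.Quotient.map (α.ellInftyHom g) fun x hx =>
    Tendsto.congr (fun n => (α.norm_apply g (x n)).symm) hx

lemma seqHom_constSeq (g : G) (a : A) : α.seqHom g (constSeq a) = constSeq (α g a) := rfl

/-- `ℓ^∞_α(ℕ, A)`: the bounded sequences `x` for which `g ↦ α^∞_g(x)` is continuous. -/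
def ellInftyCont : NonUnitalStarSubalgebra ℂ (EllInfty A) where
  carrier := {x | Continuous fun g => α.ellInftyHom g x}
  add_mem' {x y} hx hy := by
    have h : Continuous fun g => α.ellInftyHom g x + α.ellInftyHom g y := hx.add hy
    simpa only [Set.mem_ofPred_eq, map_add] using h
  zero_mem' := by simpa only [Set.mem_ofPred_eq, map_zero] using continuous_const
  mul_mem' {x y} hx hy := by
    have h : Continuous fun g => α.ellInftyHom g x * α.ellInftyHom g y := hx.mul hy
    simpa only [Set.mem_ofPred_eq, map_mul] using h
  smul_mem' c x hx := by
    have h : Continuous fun g => c • α.ellInftyHom g x := hx.const_smul c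
    simpa only [Set.mem_ofPred_eq, map_smul] using h
  star_mem' {x} hx := by
    have h : Continuous fun g => star (α.ellInftyHom g x) := hx.star
    simpa only [Set.mem_ofPred_eq, map_star] using h

/-- `A_{∞,α}`: the image of `ℓ^∞_α(ℕ, A)` in `A_∞`. -/
def seqAlgCont : NonUnitalStarSubalgebra ℂ (SeqAlg A) :=
  α.ellInftyCont.map (StarIdeal.Quotient.mkHom (cZero A))

/-- `D ⊆ A` is `α`-invariant. -/
def Invariant (D : NonUnitalStarSubalgebra ℂ A) : Prop := ∀ g, ∀ d ∈ D, α g d ∈ D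

variable {D : NonUnitalStarSubalgebra ℂ A} (hD : α.Invariant D)

/-- The restriction of `(α_∞)_g` to `A_∞ ∩ D'`, for `α`-invariant `D`. -/
def commutantHom (hD : α.Invariant D) (g : G) : relCommutant D →⋆ₙₐ[ℂ] relCommutant D :=
  NonUnitalStarAlgHom.codRestrict
    ((α.seqHom g).comp (NonUnitalStarSubalgebraClass.subtype (relCommutant D))) (relCommutant D)
    fun x d hd => by
      have h := congrArg (α.seqHom g) (x.2 _ (hD g⁻¹ d hd))
      rw [map_mul, map_mul, seqHom_constSeq, ← mul_apply, mul_inv_cancel, one_apply] at h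
      exact h

/-- The automorphism `F(α)_g` of `F(D, A)` induced by `(α_∞)_g`, for `α`-invariant `D`. -/
def centralSeqHom (hD : α.Invariant D) (g : G) : CentralSeqAlg D →⋆ₙₐ[ℂ] CentralSeqAlg D :=
  StarIdeal.Quotient.map (α.commutantHom hD g) fun x hx d hd => by
    have h := hx _ (hD g⁻¹ d hd)
    have h1 := congrArg (α.seqHom g) h.1
    have h2 := congrArg (α.seqHom g) h.2
    rw [map_mul, map_zero, seqHom_constSeq, ← mul_apply, mul_inv_cancel, one_apply] at h1 h2
    exact ⟨h1, h2⟩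

/-- `F_α(D, A)`: the image of `A_{∞,α} ∩ D'` in `F(D, A)`. -/
def centralSeqCont (D : NonUnitalStarSubalgebra ℂ A) :
    NonUnitalStarSubalgebra ℂ (CentralSeqAlg D) :=
  (α.seqAlgCont.comap (NonUnitalStarSubalgebraClass.subtype (relCommutant D))).map
    (StarIdeal.Quotient.mkHom (annihilator D))

/-- Left translation on `C(G)`: `Lt_g(f)(h) = f(g⁻¹ h)`. -/
def leftTranslate [ContinuousMul G] (g : G) (f : C(G, ℂ)) : C(G, ℂ) :=
  f.comp ⟨fun h => g⁻¹ * h, continuous_const_mul _⟩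

/-- The Rokhlin property: for every separable `α`-invariant C⋆-subalgebra `D` of `A` there is an
equivariant unital ⋆-homomorphism `(C(G), Lt) → (F_α(D, A), F(α))`. -/
def HasRokhlinProperty [ContinuousMul G] : Prop :=
  ∀ (D : NonUnitalStarSubalgebra ℂ A) (hD : α.Invariant D), IsClosed (D : Set A) →
    TopologicalSpace.IsSeparable (D : Set A) →
    ∃ φ : C(G, ℂ) →⋆ₙₐ[ℂ] α.centralSeqCont D,
      (∀ x, φ 1 * x = x ∧ x * φ 1 = x) ∧
      ∀ g f, (φ (leftTranslate g f) : CentralSeqAlg D) = α.centralSeqHom hD g (φ f)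

end RokhlinProperty

end CStarAction
end

/-! Write `E` for the average over `G`, a conditional expectation of `A` onto `A^α`, and `o_a` for
the orbit function `s ↦ α_s(a)` in the convolution algebra. Two computations carry everything: `o_a
o_b⋆` is the constant function `E(a b⋆)`, and `o_a⋆ o_b = f_{a⋆,b}`. Constant functions with fixed
values form a copy of `A^α`, and the orbit functions form a right ideal of `C(G, A)`. Hence their
closure `X` in the crossed product is an `A^α`-`(A ⋊ G)`-bimodule with inner products `x y⋆` and `x⋆
y`. It is always full on the left, and it is full on the right exactly when the action is saturated,
so (2) follows from (1) (`imprimitivityBimodule`). The copy of `A^α` is faithful because of the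
regular representation of `C(G, A)` on `A` with the `A^α`-valued inner product `E(a⋆ b)`
(`fixedIncl_injective`).

Saturation. A function `ξ(g)` is, uniformly in `g` and `h`, close to a finite sum `∑ f_i(h)
k_i(g⁻¹h)`. Let `φ` be a Rokhlin map for the algebra generated by the orbit of `a`, and let `x_i`,
`y_i` be sequences lifting `φ(f_i)`, `φ(k_i)`. Equivariance and asymptotic centrality give `ξ(g) a ≈
∑ x_i α_g(y_i) a ≈ ∑ (x_i a) α_g(y_i)`, a sum of functions `f_{b,c}` (`exists_sum_coeff_approx`).
This is pointwise in `g` along a uniformly bounded sequence, so dominated convergence makes it an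
`L¹` approximation, which controls the norm of the crossed product.

Stable isomorphism. This is an explicit form of the Brown–Green–Rieffel theorem. Put `C = A^α`, `B =
A ⋊ G`, `S = B ⊗ 𝒦`. From a sequence in `X` one builds a single `t ∈ S` for which `t⋆ t S` is dense
in `S` and the closure of `t S t⋆` is `C ⊗ 𝒦`. Then `|t| s |t| ↦ t s t⋆` is an isometric
⋆-homomorphism between dense subalgebras (`nonempty_starAlgEquiv_of_dense`); it is conjugation by
the polar part of `t`, which itself is never needed. The element `t` is a weighted adjacency matrix
of a bipartite tree whose weights decrease so fast that at each vertex other than the root the edge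
to the parent dominates all edges to children. Rescaling then isolates every single matrix unit in
the closures of `t S` and `t⋆ S` (`tendsto_op_mul`, `tendsto_star_op_mul`). -/

noncomputable section

open scoped Topology ENNReal
open Filter MeasureTheory UniformSpace

/-! ### Generalities on C⋆-algebras -/

section CStarGeneral

/-- An injective ⋆-homomorphism of C⋆-algebras reflects positivity. -/
lemma exists_eq_star_mul_self_of_map {C B : Type*} [NonUnitalCStarAlgebra C]
    [NonUnitalCStarAlgebra B] (φ : C →⋆ₙₐ[ℂ] B) (hφ : Function.Injective φ) {c : C} {b : B}
    (h : φ c = star b * b) : ∃ a, c = star a * a := by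
  let _ := CStarAlgebra.spectralOrder C
  let _ := CStarAlgebra.spectralOrderedRing C
  let _ := CStarAlgebra.spectralOrder B
  let _ := CStarAlgebra.spectralOrderedRing B
  have hsa : IsSelfAdjoint c := hφ (by rw [map_star, h, star_mul, star_star])
  have hmap : ∀ x : C, 0 ≤ x → 0 ≤ φ x := fun x hx => by
    obtain ⟨y, rfl⟩ := CStarAlgebra.nonneg_iff_eq_star_mul_self.1 hx
    rw [map_mul, map_star]
    exact star_mul_self_nonneg _
  -- The images of `c⁺` and `c⁻` are positive, orthogonal and have difference `φ c`, so by
  -- uniqueness they are the positive and negative parts of `φ c`. The latter is positive, hence `φ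
  -- c⁻ = 0`.
  have hu := CFC.posPart_negPart_unique (a := φ c) (b := φ c⁺) (c := φ c⁻)
    (by rw [← map_sub, CFC.posPart_sub_negPart c]) (by rw [← map_mul, CFC.posPart_mul_negPart, map_zero])
    (hmap _ (CFC.posPart_nonneg c)) (hmap _ (CFC.negPart_nonneg c))
  have h0 : (φ c)⁻ = 0 :=
    (CFC.negPart_eq_zero_iff _ (by rw [h]; exact IsSelfAdjoint.star_mul_self b)).2
      (h ▸ star_mul_self_nonneg b)
  have hc : c⁻ = 0 := hφ (by rw [map_zero, ← hu.2, h0])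
  exact CStarAlgebra.nonneg_iff_eq_star_mul_self.1 ((CFC.negPart_eq_zero_iff c hsa).1 hc)

/-- Both sides square to the norm of `y⋆ (r⋆ r) y`. This lets `|t|` stand in for `t` in norm
computations. -/
lemma norm_mul_eq_of_star_mul_self_eq {S : Type*} [NonUnitalCStarAlgebra S] {r t : S}
    (h : star r * r = star t * t) (y : S) : ‖r * y‖ = ‖t * y‖ := by
  have : ‖r * y‖ * ‖r * y‖ = ‖t * y‖ * ‖t * y‖ := by
    rw [← CStarRing.norm_star_mul_self, ← CStarRing.norm_star_mul_self, star_mul, star_mul,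
      mul_assoc, mul_assoc, ← mul_assoc (star r), h, ← mul_assoc (star t)]
  exact (mul_self_inj (norm_nonneg _) (norm_nonneg _)).1 this

/-- A linear bijection between dense ⋆-subalgebras that is isometric, multiplicative and
⋆-preserving extends to an isomorphism of C⋆-algebras. -/
lemma nonempty_starAlgEquiv_of_denseRange {V S S' : Type*} [AddCommGroup V] [Module ℂ V]
    [NonUnitalCStarAlgebra S] [NonUnitalCStarAlgebra S'] (u : V →ₗ[ℂ] S) (v : V →ₗ[ℂ] S')
    (hn : ∀ c, ‖v c‖ = ‖u c‖) (hu : DenseRange u) (hv : DenseRange v)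
    (m : V → V → V) (hum : ∀ c d, u (m c d) = u c * u d) (hvm : ∀ c d, v (m c d) = v c * v d)
    (σ : V → V) (hus : ∀ c, u (σ c) = star (u c)) (hvs : ∀ c, v (σ c) = star (v c)) :
    Nonempty (S ≃⋆ₐ[ℂ] S') := by
  let e : S ≃ₗᵢ[ℂ] S' := (LinearEquiv.refl ℂ V).extendOfIsometry u v hu hv hn
  have he : ∀ c, e (u c) = v c := LinearEquiv.extendOfIsometry_eq (LinearEquiv.refl ℂ V) u v hu hv hn
  have hmul : ∀ x y, e (x * y) = e x * e y := fun x y => by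
    refine hu.induction_on₂ (p := fun x y => e (x * y) = e x * e y) ?_ ?_ x y
    · exact isClosed_eq (e.continuous.comp continuous_mul)
        ((e.continuous.comp continuous_fst).mul (e.continuous.comp continuous_snd))
    · intro c d
      rw [← hum, he, he, he, hvm]
  have hstar : ∀ x, e (star x) = star (e x) := fun x => by
    refine hu.induction_on (p := fun x => e (star x) = star (e x)) x ?_ ?_
    · exact isClosed_eq (e.continuous.comp continuous_star) (continuous_star.comp e.continuous)
    · intro c
      rw [← hus, he, he, hvs]
  exact ⟨{ toFun := e, invFun := e.symm, left_inv := e.symm_apply_apply,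
           right_inv := e.apply_symm_apply, map_mul' := hmul, map_add' := map_add e,
           map_star' := hstar, map_smul' := map_smul e }⟩

/-- If `t⋆ t S` is dense in `S`, then `S` is isomorphic to the hereditary C⋆-subalgebra
`closure (t S t⋆)`. -/
lemma nonempty_starAlgEquiv_of_dense {S S' : Type*} [NonUnitalCStarAlgebra S]
    [NonUnitalCStarAlgebra S'] (t : S) (ht : DenseRange fun s => star t * t * s)
    (ψ : S' →⋆ₙₐ[ℂ] S) (hψ : Function.Injective ψ)
    (h1 : ∀ s, t * s * star t ∈ Set.range ψ)
    (h2 : Set.range ψ ⊆ closure (Set.range fun s => t * s * star t)) :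
    Nonempty (S ≃⋆ₐ[ℂ] S') := by
  let _ := CStarAlgebra.spectralOrder S
  let _ := CStarAlgebra.spectralOrderedRing S
  have hiso : Isometry ψ := NonUnitalStarAlgHom.isometry ψ hψ
  set r : S := CFC.abs t with hr
  have hrs : star r = r := (CFC.abs_nonneg t).isSelfAdjoint
  have hrr : r * r = star t * t := CFC.abs_mul_abs t
  have hnorm : ∀ y, ‖r * y‖ = ‖t * y‖ := norm_mul_eq_of_star_mul_self_eq (by rw [hrs, hrr])
  choose w hw using h1
  let u : S →ₗ[ℂ] S :=
    { toFun := fun c => r * c * r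
      map_add' := fun c d => by rw [mul_add, add_mul]
      map_smul' := fun k c => by rw [mul_smul_comm, smul_mul_assoc]; rfl }
  let v : S →ₗ[ℂ] S' :=
    { toFun := w
      map_add' := fun c d => hψ (by rw [map_add, hw, hw, hw, mul_add, add_mul])
      map_smul' := fun k c => hψ (by
        rw [map_smul, hw, hw, mul_smul_comm, smul_mul_assoc]; rfl) }
  have hr1 : DenseRange fun s => r * s := by
    refine ht.mono ?_
    rintro _ ⟨s, rfl⟩
    exact ⟨r * s, by simp only [← mul_assoc, hrr]⟩
  have hr2 : DenseRange fun s => s * r := by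
    have := hr1.comp (star_involutive (R := S)).surjective.denseRange (continuous_const_mul r)
    have := (star_involutive (R := S)).surjective.denseRange.comp this continuous_star
    refine this.mono ?_
    rintro _ ⟨s, rfl⟩
    exact ⟨s, by simp [hrs]⟩
  refine nonempty_starAlgEquiv_of_denseRange u v ?_ ?_ ?_
    -- Both maps turn the product `c (r r) d` on the parameter space into multiplication, because `r
    -- r = t⋆ t`.
    (fun c d => c * (r * r) * d) ?_ ?_ star ?_ ?_
  · intro c
    have : ‖ψ (w c)‖ = ‖w c‖ := hiso.norm_map_of_map_zero (map_zero ψ) _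
    change ‖w c‖ = ‖r * c * r‖
    rw [← this, hw, mul_assoc, ← hnorm, ← norm_star, ← mul_assoc, star_mul, star_star, star_mul, hrs,
      ← hnorm, ← norm_star, star_mul, star_mul, hrs, star_star]
  · exact (hr1.comp hr2 (continuous_const_mul r)).mono (by
      rintro _ ⟨s, rfl⟩; exact ⟨s, mul_assoc _ _ _⟩)
  · intro x
    rw [hiso.isUniformInducing.isInducing.closure_eq_preimage_closure_image, Set.mem_preimage]
    refine closure_mono ?_ (h2 ⟨x, rfl⟩)
    rintro _ ⟨s, rfl⟩
    exact ⟨w s, ⟨s, rfl⟩, hw s⟩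
  · intro c d
    change r * (c * (r * r) * d) * r = r * c * r * (r * d * r)
    simp only [mul_assoc]
  · intro c d
    refine hψ ?_
    change ψ (w _) = ψ (w _ * w _)
    rw [map_mul, hw, hw, hw, hrr]
    simp only [mul_assoc]
  · intro c
    change r * star c * r = star (r * c * r)
    rw [star_mul, star_mul, hrs, mul_assoc]
  · intro c
    refine hψ ?_
    change ψ (w _) = ψ (star (w _))
    rw [map_star, hw, hw, star_mul, star_mul, star_star, mul_assoc]

end CStarGeneral

namespace CStarAction

/-! ### Averaging over the group -/

section Average
variable {G : Type*} [Group G] [TopologicalSpace G] [IsTopologicalGroup G] [CompactSpace G]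
  [T2Space G] [SecondCountableTopology G] [MeasurableSpace G] [BorelSpace G]
  {A : Type*} [NonUnitalCStarAlgebra A] (α : CStarAction G A)

instance : IsProbabilityMeasure (haarProb G) := ⟨Measure.haarMeasure_self (K₀ := ⊤)⟩

/-- Compact groups are unimodular: a right translate of the normalized Haar measure is again a left
Haar probability measure, and such a measure is unique. -/
instance : (haarProb G).IsMulRightInvariant where
  map_mul_right_eq_self g := by
    have : IsProbabilityMeasure ((haarProb G).map (· * g)) :=
      Measure.isProbabilityMeasure_map (by fun_prop)
    exact Measure.isHaarMeasure_eq_of_isProbabilityMeasure _ _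

/-- The average `∫ α_t(a) dt` of `a` over the action. -/
def avg : A →L[ℂ] A :=
  LinearMap.mkContinuous
    { toFun := fun a => ∫ t, α t a ∂haarProb G
      map_add' := fun a b => by
        simp only [map_add]
        exact integral_add (Conv.integrable (α.continuous_apply' a))
          (Conv.integrable (α.continuous_apply' b))
      map_smul' := fun c a => by
        simp only [map_smul]
        exact integral_smul c _ } 1 fun a => by
      refine (norm_integral_le_of_norm_le_const (C := ‖a‖)
        (ae_of_all _ fun t => (α.norm_apply t a).le)).trans ?_
      simp

lemma avg_apply (a : A) : α.avg a = ∫ t, α t a ∂haarProb G := rfl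

lemma apply_avg (g : G) (a : A) : α g (α.avg a) = α.avg a := by
  rw [avg_apply, ← Conv.integral_act g (α.continuous_apply' a)]
  simp only [← mul_apply]
  exact integral_mul_left_eq_self (fun t => α t a) g

lemma avg_mem (a : A) : α.avg a ∈ α.fixedPoints := fun g => α.apply_avg g a

lemma avg_map (g : G) (a : A) : α.avg (α g a) = α.avg a := by
  simp only [avg_apply, ← mul_apply]
  exact integral_mul_right_eq_self (fun t => α t a) g

lemma avg_of_mem {a : A} (ha : a ∈ α.fixedPoints) : α.avg a = a := by
  rw [avg_apply]
  simp only [ha _]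
  simp

/-- With `star_avg` this makes the average an `A^α`-bimodule map, so that `⟨a, b⟩ = avg (star a *
b)` behaves as an `A^α`-valued inner product on `A`. -/
lemma avg_mul_of_mem (a : A) {z : A} (hz : z ∈ α.fixedPoints) : α.avg (a * z) = α.avg a * z := by
  simp only [avg_apply, map_mul, hz _]
  exact Conv.integral_mul_right' z (α.continuous_apply' a)

lemma star_avg (a : A) : star (α.avg a) = α.avg (star a) := by
  have := (((starL' ℝ : A ≃L[ℝ] A).toContinuousLinearMap).integral_comp_comm
    (Conv.integrable (α.continuous_apply' a))).symm
  refine this.trans ?_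
  rw [avg_apply]
  simp only [map_star]
  rfl

lemma norm_avg_le (a : A) : ‖α.avg a‖ ≤ ‖a‖ := by
  refine (norm_integral_le_of_norm_le_const (C := ‖a‖)
    (ae_of_all _ fun t => (α.norm_apply t a).le)).trans ?_
  simp

section Order
variable [PartialOrder A] [StarOrderedRing A]

lemma avg_nonneg {a : A} (ha : 0 ≤ a) : 0 ≤ α.avg a :=
  integral_nonneg fun t => by
    obtain ⟨y, rfl⟩ := CStarAlgebra.nonneg_iff_eq_star_mul_self.1 ha
    simp only [map_mul, map_star]
    exact star_mul_self_nonneg _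

lemma avg_mono {a b : A} (h : a ≤ b) : α.avg a ≤ α.avg b := by
  rw [← sub_nonneg, ← map_sub]
  exact α.avg_nonneg (sub_nonneg.2 h)

end Order

/-- The seminorm `‖∫ α_t(a⋆ a) dt‖^{1/2}`. -/
def avgNorm (a : A) : ℝ := √‖α.avg (star a * a)‖

lemma avgNorm_nonneg (a : A) : 0 ≤ α.avgNorm a := Real.sqrt_nonneg _

lemma avgNorm_sq (a : A) : α.avgNorm a ^ 2 = ‖α.avg (star a * a)‖ := Real.sq_sqrt (norm_nonneg _)

lemma avgNorm_of_mem {a : A} (ha : a ∈ α.fixedPoints) : α.avgNorm a = ‖a‖ := by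
  rw [avgNorm, α.avg_of_mem (mul_mem (star_mem ha) ha), CStarRing.norm_star_mul_self,
    Real.sqrt_mul_self (norm_nonneg _)]

lemma avgNorm_map (g : G) (a : A) : α.avgNorm (α g a) = α.avgNorm a := by
  rw [avgNorm, ← map_star, ← map_mul, avg_map, avgNorm]

/-- Averaging and the norm both respect `a⋆ c⋆ c a ≤ ‖c‖² a⋆ a`. -/
lemma avgNorm_mul_le (c a : A) : α.avgNorm (c * a) ≤ ‖c‖ * α.avgNorm a := by
  let _ := CStarAlgebra.spectralOrder A
  let _ := CStarAlgebra.spectralOrderedRing A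
  rw [avgNorm, ← Real.sqrt_sq (norm_nonneg c), avgNorm, ← Real.sqrt_mul (sq_nonneg _)]
  refine Real.sqrt_le_sqrt ?_
  have h : star (c * a) * (c * a) ≤ (‖c‖ ^ 2) • (star a * a) := by
    have := CStarAlgebra.star_left_conjugate_le_norm_smul (a := a) (b := star c * c)
    rw [CStarRing.norm_star_mul_self, ← sq] at this
    simpa only [star_mul, mul_assoc] using this
  have h2 := CStarAlgebra.norm_le_norm_of_nonneg_of_le
    (α.avg_nonneg (star_mul_self_nonneg _)) (α.avg_mono h)
  rwa [map_real_smul α.avg α.avg.continuous, norm_smul, Real.norm_of_nonneg (sq_nonneg _)] at h2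

/-- The Cauchy–Schwarz inequality of Hilbert modules. With `z = ⟨a, b⟩` and `K = ‖⟨a, a⟩‖`,
expanding `0 ≤ ⟨b - t a z, b - t a z⟩` and bounding `z⋆ ⟨a, a⟩ z` by `K z⋆ z` gives `(2t - t² K) z⋆
z ≤ ⟨b, b⟩` for all real `t`. -/
lemma norm_avg_star_mul_le (a b : A) : ‖α.avg (star a * b)‖ ≤ α.avgNorm a * α.avgNorm b := by
  let _ := CStarAlgebra.spectralOrder A
  let _ := CStarAlgebra.spectralOrderedRing A
  set z := α.avg (star a * b) with hz
  set K := ‖α.avg (star a * a)‖ with hK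
  have hzm : z ∈ α.fixedPoints := α.avg_mem _
  have hzs : star z = α.avg (star b * a) := by rw [hz, star_avg, star_mul, star_star]
  have key : ∀ t : ℝ, (2 * t - t ^ 2 * K) • (star z * z) ≤ α.avg (star b * b) := by
    intro t
    have h0 : 0 ≤ α.avg (star (b - (t : ℂ) • (a * z)) * (b - (t : ℂ) • (a * z))) :=
      α.avg_nonneg (star_mul_self_nonneg _)
    have h1 : star (b - (t : ℂ) • (a * z)) * (b - (t : ℂ) • (a * z)) =
        star b * b - (t : ℂ) • (star b * a * z) - (t : ℂ) • star (star b * a * z)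
          + (t : ℂ) • ((t : ℂ) • star (star z * (star a * a) * z)) := by
      simp only [star_sub, star_smul, star_mul, star_star, sub_mul, mul_sub, smul_mul_assoc,
        mul_smul_comm, mul_assoc, Complex.star_def, Complex.conj_ofReal, smul_sub]
      abel
    have h2 : α.avg (star (star z * (star a * a) * z)) = star z * α.avg (star a * a) * z := by
      rw [← star_avg, avg_mul_of_mem _ _ hzm, ← star_star (α.avg (star z * (star a * a))),
        star_avg, star_mul, star_mul, star_star, star_star, avg_mul_of_mem _ _ hzm]
      simp only [star_mul, star_star, mul_assoc]
    rw [h1, map_add, map_sub, map_sub, map_smul, map_smul, map_smul, map_smul, h2, ← star_avg,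
      avg_mul_of_mem _ _ hzm, ← hzs, star_mul, star_star] at h0
    have h3 : star z * α.avg (star a * a) * z ≤ K • (star z * z) :=
      CStarAlgebra.star_left_conjugate_le_norm_smul
        (hb := (α.avg_nonneg (star_mul_self_nonneg a)).isSelfAdjoint)
    have h4 := smul_le_smul_of_nonneg_left h3 (sq_nonneg t)
    simp only [Complex.coe_smul, smul_smul, ← sq] at h0
    have h5 := h0.trans (add_le_add_right h4 _)
    rw [← sub_nonneg]
    refine h5.trans (le_of_eq ?_)
    rw [sub_smul, smul_smul, mul_smul 2 t, ofNat_smul_eq_nsmul ℝ 2, two_nsmul]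
    abel
  have key2 : ∀ t : ℝ, (2 * t - t ^ 2 * K) * ‖z‖ ^ 2 ≤ α.avgNorm b ^ 2 := by
    intro t
    rcases le_or_gt (2 * t - t ^ 2 * K) 0 with h | h
    · exact (mul_nonpos_of_nonpos_of_nonneg h (sq_nonneg _)).trans (sq_nonneg _)
    · have := CStarAlgebra.norm_le_norm_of_nonneg_of_le
        (smul_nonneg h.le (star_mul_self_nonneg z)) (key t)
      rwa [norm_smul, CStarRing.norm_star_mul_self, ← sq, Real.norm_of_nonneg h.le,
        ← avgNorm_sq] at this
  refine abs_le_of_sq_le_sq' ?_ (mul_nonneg (α.avgNorm_nonneg a) (α.avgNorm_nonneg b)) |>.2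
  rw [mul_pow, avgNorm_sq α a, ← hK]
  -- The coefficient `2t - t² K` is largest at `t = K⁻¹`. For `K = 0` it is `2t`, which is unbounded
  -- and forces `z = 0`.
  rcases (norm_nonneg (α.avg (star a * a))).eq_or_lt with h | h
  · rw [← hK] at h
    rw [← h, zero_mul]
    by_contra hcon
    push Not at hcon
    have := key2 ((α.avgNorm b ^ 2 + 1) / ‖z‖ ^ 2)
    rw [← h, mul_zero, sub_zero, mul_assoc, div_mul_cancel₀ _ hcon.ne'] at this
    nlinarith [sq_nonneg (α.avgNorm b)]
  · have := key2 K⁻¹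
    have hK0 : K ≠ 0 := h.ne'
    have e : 2 * K⁻¹ - K⁻¹ ^ 2 * K = K⁻¹ := by field_simp; norm_num
    rw [e, inv_mul_le_iff₀ h] at this
    exact this

lemma avgNorm_add_le (a b : A) : α.avgNorm (a + b) ≤ α.avgNorm a + α.avgNorm b := by
  refine abs_le_of_sq_le_sq' ?_ (add_nonneg (α.avgNorm_nonneg a) (α.avgNorm_nonneg b)) |>.2
  have h : star (a + b) * (a + b) =
      star a * a + star a * b + (star b * a + star b * b) := by
    rw [star_add, add_mul, mul_add, mul_add]
  rw [avgNorm_sq, h, map_add, map_add, map_add]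
  calc _ ≤ (‖α.avg (star a * a)‖ + ‖α.avg (star a * b)‖)
        + (‖α.avg (star b * a)‖ + ‖α.avg (star b * b)‖) :=
        (norm_add_le _ _).trans (add_le_add (norm_add_le _ _) (norm_add_le _ _))
    _ ≤ _ := by
      rw [← avgNorm_sq, ← avgNorm_sq]
      nlinarith [α.norm_avg_star_mul_le a b, α.norm_avg_star_mul_le b a]

end Average
end CStarAction

namespace CStarAction

section Regular
set_option linter.unusedSectionVars false
variable {G : Type*} [Group G] [TopologicalSpace G] [IsTopologicalGroup G] [CompactSpace G]
  [T2Space G] [SecondCountableTopology G] [MeasurableSpace G] [BorelSpace G]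
  {A : Type*} [NonUnitalCStarAlgebra A] (α : CStarAction G A)

/-! ### Distinguished elements of the convolution algebra -/

/-- The constant function `a`, as an element of the convolution algebra. -/
def constConv (a : A) : α.Conv := (ContinuousMap.const G a : C(G, A))

/-- The function `s ↦ α_s(a)`, as an element of the convolution algebra. -/
def orbitConv (a : A) : α.Conv := (⟨fun s => α s a, α.continuous_apply' a⟩ : C(G, A))

/-- The function `s ↦ a α_s(b)`, as an element of the convolution algebra. -/
def coeffConv (a b : A) : α.Conv := α.coeff a b

@[simp] lemma constConv_apply (a : A) (s : G) : α.constConv a s = a := rfl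
@[simp] lemma orbitConv_apply (a : A) (s : G) : α.orbitConv a s = α s a := rfl
@[simp] lemma coeffConv_apply (a b : A) (s : G) : α.coeffConv a b s = a * α s b := rfl

lemma constConv_add (a b : A) : α.constConv (a + b) = α.constConv a + α.constConv b := rfl
lemma constConv_smul (c : ℂ) (a : A) : α.constConv (c • a) = c • α.constConv a := rfl
lemma orbitConv_add (a b : A) : α.orbitConv (a + b) = α.orbitConv a + α.orbitConv b :=
  Conv.ext fun s => map_add (α s) a b
lemma orbitConv_smul (c : ℂ) (a : A) : α.orbitConv (c • a) = c • α.orbitConv a :=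
  Conv.ext fun s => map_smul (α s) c a

lemma constConv_injective : Function.Injective α.constConv := fun a b h => by
  have := congrArg (fun f : α.Conv => f 1) h
  simpa using this

lemma constConv_eq_orbitConv {a : A} (ha : a ∈ α.fixedPoints) :
    α.constConv a = α.orbitConv a := Conv.ext fun s => (ha s).symm

lemma star_constConv (a : A) : star (α.constConv a) = α.orbitConv (star a) := rfl

lemma star_orbitConv (a : A) : star (α.orbitConv a) = α.constConv (star a) := by
  ext s
  rw [Conv.star_apply, orbitConv_apply, constConv_apply, ← map_star, ← mul_apply, mul_inv_cancel,
    one_apply]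

/-- This identity and `constConv_mul_orbitConv` are the two inner products of the bimodule, because
the adjoint of an orbit function is a constant function. -/
lemma orbitConv_mul_constConv (a b : A) :
    α.orbitConv a * α.constConv b = α.constConv (α.avg (a * b)) := by
  ext s
  simp only [Conv.mul_apply, constConv_apply, orbitConv_apply, avg_apply, map_mul]

lemma constConv_mul_orbitConv (a b : A) :
    α.constConv a * α.orbitConv b = α.coeffConv a b := by
  ext s
  simp only [Conv.mul_apply, constConv_apply, orbitConv_apply, coeffConv_apply, ← mul_apply,
    mul_inv_cancel_left]
  simp

lemma coeffConv_of_mem {a : A} (ha : a ∈ α.fixedPoints) (b : A) :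
    α.coeffConv a b = α.orbitConv (a * b) := by
  ext s
  rw [coeffConv_apply, orbitConv_apply, map_mul, ha s]

/-- The orbit functions form a right ideal: substitute `s t` for `t` in the convolution integral and
pull `α_s` out. -/
lemma orbitConv_mul (a : A) (f : α.Conv) :
    α.orbitConv a * f = α.orbitConv (∫ t, α t (a * f t⁻¹) ∂haarProb G) := by
  ext s
  have hc : Continuous fun t => α t (a * f t⁻¹) :=
    α.continuous_comp continuous_id (continuous_const.mul (f.continuous.comp continuous_inv))
  rw [orbitConv_apply, ← Conv.integral_act s hc, Conv.mul_apply,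
    ← integral_mul_left_eq_self (fun t => α.orbitConv a t * α t (f (t⁻¹ * s))) s]
  congr 1 with t
  rw [orbitConv_apply, ← map_mul, mul_apply, mul_inv_rev, inv_mul_cancel_right]

/-! ### The regular representation -/

/-- The action `a ↦ ∫ f(t) α_t(a) dt` of the convolution algebra on `A`. -/
def convAct (f : α.Conv) (a : A) : A := ∫ t, f t * α t a ∂haarProb G

/-- The constant functions form a left ideal, identified with `A`, on which the convolution algebra
acts by left multiplication. Linearity, multiplicativity and the adjoint relation of `convAct`
therefore reduce to ring identities. -/
lemma mul_constConv (f : α.Conv) (a : A) :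
    f * α.constConv a = α.constConv (α.convAct f a) := rfl

lemma convAct_add_right (f : α.Conv) (a b : A) :
    α.convAct f (a + b) = α.convAct f a + α.convAct f b :=
  α.constConv_injective (by simp only [← mul_constConv, constConv_add, mul_add])

lemma convAct_smul_right (f : α.Conv) (c : ℂ) (a : A) :
    α.convAct f (c • a) = c • α.convAct f a :=
  α.constConv_injective (by simp only [← mul_constConv, constConv_smul, mul_smul_comm])

lemma convAct_add_left (f h : α.Conv) (a : A) :
    α.convAct (f + h) a = α.convAct f a + α.convAct h a :=
  α.constConv_injective (by simp only [← mul_constConv, constConv_add, add_mul])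

lemma convAct_smul_left (c : ℂ) (f : α.Conv) (a : A) :
    α.convAct (c • f) a = c • α.convAct f a :=
  α.constConv_injective (by simp only [← mul_constConv, constConv_smul, smul_mul_assoc])

lemma convAct_mul (f h : α.Conv) (a : A) :
    α.convAct (f * h) a = α.convAct f (α.convAct h a) :=
  α.constConv_injective (by simp only [← mul_constConv, mul_assoc])

/-- `convAct (star f)` is adjoint to `convAct f` for the inner product `⟨a, b⟩ = avg (star a * b)`,
since that inner product is the convolution `(const a)⋆ * const b`. -/
lemma avg_star_convAct_mul (f : α.Conv) (a b : A) :
    α.avg (star (α.convAct f a) * b) = α.avg (star a * α.convAct (star f) b) :=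
  α.constConv_injective (by
    simp only [← orbitConv_mul_constConv, ← star_constConv, ← mul_constConv, star_mul, mul_assoc])

lemma convAct_constConv (a b : A) : α.convAct (α.constConv a) b = a * α.avg b :=
  Conv.integral_mul_left' a (α.continuous_apply' b)

/-- With `c = convAct f a`, the integral is expanded only in the second slot of `⟨c, c⟩`.
Cauchy–Schwarz and invariance of `avgNorm` bound the integrand by `avgNorm c * ‖f t‖ * avgNorm a`,
and one factor `avgNorm c` cancels. -/
lemma avgNorm_convAct_le (f : α.Conv) (a : A) :
    α.avgNorm (α.convAct f a) ≤ Conv.normL1 f * α.avgNorm a := by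
  have hf : Continuous fun t => f t * α t a := f.continuous.mul (α.continuous_apply' a)
  rcases (α.avgNorm_nonneg (α.convAct f a)).eq_or_lt with h | h
  · rw [← h]
    exact mul_nonneg (integral_nonneg fun _ => norm_nonneg _) (α.avgNorm_nonneg a)
  refine le_of_mul_le_mul_left ?_ h
  rw [← sq, avgNorm_sq]
  have e : α.avg (star (α.convAct f a) * α.convAct f a) =
      ∫ t, α.avg (star (α.convAct f a) * (f t * α t a)) ∂haarProb G := by
    conv_lhs => rw [convAct.eq_1 α f a]
    exact (((α.avg).comp (ContinuousLinearMap.mul ℂ A (star (α.convAct f a)))).integral_comp_comm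
      (Conv.integrable hf)).symm
  rw [e]
  have hi : Integrable (fun t => α.avgNorm (α.convAct f a) * (‖f t‖ * α.avgNorm a)) (haarProb G) :=
    ((f.continuous.norm.mul continuous_const).const_mul
      (α.avgNorm (α.convAct f a))).integrable_of_hasCompactSupport
      (HasCompactSupport.of_compactSpace _)
  refine (norm_integral_le_of_norm_le hi (ae_of_all _ fun t => ?_)).trans (le_of_eq ?_)
  · refine (α.norm_avg_star_mul_le _ _).trans
      (mul_le_mul_of_nonneg_left ?_ (α.avgNorm_nonneg _))
    exact (α.avgNorm_mul_le _ _).trans (by rw [avgNorm_map])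
  · rw [integral_const_mul, integral_mul_const, Conv.normL1]

lemma avgNorm_smul (c : ℂ) (a : A) : α.avgNorm (c • a) = ‖c‖ * α.avgNorm a := by
  rw [avgNorm, star_smul, smul_mul_smul_comm, map_smul, norm_smul, norm_mul, norm_star, avgNorm,
    Real.sqrt_mul (mul_nonneg (norm_nonneg _) (norm_nonneg _)), Real.sqrt_mul_self (norm_nonneg _)]

/-- `A`, seminormed by `avgNorm`. -/
def AvgSpace (_α : CStarAction G A) : Type _ := A

namespace AvgSpace

instance : AddCommGroup α.AvgSpace := inferInstanceAs (AddCommGroup A)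
instance : Module ℂ α.AvgSpace := inferInstanceAs (Module ℂ A)

instance : SeminormedAddCommGroup α.AvgSpace :=
  AddGroupSeminorm.toSeminormedAddCommGroup
    (Seminorm.of (𝕜 := ℂ) α.avgNorm α.avgNorm_add_le α.avgNorm_smul).toAddGroupSeminorm

instance : NormedSpace ℂ α.AvgSpace where
  __ := (inferInstance : Module ℂ α.AvgSpace)
  norm_smul_le c x := (α.avgNorm_smul c x).le

end AvgSpace

/-- The operator `a ↦ ∫ f(t) α_t(a) dt` on `A` seminormed by `avgNorm`. -/
def regular (f : α.Conv) : α.AvgSpace →L[ℂ] α.AvgSpace :=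
  LinearMap.mkContinuous
    { toFun := α.convAct f
      map_add' := α.convAct_add_right f
      map_smul' := α.convAct_smul_right f } (Conv.normL1 f) (α.avgNorm_convAct_le f)

lemma avgNorm_convAct_le_regular (f : α.Conv) (a : A) :
    α.avgNorm (α.convAct f a) ≤ ‖α.regular f‖ * α.avgNorm a :=
  (α.regular f).le_opNorm (show α.AvgSpace from a)

lemma regular_mul (f h : α.Conv) : α.regular (f * h) = (α.regular f).comp (α.regular h) :=
  ContinuousLinearMap.ext fun a => α.convAct_mul f h a

/-- The usual proof of the C⋆-inequality for adjointable operators: `⟨f a, f a⟩ = ⟨a, f⋆ f a⟩`, then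
Cauchy–Schwarz. -/
lemma norm_regular_sq_le (f : α.Conv) : ‖α.regular f‖ ^ 2 ≤ ‖α.regular (star f * f)‖ := by
  refine (Real.le_sqrt (norm_nonneg _) (norm_nonneg _)).1 ?_
  refine (α.regular f).opNorm_le_bound (Real.sqrt_nonneg _) fun (a : A) => ?_
  change α.avgNorm (α.convAct f a) ≤ _ * α.avgNorm a
  refine abs_le_of_sq_le_sq' ?_ (mul_nonneg (Real.sqrt_nonneg _) (α.avgNorm_nonneg a)) |>.2
  rw [mul_pow, Real.sq_sqrt (norm_nonneg _), avgNorm_sq, avg_star_convAct_mul, ← convAct_mul]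
  refine (α.norm_avg_star_mul_le _ _).trans ?_
  nlinarith [α.avgNorm_convAct_le_regular (star f * f) a, α.avgNorm_nonneg a]

lemma norm_regular_mul_le (f h : α.Conv) :
    ‖α.regular (f * h)‖ ≤ ‖α.regular f‖ * ‖α.regular h‖ := by
  rw [regular_mul]
  exact ContinuousLinearMap.opNorm_comp_le _ _

lemma norm_regular_le_star (f : α.Conv) : ‖α.regular f‖ ≤ ‖α.regular (star f)‖ := by
  rcases (norm_nonneg (α.regular f)).eq_or_lt with h | h
  · rw [← h]; exact norm_nonneg _
  · refine le_of_mul_le_mul_right ?_ h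
    rw [← sq]
    exact (α.norm_regular_sq_le f).trans (α.norm_regular_mul_le _ _)

/-- The C⋆-seminorm of the regular representation. -/
def regularSeminorm : CStarSeminorm α.Conv where
  toSeminorm := Seminorm.of (fun f => ‖α.regular f‖)
    (fun f h => by
      have : α.regular (f + h) = α.regular f + α.regular h :=
        ContinuousLinearMap.ext fun a => α.convAct_add_left f h a
      rw [this]; exact norm_add_le _ _)
    (fun c f => by
      have : α.regular (c • f) = c • α.regular f :=
        ContinuousLinearMap.ext fun a => α.convAct_smul_left c f a
      rw [this, norm_smul])
  mul_le' := α.norm_regular_mul_le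
  star_mul_self' f := by
    refine le_antisymm ((α.norm_regular_mul_le _ _).trans ?_) (α.norm_regular_sq_le f)
    have := α.norm_regular_le_star (star f)
    rw [star_star] at this
    exact (mul_le_mul_of_nonneg_right this (norm_nonneg _)).trans (sq _).ge

lemma regularSeminorm_le (f : α.Conv) : α.regularSeminorm f ≤ Conv.normL1 f :=
  LinearMap.mkContinuous_norm_le _ (integral_nonneg fun _ => norm_nonneg _) _

/-- Test the operator on `star a`: it is sent to `a a⋆`, and on fixed elements `avgNorm` is the norm
of `A`. -/
lemma norm_le_regularSeminorm {a : A} (ha : a ∈ α.fixedPoints) :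
    ‖a‖ ≤ α.regularSeminorm (α.constConv a) := by
  rcases (norm_nonneg a).eq_or_lt with h | h
  · rw [← h]; exact α.regularSeminorm.nonneg _
  · refine le_of_mul_le_mul_right ?_ h
    have hs : star a ∈ α.fixedPoints := star_mem ha
    have := α.avgNorm_convAct_le_regular (α.constConv a) (star a)
    rw [convAct_constConv, α.avg_of_mem hs, α.avgNorm_of_mem (mul_mem ha hs), α.avgNorm_of_mem hs,
      CStarRing.norm_self_mul_star, norm_star] at this
    exact this

/-! ### The crossed product -/

/-- The canonical ⋆-homomorphism from the convolution algebra to the crossed product. -/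
def ofConv : α.Conv →⋆ₙₐ[ℂ] α.CrossedProduct where
  toFun := CStarSeminorm.Completion.of _
  map_smul' := CStarSeminorm.Completion.of_smul _
  map_zero' := by
    have := CStarSeminorm.Completion.of_smul
      (CStarSeminorm.largest (Conv.normL1 : α.Conv → ℝ)) 0 0
    rwa [zero_smul, zero_smul] at this
  map_add' := CStarSeminorm.Completion.of_add _
  map_mul' := CStarSeminorm.Completion.of_mul _
  map_star' := CStarSeminorm.Completion.of_star _

lemma denseRange_ofConv : DenseRange α.ofConv := CStarSeminorm.Completion.denseRange_of _

lemma norm_ofConv_le (f : α.Conv) : ‖α.ofConv f‖ ≤ Conv.normL1 f :=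
  (CStarSeminorm.Completion.norm_of _ f).le.trans
    (Real.iSup_le (fun p => p.2 f) (integral_nonneg fun _ => norm_nonneg _))

/-- The regular seminorm is dominated by the `L¹`-norm, so it competes in the supremum that defines
the crossed product. This is the lower bound that keeps `A^α` from collapsing there. -/
lemma regularSeminorm_le_norm_ofConv (f : α.Conv) : α.regularSeminorm f ≤ ‖α.ofConv f‖ :=
  (CStarSeminorm.le_sup _ ⟨α.regularSeminorm, α.regularSeminorm_le⟩ f).trans
    (CStarSeminorm.Completion.norm_of
      (CStarSeminorm.largest (Conv.normL1 : α.Conv → ℝ)) f).ge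

/-- The embedding of the fixed point algebra in the crossed product by constant functions. -/
def fixedIncl : α.fixedPoints →⋆ₙₐ[ℂ] α.CrossedProduct where
  toFun a := α.ofConv (α.constConv a)
  map_smul' c a := by
    rw [← map_smul]; rfl
  map_zero' := map_zero α.ofConv
  map_add' a b := by
    rw [← map_add]; rfl
  map_mul' a b := by
    rw [← map_mul, α.constConv_eq_orbitConv b.2, constConv_mul_orbitConv, α.coeffConv_of_mem a.2,
      α.constConv_eq_orbitConv (a * b).2]
    rfl
  map_star' a := by
    rw [← map_star, star_constConv, ← α.constConv_eq_orbitConv (star_mem a.2)]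
    rfl

lemma fixedIncl_apply (a : α.fixedPoints) : α.fixedIncl a = α.ofConv (α.constConv a) := rfl

lemma fixedIncl_injective : Function.Injective α.fixedIncl := by
  refine (injective_iff_map_eq_zero α.fixedIncl).2 fun a ha => ?_
  have h := (α.norm_le_regularSeminorm a.2).trans (α.regularSeminorm_le_norm_ofConv _)
  rw [← fixedIncl_apply, ha, norm_zero] at h
  exact Subtype.ext (norm_le_zero_iff.1 h)

/-- The linear map `a ↦ (s ↦ α_s(a))` from `A` to the crossed product. -/
def orbitMap : A →L[ℂ] α.CrossedProduct :=
  LinearMap.mkContinuous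
    { toFun := fun a => α.ofConv (α.orbitConv a)
      map_add' := fun a b => by rw [orbitConv_add, map_add]
      map_smul' := fun c a => by rw [orbitConv_smul, map_smul]; rfl } 1 fun a => by
    refine (α.norm_ofConv_le _).trans (le_of_eq ?_)
    simp [Conv.normL1, norm_apply]

lemma orbitMap_apply (a : A) : α.orbitMap a = α.ofConv (α.orbitConv a) := rfl

lemma orbitMap_of_mem (a : α.fixedPoints) : α.orbitMap a = α.fixedIncl a := by
  rw [orbitMap_apply, fixedIncl_apply, α.constConv_eq_orbitConv a.2]

lemma orbitMap_mul_ofConv (a : A) (f : α.Conv) : ∃ b, α.orbitMap a * α.ofConv f = α.orbitMap b :=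
  ⟨∫ t, α t (a * f t⁻¹) ∂haarProb G, by
    rw [orbitMap_apply, orbitMap_apply, ← map_mul, orbitConv_mul]⟩

lemma fixedIncl_mul_orbitMap (a : α.fixedPoints) (b : A) :
    α.fixedIncl a * α.orbitMap b = α.orbitMap (a * b) := by
  rw [orbitMap_apply, orbitMap_apply, fixedIncl_apply, ← map_mul, constConv_mul_orbitConv,
    coeffConv_of_mem _ a.2]

lemma orbitMap_mul_star (a b : A) : α.orbitMap a * star (α.orbitMap b) =
    α.fixedIncl ⟨α.avg (a * star b), α.avg_mem _⟩ := by
  rw [orbitMap_apply, orbitMap_apply, fixedIncl_apply, ← map_star, ← map_mul, star_orbitConv,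
    orbitConv_mul_constConv]

lemma star_orbitMap_mul (a b : A) : star (α.orbitMap a) * α.orbitMap b =
    α.toCrossedProduct (α.coeff (star a) b) := by
  rw [orbitMap_apply, orbitMap_apply, ← map_star, ← map_mul, star_orbitConv,
    constConv_mul_orbitConv]
  rfl

end Regular
end CStarAction

namespace CStarAction

section Morita
set_option linter.unusedSectionVars false
variable {G : Type*} [Group G] [TopologicalSpace G] [IsTopologicalGroup G] [CompactSpace G]
  [T2Space G] [SecondCountableTopology G] [MeasurableSpace G] [BorelSpace G]
  {A : Type*} [NonUnitalCStarAlgebra A] (α : CStarAction G A)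

/-! ### Invariant approximate units -/

/-- For each `t`, `α_t(e_n) a = α_t(e_n α_{t⁻¹}(a))` tends to `a`. The bound `‖e_n‖ ≤ 1` supplies
the dominating function `‖a‖`. -/
lemma tendsto_avg_mul {e : ℕ → A} (h1 : ∀ n, ‖e n‖ ≤ 1)
    (he : ∀ a, Tendsto (fun n => e n * a) atTop (𝓝 a)) (a : A) :
    Tendsto (fun n => α.avg (e n) * a) atTop (𝓝 a) := by
  have hc : ∀ n, Continuous fun t => α t (e n) * a := fun n =>
    (α.continuous_apply' (e n)).mul continuous_const
  have h : Tendsto (fun n => ∫ t, α t (e n) * a ∂haarProb G) atTop (𝓝 (∫ _, a ∂haarProb G)) := by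
    refine tendsto_integral_of_dominated_convergence (fun _ => ‖a‖)
      (fun n => (Conv.integrable (hc n)).aestronglyMeasurable) (integrable_const _)
      (fun n => ae_of_all _ fun t => ?_) (ae_of_all _ fun t => ?_)
    · refine (norm_mul_le _ _).trans ?_
      rw [norm_apply]
      exact mul_le_of_le_one_left (norm_nonneg a) (h1 n)
    · have := ((α.clm t).continuous.tendsto _).comp (he (α t⁻¹ a))
      simpa only [Function.comp_def, clm_apply, map_mul, ← mul_apply, mul_inv_cancel,
        one_apply] using this
  simp only [integral_const, probReal_univ, one_smul] at h
  refine h.congr fun n => ?_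
  exact Conv.integral_mul_right' a (α.continuous_apply' (e n))

/-- A σ-unital C⋆-algebra with an action of a compact group has an invariant countable approximate
unit. -/
lemma exists_fixed_approximateUnit (hA : IsSigmaUnital A) :
    ∃ u : ℕ → A, (∀ n, u n ∈ α.fixedPoints) ∧ (∀ n, ‖u n‖ ≤ 1) ∧
      (∀ a, Tendsto (fun n => u n * a) atTop (𝓝 a)) ∧
      (∀ a, Tendsto (fun n => a * u n) atTop (𝓝 a)) := by
  obtain ⟨e, hpos, h1, he⟩ := hA
  have hl : ∀ a, Tendsto (fun n => α.avg (e n) * a) atTop (𝓝 a) :=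
    α.tendsto_avg_mul h1 fun a => tendsto_map'_iff.1 (he.tendsto_mul_right a)
  refine ⟨fun n => α.avg (e n), fun n => α.avg_mem _, fun n => (α.norm_avg_le _).trans (h1 n), hl,
    fun a => ?_⟩
  -- The averages are self-adjoint because the `e n` are positive, so the right-hand limit is the
  -- adjoint of the left-hand one.
  have h := (continuous_star.tendsto _).comp (hl (star a))
  have hs : ∀ n, star (α.avg (e n)) = α.avg (e n) := fun n => by
    obtain ⟨c, hc⟩ := hpos n
    rw [star_avg, hc, star_mul, star_star]
  simpa only [Function.comp_def, star_mul, star_star, hs] using h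

/-! ### The imprimitivity bimodule -/

/-- The closure of the functions `s ↦ α_s(a)` in the crossed product. -/
def bimodule : Submodule ℂ α.CrossedProduct := (LinearMap.range α.orbitMap.toLinearMap).topologicalClosure

lemma isClosed_bimodule : IsClosed (α.bimodule : Set α.CrossedProduct) :=
  Submodule.isClosed_topologicalClosure _

instance : CompleteSpace α.bimodule := α.isClosed_bimodule.completeSpace_coe

lemma orbitMap_mem (a : A) : α.orbitMap a ∈ α.bimodule :=
  Submodule.le_topologicalClosure _ ⟨a, rfl⟩

lemma bimodule_induction {p : α.CrossedProduct → Prop} (hc : IsClosed {x | p x})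
    (h : ∀ a, p (α.orbitMap a)) {x : α.CrossedProduct} (hx : x ∈ α.bimodule) : p x :=
  closure_minimal (s := Set.range α.orbitMap) (by rintro _ ⟨a, rfl⟩; exact h a) hc hx

/-- Injective ⋆-homomorphisms are isometric. Closedness keeps `x y⋆` inside the copy of `A^α` when
`x` and `y` are only limits of orbit functions. -/
lemma isClosed_range_fixedIncl : IsClosed (Set.range α.fixedIncl) :=
  (NonUnitalStarAlgHom.isometry α.fixedIncl α.fixedIncl_injective).isClosedEmbedding.isClosed_range

lemma bimodule_mul_mem {x : α.CrossedProduct} (hx : x ∈ α.bimodule) (b : α.CrossedProduct) :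
    x * b ∈ α.bimodule := by
  refine α.bimodule_induction (p := fun x => x * b ∈ α.bimodule)
    (α.isClosed_bimodule.preimage (continuous_mul_const b)) (fun a => ?_) hx
  refine α.denseRange_ofConv.induction_on (p := fun b => α.orbitMap a * b ∈ α.bimodule) b
    (α.isClosed_bimodule.preimage (continuous_const_mul _)) fun f => ?_
  obtain ⟨c, hc⟩ := α.orbitMap_mul_ofConv a f
  rw [hc]
  exact α.orbitMap_mem c

lemma fixedIncl_mul_mem (c : α.fixedPoints) {x : α.CrossedProduct} (hx : x ∈ α.bimodule) :
    α.fixedIncl c * x ∈ α.bimodule := by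
  refine α.bimodule_induction (p := fun x => α.fixedIncl c * x ∈ α.bimodule)
    (α.isClosed_bimodule.preimage (continuous_const_mul _)) (fun a => ?_) hx
  rw [fixedIncl_mul_orbitMap]
  exact α.orbitMap_mem _

lemma mul_star_mem_range {x y : α.CrossedProduct} (hx : x ∈ α.bimodule) (hy : y ∈ α.bimodule) :
    x * star y ∈ Set.range α.fixedIncl := by
  refine α.bimodule_induction (p := fun x => x * star y ∈ Set.range α.fixedIncl)
    (α.isClosed_range_fixedIncl.preimage (continuous_mul_const _)) (fun a => ?_) hx
  refine α.bimodule_induction (p := fun y => α.orbitMap a * star y ∈ Set.range α.fixedIncl)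
    (α.isClosed_range_fixedIncl.preimage ((continuous_const_mul _).comp continuous_star))
    (fun b => ?_) hy
  rw [orbitMap_mul_star]
  exact ⟨_, rfl⟩

/-- The `A^α`-valued inner product `x y⋆` of the bimodule. -/
def bimoduleInner (x y : α.bimodule) : α.fixedPoints := (α.mul_star_mem_range x.2 y.2).choose

lemma fixedIncl_bimoduleInner (x y : α.bimodule) :
    α.fixedIncl (α.bimoduleInner x y) = x.1 * star y.1 :=
  (α.mul_star_mem_range x.2 y.2).choose_spec

/-- If the action is saturated, then `bimodule` is an imprimitivity bimodule. -/
def imprimitivityBimodule (hA : IsSigmaUnital A) (hα : α.IsSaturated) :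
    ImprimitivityBimodule α.fixedPoints α.CrossedProduct α.bimodule where
  lact := LinearMap.mk₂ ℂ (fun c x => ⟨α.fixedIncl c * x.1, α.fixedIncl_mul_mem c x.2⟩)
    (fun c d x => Subtype.ext (by simp [add_mul]))
    (fun k c x => Subtype.ext (by simp [smul_mul_assoc]))
    (fun c x y => Subtype.ext (by simp [mul_add]))
    (fun k c x => Subtype.ext (by simp [mul_smul_comm]))
  ract := LinearMap.mk₂ ℂ (fun b x => ⟨x.1 * b, α.bimodule_mul_mem x.2 b⟩)
    (fun c d x => Subtype.ext (by simp [mul_add]))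
    (fun k c x => Subtype.ext (by simp [mul_smul_comm]))
    (fun c x y => Subtype.ext (by simp [add_mul]))
    (fun k c x => Subtype.ext (by simp [smul_mul_assoc]))
  lact_mul c d x := Subtype.ext (by simp [mul_assoc])
  ract_mul b c x := Subtype.ext (by simp [mul_assoc])
  lact_ract c b x := Subtype.ext (by simp [mul_assoc])
  linner := α.bimoduleInner
  rinner x y := star x.1 * y.1
  linner_add_left x x' y := α.fixedIncl_injective (by
    simp only [map_add, fixedIncl_bimoduleInner, Submodule.coe_add, add_mul])
  linner_smul_left c x y := α.fixedIncl_injective (by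
    simp only [map_smul, fixedIncl_bimoduleInner, Submodule.coe_smul, smul_mul_assoc])
  linner_lact a x y := α.fixedIncl_injective (by
    simp only [map_mul, fixedIncl_bimoduleInner, LinearMap.mk₂_apply, mul_assoc])
  star_linner x y := α.fixedIncl_injective (by
    simp only [map_star, fixedIncl_bimoduleInner, star_mul, star_star])
  -- `x x⋆` is visibly positive in the crossed product only; positivity is reflected back to `A^α`
  -- along the embedding.
  linner_self_nonneg x := exists_eq_star_mul_self_of_map α.fixedIncl α.fixedIncl_injective
    (b := star x.1) (by rw [fixedIncl_bimoduleInner, star_star])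
  rinner_add_right x y y' := by simp only [Submodule.coe_add, mul_add]
  rinner_smul_right c x y := by simp only [Submodule.coe_smul, mul_smul_comm]
  rinner_ract b x y := by simp only [LinearMap.mk₂_apply, mul_assoc]
  star_rinner x y := by simp only [star_mul, star_star]
  rinner_self_nonneg x := ⟨x.1, rfl⟩
  norm_sq_eq_linner x := by
    rw [← NonUnitalStarAlgHom.norm_map α.fixedIncl α.fixedIncl_injective, fixedIncl_bimoduleInner,
      CStarRing.norm_self_mul_star, sq]
    rfl
  norm_sq_eq_rinner x := by
    rw [CStarRing.norm_star_mul_self, sq]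
    rfl
  linner_full := by
    obtain ⟨u, hu, -, -, hr⟩ := α.exists_fixed_approximateUnit hA
    intro a
    -- For an invariant approximate unit `u`, the left inner product of the orbit functions of `a`
    -- and `(u n)⋆` is `E(a u_n) = a u_n`, which tends to `a`.
    refine mem_closure_of_tendsto (f := fun n => a * ⟨u n, hu n⟩)
      (tendsto_subtype_rng.2 (hr a)) (Eventually.of_forall fun n => Submodule.subset_span ?_)
    refine ⟨⟨α.orbitMap a, α.orbitMap_mem _⟩,
      ⟨α.orbitMap (star (u n)), α.orbitMap_mem _⟩, α.fixedIncl_injective ?_⟩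
    rw [fixedIncl_bimoduleInner]
    change _ = α.orbitMap a * star (α.orbitMap (star (u n)))
    rw [orbitMap_mul_star]
    congr 1
    refine Subtype.ext ?_
    change a.1 * u n = α.avg (a.1 * star (star (u n)))
    rw [star_star, α.avg_of_mem (mul_mem a.2 (hu n))]
  rinner_full := by
    -- Saturation enters here: `f_{a,b}` is the right inner product of the orbit functions of `a⋆`
    -- and `b`.
    refine hα.mono (Submodule.span_mono ?_)
    rintro _ ⟨a, b, rfl⟩
    refine ⟨⟨α.orbitMap (star a), α.orbitMap_mem _⟩, ⟨α.orbitMap b, α.orbitMap_mem _⟩, ?_⟩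
    change _ = star (α.orbitMap (star a)) * α.orbitMap b
    rw [star_orbitMap_mul, star_star]
  rinner_lact a x y := by
    simp only [LinearMap.mk₂_apply, star_mul, map_star, mul_assoc]
  linner_ract b x y := α.fixedIncl_injective (by
    simp only [fixedIncl_bimoduleInner, LinearMap.mk₂_apply, star_mul, star_star, mul_assoc])
  lact_linner x y z := Subtype.ext (by
    simp only [LinearMap.mk₂_apply, fixedIncl_bimoduleInner, mul_assoc])

end Morita
end CStarAction

/-! ### Approximation of continuous functions on compact spaces -/

section Approximation

/-- Continuous functions from a compact Hausdorff space to a normed space are uniformly approximated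
by finite sums of elementary tensors. -/
lemma exists_sum_smul_approx {G E : Type*} [TopologicalSpace G] [CompactSpace G] [T2Space G]
    [NormedAddCommGroup E] [NormedSpace ℂ E] {f : G → E} (hf : Continuous f) {ε : ℝ} (hε : 0 < ε) :
    ∃ (n : ℕ) (ξ : Fin n → C(G, ℂ)) (v : Fin n → E), ∀ g, ‖f g - ∑ i, ξ i g • v i‖ ≤ ε := by
  have hopen : ∀ x : G, IsOpen {g | ‖f g - f x‖ < ε} := fun x =>
    isOpen_lt (hf.sub continuous_const).norm continuous_const
  obtain ⟨t, ht⟩ := isCompact_univ.elim_finite_subcover (fun x : G => {g | ‖f g - f x‖ < ε}) hopen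
    fun g _ => Set.mem_iUnion.2 ⟨g, by simpa using hε⟩
  let e := t.equivFin.symm
  have hcov : Set.univ ⊆ ⋃ i, {g | ‖f g - f (e i)‖ < ε} := fun g hg => by
    obtain ⟨x, hx, hgx⟩ := Set.mem_iUnion₂.1 (ht hg)
    exact Set.mem_iUnion.2 ⟨e.symm ⟨x, hx⟩, by simpa using hgx⟩
  -- A partition of unity subordinate to sets on which `f` varies by less than `ε` from a sample
  -- value; the sum of the sample values weighted by it is the approximant.
  obtain ⟨ρ, hsupp, hsum, hρ, -⟩ := exists_continuous_sum_one_of_isOpen_isCompact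
    (fun i => hopen (e i)) isCompact_univ hcov
  refine ⟨t.card, fun i => ⟨fun g => (ρ i g : ℂ), by fun_prop⟩, fun i => f (e i), fun g => ?_⟩
  have h1 : ∑ i, ρ i g = 1 := by simpa using hsum (Set.mem_univ g)
  have h2 : f g - ∑ i, (ρ i g : ℂ) • f (e i) = ∑ i, (ρ i g : ℂ) • (f g - f (e i)) := by
    simp only [smul_sub, Finset.sum_sub_distrib, ← Finset.sum_smul]
    rw [← Complex.ofReal_sum, h1, Complex.ofReal_one, one_smul]
  change ‖f g - ∑ i, (ρ i g : ℂ) • f (e i)‖ ≤ ε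
  rw [h2]
  calc _ ≤ ∑ i, ρ i g * ε := norm_sum_le_of_le _ fun i _ => by
        rw [norm_smul, Complex.norm_real, Real.norm_of_nonneg (hρ i g).1]
        by_cases hg : ρ i g = 0
        · simp [hg]
        · exact mul_le_mul_of_nonneg_left (hsupp i (subset_tsupport _ hg)).le (hρ i g).1
    _ = ε := by rw [← Finset.sum_mul, h1, one_mul]

/-- A function of `g` is uniformly approximated by finite sums of functions `f(h) k(g⁻¹h)`. -/
lemma exists_sum_mul_translate_approx {G : Type*} [Group G] [TopologicalSpace G]
    [IsTopologicalGroup G] [CompactSpace G] [T2Space G] (ξ : C(G, ℂ)) {ε : ℝ} (hε : 0 < ε) :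
    ∃ (n : ℕ) (f k : Fin n → C(G, ℂ)), ∀ g h, ‖ξ g - ∑ i, f i h * k i (g⁻¹ * h)‖ ≤ ε := by
  -- `F x` is the function `y ↦ ξ(x y⁻¹)`, and `F x (g⁻¹ x) = ξ g` for every `x`. Approximating `F`
  -- by elementary tensors in the sup norm thus separates `x` from `g⁻¹ x`.
  let F : C(G, C(G, ℂ)) := ContinuousMap.curry ⟨fun z : G × G => ξ (z.1 * z.2⁻¹), by fun_prop⟩
  obtain ⟨n, f, k, h⟩ := exists_sum_smul_approx F.continuous hε
  refine ⟨n, f, k, fun g x => ?_⟩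
  have h1 := (ContinuousMap.norm_coe_le_norm _ (g⁻¹ * x)).trans (h x)
  have h2 : F x (g⁻¹ * x) = ξ g := by
    change ξ (x * (g⁻¹ * x)⁻¹) = ξ g
    congr 1
    group
  simpa [ContinuousMap.sub_apply, h2, ContinuousMap.sum_apply] using h1

/-- The generated semigroup is the union of the sets of `n`-fold products, each a continuous image
of a compact set and hence separable. -/
lemma isSeparable_subsemigroup_closure {A : Type*} [NonUnitalSeminormedRing A] {s : Set A}
    (hs : IsCompact s) : TopologicalSpace.IsSeparable (Subsemigroup.closure s : Set A) := by
  -- `T n` consists of the products of `n + 1` factors, which explains the index `m + n + 1` below.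
  let T : ℕ → Set A := fun n => Nat.rec s (fun _ t => Set.image2 (· * ·) t s) n
  have hT : ∀ n, IsCompact (T n) := fun n => by
    induction n with
    | zero => exact hs
    | succ n ih =>
      have := (ih.prod hs).image continuous_mul
      rwa [Set.image_prod] at this
  have hmul : ∀ m n x y, x ∈ T m → y ∈ T n → x * y ∈ T (m + n + 1) := by
    intro m n
    induction n with
    | zero => exact fun x y hx hy => ⟨x, hx, y, hy, rfl⟩
    | succ n ih =>
      rintro x _ hx ⟨y, hy, z, hz, rfl⟩
      exact ⟨x * y, ih x y hx hy, z, hz, mul_assoc _ _ _⟩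
  refine (TopologicalSpace.IsSeparable.iUnion fun n => (hT n).isSeparable).mono fun x hx => ?_
  induction hx using Subsemigroup.closure_induction with
  | mem x hx => exact Set.mem_iUnion.2 ⟨0, hx⟩
  | mul x y _ _ hx hy =>
    obtain ⟨m, hm⟩ := Set.mem_iUnion.1 hx
    obtain ⟨n, hn⟩ := Set.mem_iUnion.1 hy
    exact Set.mem_iUnion.2 ⟨m + n + 1, hmul m n x y hm hn⟩

/-- A uniformly bounded sequence of continuous functions that is pointwise eventually at most `c`
has integrals eventually less than `c + ε`. -/
lemma exists_integral_lt {G : Type*} [TopologicalSpace G] [CompactSpace G]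
    [MeasurableSpace G] [BorelSpace G] {μ : Measure G} [IsProbabilityMeasure μ]
    {F : ℕ → G → ℝ} (hF : ∀ n, Continuous (F n)) {M c ε : ℝ}
    (h0 : ∀ n g, 0 ≤ F n g) (hM : ∀ n g, F n g ≤ M) (hc : 0 ≤ c)
    (h : ∀ g, ∀ᶠ n in atTop, F n g ≤ c) (hε : 0 < ε) : ∃ n, ∫ g, F n g ∂μ < c + ε := by
  have hcont : ∀ n, Continuous fun g => max (F n g - c) 0 := fun n => by
    have := hF n
    fun_prop
  have hint : ∀ f : G → ℝ, Continuous f → Integrable f μ := fun f hf =>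
    hf.integrable_of_hasCompactSupport (HasCompactSupport.of_compactSpace f)
  -- The threshold in `h` depends on `g`, so no single `n` need work everywhere. The excess over `c`
  -- is eventually zero at each point, and dominated convergence makes its integral small.
  have ht : Tendsto (fun n => ∫ g, max (F n g - c) 0 ∂μ) atTop (𝓝 (∫ _, (0 : ℝ) ∂μ)) := by
    refine tendsto_integral_of_dominated_convergence (fun _ => M)
      (fun n => (hint _ (hcont n)).aestronglyMeasurable) (integrable_const _)
      (fun n => ae_of_all _ fun g => ?_) (ae_of_all _ fun g => ?_)
    · rw [Real.norm_of_nonneg (le_max_right _ _)]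
      exact max_le (by linarith [hM n g]) ((h0 n g).trans (hM n g))
    · refine tendsto_const_nhds.congr' ?_
      filter_upwards [h g] with n hn
      rw [max_eq_right (by linarith)]
  rw [integral_zero] at ht
  obtain ⟨n, hn⟩ := (ht.eventually_lt_const hε).exists
  refine ⟨n, ?_⟩
  calc ∫ g, F n g ∂μ ≤ ∫ g, (max (F n g - c) 0 + c) ∂μ :=
        integral_mono (hint _ (hF n)) (hint _ ((hcont n).add continuous_const))
          fun g => by linarith [le_max_left (F n g - c) 0]
    _ < c + ε := by
      rw [integral_add (hint _ (hcont n)) (integrable_const _), integral_const, probReal_univ,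
        one_smul]
      linarith

end Approximation

namespace CStarAction

/-! ### Separable invariant subalgebras generated by one orbit -/

section Orbit
set_option linter.unusedSectionVars false
variable {G : Type*} [Group G] [TopologicalSpace G] [CompactSpace G]
  {A : Type*} [NonUnitalCStarAlgebra A] (α : CStarAction G A)

/-- The C⋆-algebra generated by the orbit of `a`. -/
def orbitAlgebra (a : A) : NonUnitalStarSubalgebra ℂ A :=
  (NonUnitalStarAlgebra.adjoin ℂ (Set.range fun g => α g a)).topologicalClosure

lemma mem_orbitAlgebra (a : A) (g : G) : α g a ∈ α.orbitAlgebra a :=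
  NonUnitalStarSubalgebra.le_topologicalClosure _
    (NonUnitalStarAlgebra.subset_adjoin ℂ _ ⟨g, rfl⟩)

lemma isClosed_orbitAlgebra (a : A) : IsClosed (α.orbitAlgebra a : Set A) :=
  NonUnitalStarSubalgebra.isClosed_topologicalClosure _

lemma invariant_orbitAlgebra (a : A) : α.Invariant (α.orbitAlgebra a) := by
  intro g
  change α.orbitAlgebra a ≤ (α.orbitAlgebra a).comap (α g)
  refine NonUnitalStarSubalgebra.topologicalClosure_minimal _ ?_
    ((α.isClosed_orbitAlgebra a).preimage (α.clm g).continuous)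
  refine NonUnitalStarAlgebra.adjoin_le ?_
  rintro _ ⟨h, rfl⟩
  change α g (α h a) ∈ α.orbitAlgebra a
  rw [← mul_apply]
  exact α.mem_orbitAlgebra a _

/-- The orbit is compact since `G` is, and the algebra is the closed span of the semigroup generated
by the orbit and its adjoints. No separability of `A` is involved. -/
lemma isSeparable_orbitAlgebra (a : A) :
    TopologicalSpace.IsSeparable (α.orbitAlgebra a : Set A) := by
  have hc : IsCompact (Set.range fun g => α g a) := isCompact_range (α.continuous_apply' a)
  have hs : IsCompact (star (Set.range fun g => α g a)) := by
    rw [← Set.image_star]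
    exact hc.image continuous_star
  have h := (isSeparable_subsemigroup_closure (hc.union hs)).span (R := ℂ)
  rw [← NonUnitalStarAlgebra.adjoin_eq_span] at h
  exact h.closure

end Orbit
end CStarAction

/-! ### Lifting elements of central sequence algebras -/

section Lifts
variable {A : Type*} [NonUnitalCStarAlgebra A]

/-- The constant sequence `a`. -/
def constEll (a : A) : EllInfty A :=
  ⟨fun _ => a, memℓp_infty ⟨‖a‖, by rintro _ ⟨_, rfl⟩; exact le_rfl⟩⟩

lemma mk_cZero_eq {x y : EllInfty A} :
    StarIdeal.Quotient.mk (cZero A) x = StarIdeal.Quotient.mk (cZero A) y ↔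
      Tendsto (fun n => x n - y n) atTop (𝓝 0) := by
  rw [StarIdeal.Quotient.mk_eq_mk, tendsto_zero_iff_norm_tendsto_zero]
  rfl

/-- The bounded sequence `z` represents the element `q` of `F(D, A)`. -/
def Lifts {D : NonUnitalStarSubalgebra ℂ A} (z : EllInfty A) (q : CentralSeqAlg D) : Prop :=
  ∃ h : StarIdeal.Quotient.mk (cZero A) z ∈ relCommutant D,
    StarIdeal.Quotient.mk (annihilator D) ⟨_, h⟩ = q

namespace Lifts
variable {D : NonUnitalStarSubalgebra ℂ A} {y z : EllInfty A} {p q : CentralSeqAlg D}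

lemma exists_lift (q : CentralSeqAlg D) : ∃ z, Lifts z q := by
  obtain ⟨⟨x, hx⟩, rfl⟩ := StarIdeal.Quotient.mk_surjective q
  obtain ⟨z, rfl⟩ := StarIdeal.Quotient.mk_surjective x
  exact ⟨z, hx, rfl⟩

lemma add (hy : Lifts y p) (hz : Lifts z q) : Lifts (y + z) (p + q) := by
  obtain ⟨hy, rfl⟩ := hy
  obtain ⟨hz, rfl⟩ := hz
  exact ⟨add_mem hy hz, rfl⟩

lemma mul (hy : Lifts y p) (hz : Lifts z q) : Lifts (y * z) (p * q) := by
  obtain ⟨hy, rfl⟩ := hy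
  obtain ⟨hz, rfl⟩ := hz
  exact ⟨mul_mem hy hz, rfl⟩

lemma smul (c : ℂ) (hz : Lifts z q) : Lifts (c • z) (c • q) := by
  obtain ⟨hz, rfl⟩ := hz
  exact ⟨SMulMemClass.smul_mem c hz, rfl⟩

lemma star (hz : Lifts z q) : Lifts (star z) (star q) := by
  obtain ⟨hz, rfl⟩ := hz
  exact ⟨star_mem hz, rfl⟩

lemma zero : Lifts (0 : EllInfty A) (0 : CentralSeqAlg D) := ⟨zero_mem _, rfl⟩

lemma sum {ι : Type*} (s : Finset ι) {y : ι → EllInfty A} {p : ι → CentralSeqAlg D}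
    (h : ∀ i, Lifts (y i) (p i)) : Lifts (∑ i ∈ s, y i) (∑ i ∈ s, p i) := by
  classical
  induction s using Finset.induction_on with
  | empty => simpa using zero
  | insert i s hi ih =>
    rw [Finset.sum_insert hi, Finset.sum_insert hi]
    exact (h i).add ih

lemma tendsto_commute (hz : Lifts z q) {d : A} (hd : d ∈ D) :
    Tendsto (fun n => z n * d - d * z n) atTop (𝓝 0) := by
  obtain ⟨hz, -⟩ := hz
  exact mk_cZero_eq (x := z * constEll d) (y := constEll d * z) |>.1 (hz d hd)

/-- A class in `F(D, A)` fixes a lift only modulo the annihilator of `D`, so lifts can be compared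
only after multiplication by elements of `D`. -/
lemma tendsto_sub (hy : Lifts y q) (hz : Lifts z q) {d : A} (hd : d ∈ D) :
    Tendsto (fun n => (y n - z n) * d) atTop (𝓝 0) := by
  obtain ⟨hy, rfl⟩ := hy
  obtain ⟨hz, h⟩ := hz
  have h1 := ((StarIdeal.Quotient.mk_eq_mk.1 h.symm) d hd).1
  have h2 := mk_cZero_eq (x := (y - z) * constEll d) (y := 0) |>.1 h1
  refine h2.congr fun n => ?_
  exact sub_zero _

end Lifts

/-! ### Lifts of the Rokhlin homomorphism -/

section Rokhlin
set_option linter.unusedSectionVars false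
variable {G : Type*} [Group G] [TopologicalSpace G] [IsTopologicalGroup G] [CompactSpace G]
  [T2Space G] (α : CStarAction G A)
  {D : NonUnitalStarSubalgebra ℂ A}

lemma Lifts.act (hD : α.Invariant D) (g : G) {z : EllInfty A} {q : CentralSeqAlg D}
    (hz : Lifts z q) : Lifts (α.ellInftyHom g z) (α.centralSeqHom hD g q) := by
  obtain ⟨hz, rfl⟩ := hz
  exact ⟨(α.commutantHom hD g ⟨_, hz⟩).2, rfl⟩

variable (φ : C(G, ℂ) →⋆ₙₐ[ℂ] α.centralSeqCont D)

/-- Lifts of the unit act as units on `D`. -/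
lemma CStarAction.tendsto_lift_one_mul {u : ℕ → A} (hu : ∀ n, u n ∈ α.fixedPoints) (hu1 : ∀ n, ‖u n‖ ≤ 1)
    (hul : ∀ a, Tendsto (fun n => u n * a) atTop (𝓝 a))
    (hur : ∀ a, Tendsto (fun n => a * u n) atTop (𝓝 a))
    (hφ : ∀ x, φ 1 * x = x ∧ x * φ 1 = x) {z : EllInfty A}
    (hz : Lifts z (φ 1 : CentralSeqAlg D)) {d : A} (hd : d ∈ D) :
    Tendsto (fun n => z n * d) atTop (𝓝 d) := by
  -- `φ 1` is known to be a unit only for `F_α(D, A)`. The invariant approximate unit represents an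
  -- element of that algebra, so `z U` and `U` have the same class, and `U` acts as a unit on `D`.
  let U : EllInfty A := ⟨u, memℓp_infty ⟨1, by rintro _ ⟨n, rfl⟩; exact hu1 n⟩⟩
  have hUc : StarIdeal.Quotient.mk (cZero A) U ∈ relCommutant D := fun d _ => by
    refine mk_cZero_eq (x := U * constEll d) (y := constEll d * U) |>.2 ?_
    have h := (hul d).sub (hur d)
    rwa [sub_self] at h
  have hUcont : (StarIdeal.Quotient.mk (annihilator D) ⟨_, hUc⟩) ∈ α.centralSeqCont D := by
    refine ⟨⟨_, hUc⟩, ⟨U, ?_, rfl⟩, rfl⟩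
    have : ∀ g, α.ellInftyHom g U = U := fun g => Subtype.ext (funext fun n => hu n g)
    change Continuous fun g => α.ellInftyHom g U
    simp only [this]
    exact continuous_const
  have hUl : Lifts U (StarIdeal.Quotient.mk (annihilator D) ⟨_, hUc⟩) := ⟨hUc, rfl⟩
  have hzU : Lifts (z * U) (StarIdeal.Quotient.mk (annihilator D) ⟨_, hUc⟩) := by
    have h := (hφ ⟨_, hUcont⟩).1
    have h2 := congrArg Subtype.val h
    have h3 := hz.mul hUl
    rwa [show ((φ 1 : CentralSeqAlg D) * _) = _ from h2] at h3
  have h1 : Tendsto (fun n => (z n * u n - u n) * d) atTop (𝓝 0) := hzU.tendsto_sub hUl hd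
  have h2 : Tendsto (fun n => z n * (d - u n * d)) atTop (𝓝 0) := by
    have h3 : Tendsto (fun n => ‖z‖ * ‖d - u n * d‖) atTop (𝓝 0) := by
      simpa using ((tendsto_const_nhds (x := d)).sub (hul d)).norm.const_mul ‖z‖
    exact squeeze_zero_norm (fun n => (norm_mul_le _ _).trans (mul_le_mul_of_nonneg_right
      (lp.norm_apply_le_norm ENNReal.top_ne_zero z n) (norm_nonneg _))) h3
  have h4 := (h1.add h2).add (hul d)
  simp only [zero_add] at h4
  refine h4.congr fun n => ?_
  rw [sub_mul, mul_sub, mul_assoc]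
  abel

/-- Lifts of `φ f` satisfy `limsup ‖z_n d‖ ≤ ‖f‖ ‖d‖`. -/
lemma CStarAction.eventually_norm_lift_mul_le
    (hone : ∀ z : EllInfty A, Lifts z (φ 1 : CentralSeqAlg D) →
      ∀ d ∈ D, Tendsto (fun n => z n * d) atTop (𝓝 d))
    {f : C(G, ℂ)} {C : ℝ} (hf : ‖f‖ ≤ C) {z : EllInfty A} (hz : Lifts z (φ f : CentralSeqAlg D))
    {d : A} (hd : d ∈ D) {δ : ℝ} (hδ : 0 < δ) :
    ∀ᶠ n in atTop, ‖z n * d‖ ≤ C * ‖d‖ + δ := by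
  let _ := CStarAlgebra.spectralOrder A
  let _ := CStarAlgebra.spectralOrderedRing A
  have hC : 0 ≤ C := (norm_nonneg f).trans hf
  -- `k = (C² - |f|²)^{1/2}` completes `|f|²` to the constant `C²`. The norm bound thus becomes a
  -- positivity argument on lifts and needs no norm on the quotient `F(D, A)`.
  let k : C(G, ℂ) := ⟨fun g => (√(C ^ 2 - ‖f g‖ ^ 2) : ℝ), by fun_prop⟩
  have hk : star k * k + star f * f = ((C ^ 2 : ℝ) : ℂ) • (1 : C(G, ℂ)) := by
    ext g
    have h0 : 0 ≤ C ^ 2 - ‖f g‖ ^ 2 :=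
      sub_nonneg.2 (pow_le_pow_left₀ (norm_nonneg _) ((f.norm_coe_le_norm g).trans hf) 2)
    change star ((√(C ^ 2 - ‖f g‖ ^ 2) : ℝ) : ℂ) * ((√(C ^ 2 - ‖f g‖ ^ 2) : ℝ) : ℂ)
      + star (f g) * f g = ((C ^ 2 : ℝ) : ℂ) * 1
    rw [Complex.star_def, Complex.conj_ofReal, ← Complex.ofReal_mul, Real.mul_self_sqrt h0,
      Complex.conj_mul', mul_one]
    push_cast
    ring
  obtain ⟨y, hy⟩ := Lifts.exists_lift (φ k : CentralSeqAlg D)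
  obtain ⟨o, ho⟩ := Lifts.exists_lift (φ 1 : CentralSeqAlg D)
  have h1 : Lifts (star y * y + star z * z) (((C ^ 2 : ℝ) : ℂ) • (φ 1 : CentralSeqAlg D)) := by
    have h2 := (hy.star.mul hy).add (hz.star.mul hz)
    have h3 := congrArg Subtype.val (congrArg φ hk)
    rw [map_add, map_mul, map_mul, map_star, map_star, map_smul] at h3
    rwa [show star (φ k : CentralSeqAlg D) * (φ k : CentralSeqAlg D) +
      star (φ f : CentralSeqAlg D) * (φ f : CentralSeqAlg D) = _ from h3] at h2
  -- Both `y⋆ y + z⋆ z` and `C²` times a lift of the unit represent `C² φ(1)`, so the compression by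
  -- `d` tends to `C² d⋆ d`. It dominates `(z_n d)⋆ (z_n d)`.
  have h2 : Tendsto (fun n => star d * ((star (y n) * y n + star (z n) * z n) * d)) atTop
      (𝓝 (star d * (((C ^ 2 : ℝ) : ℂ) • d))) := by
    have h3 := (h1.tendsto_sub (ho.smul ((C ^ 2 : ℝ) : ℂ)) hd).add
      ((hone o ho d hd).const_smul ((C ^ 2 : ℝ) : ℂ))
    rw [zero_add] at h3
    refine (h3.const_mul (star d)).congr fun n => ?_
    change star d * ((star (y n) * y n + star (z n) * z n - ((C ^ 2 : ℝ) : ℂ) • o n) * d +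
      ((C ^ 2 : ℝ) : ℂ) • (o n * d)) = _
    rw [sub_mul, smul_mul_assoc, sub_add_cancel]
  have h3 := h2.norm
  have e : ‖star d * (((C ^ 2 : ℝ) : ℂ) • d)‖ = (C * ‖d‖) ^ 2 := by
    rw [mul_smul_comm, norm_smul, CStarRing.norm_star_mul_self, Complex.norm_real,
      Real.norm_of_nonneg (sq_nonneg C)]
    ring
  rw [e] at h3
  have hlt : (C * ‖d‖) ^ 2 < (C * ‖d‖ + δ) ^ 2 :=
    pow_lt_pow_left₀ (by linarith) (mul_nonneg hC (norm_nonneg d)) two_ne_zero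
  filter_upwards [h3.eventually_lt_const hlt] with n hn
  refine abs_le_of_sq_le_sq' ?_ (by positivity) |>.2
  refine le_trans ?_ hn.le
  rw [sq, ← CStarRing.norm_star_mul_self]
  refine CStarAlgebra.norm_le_norm_of_nonneg_of_le (star_mul_self_nonneg _) ?_
  have : star d * ((star (y n) * y n + star (z n) * z n) * d) =
      star (y n * d) * (y n * d) + star (z n * d) * (z n * d) := by
    simp only [star_mul, add_mul, mul_add, mul_assoc]
  rw [this]
  exact le_add_of_nonneg_left (star_mul_self_nonneg _)

end Rokhlin
end Lifts

namespace CStarAction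

/-! ### Saturation -/

section Saturation
set_option linter.unusedSectionVars false
variable {G : Type*} [Group G] [TopologicalSpace G] [IsTopologicalGroup G] [CompactSpace G]
  [T2Space G] {A : Type*} [NonUnitalCStarAlgebra A] (α : CStarAction G A)

/-- With the Rokhlin property, `ξ(g) a u` is asymptotically a sum of functions `b α_g(c)`. -/
lemma HasRokhlinProperty.exists_sum_coeff_approx (hα : α.HasRokhlinProperty)
    (hA : ∃ u : ℕ → A, (∀ n, u n ∈ α.fixedPoints) ∧ (∀ n, ‖u n‖ ≤ 1) ∧
      (∀ a, Tendsto (fun n => u n * a) atTop (𝓝 a)) ∧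
      (∀ a, Tendsto (fun n => a * u n) atTop (𝓝 a)))
    (ξ : C(G, ℂ)) (a : A) {v : A} (hv : v ∈ α.fixedPoints) (hv1 : ‖v‖ ≤ 1) {c : ℝ} (hc : 0 < c) :
    ∃ (m : ℕ) (x y : Fin m → EllInfty A), ∀ g, ∀ᶠ n in atTop,
      ‖ξ g • (a * v) - ∑ i, x i n * a * α g (y i n * v)‖ ≤ c := by
  obtain ⟨u, hu, hu1, hul, hur⟩ := hA
  have ha1 : 0 < ‖a‖ + 3 := by positivity
  -- The final error is `δ ‖a‖ + δ + δ + δ`: the lift estimate with its slack, the lifted unit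
  -- acting on `a`, and the commutators. Hence `δ = c / (‖a‖ + 3)`.
  obtain ⟨m, f, k, hfk⟩ := exists_sum_mul_translate_approx ξ (ε := c / (‖a‖ + 3)) (by positivity)
  -- The Rokhlin property needs a separable invariant subalgebra containing `a`; the one generated
  -- by its orbit suffices.
  have hD := α.invariant_orbitAlgebra a
  have haD : a ∈ α.orbitAlgebra a := by simpa using α.mem_orbitAlgebra a 1
  obtain ⟨φ, hφ1, hφg⟩ := hα _ hD (α.isClosed_orbitAlgebra a) (α.isSeparable_orbitAlgebra a)
  have hone : ∀ z : EllInfty A, Lifts z (φ 1 : CentralSeqAlg (α.orbitAlgebra a)) →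
      ∀ d ∈ α.orbitAlgebra a, Tendsto (fun n => z n * d) atTop (𝓝 d) :=
    fun z hz d hd => α.tendsto_lift_one_mul φ hu hu1 hul hur hφ1 hz hd
  choose x hx using fun i => Lifts.exists_lift (φ (f i) : CentralSeqAlg (α.orbitAlgebra a))
  choose y hy using fun i => Lifts.exists_lift (φ (k i) : CentralSeqAlg (α.orbitAlgebra a))
  obtain ⟨o, ho⟩ := Lifts.exists_lift (φ 1 : CentralSeqAlg (α.orbitAlgebra a))
  refine ⟨m, x, y, fun g => ?_⟩
  set δ := c / (‖a‖ + 3) with hδ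
  have hδ0 : 0 < δ := by positivity
  -- For the fixed `g`, `r = ξ(g) 1 - ∑ f_i Lt_g(k_i)` has norm at most `δ`. By equivariance `φ r`
  -- is represented by the sequence `z` below, so `z_n a` is eventually small.
  let r : C(G, ℂ) := ξ g • (1 : C(G, ℂ)) + (-1 : ℂ) • ∑ i, f i * leftTranslate g (k i)
  have hr : ‖r‖ ≤ δ := by
    refine (ContinuousMap.norm_le _ hδ0.le).2 fun h => ?_
    have := hfk g h
    simpa [r, leftTranslate, ContinuousMap.sum_apply, sub_eq_add_neg] using this
  let z : EllInfty A := ξ g • o + (-1 : ℂ) • ∑ i, x i * α.ellInftyHom g (y i)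
  have hyg : ∀ i, Lifts (α.ellInftyHom g (y i))
      (φ (leftTranslate g (k i)) : CentralSeqAlg (α.orbitAlgebra a)) := fun i => by
    rw [hφg]
    exact Lifts.act α hD g (hy i)
  have hz : Lifts z (φ r : CentralSeqAlg (α.orbitAlgebra a)) := by
    have h1 := (ho.smul (ξ g)).add
      ((Lifts.sum Finset.univ fun i => (hx i).mul (hyg i)).smul (-1))
    have h2 : (φ r : CentralSeqAlg (α.orbitAlgebra a)) =
        ξ g • (φ 1 : CentralSeqAlg (α.orbitAlgebra a)) + (-1 : ℂ) •
          ∑ i, (φ (f i) : CentralSeqAlg (α.orbitAlgebra a)) * φ (leftTranslate g (k i)) := by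
      simp only [r, map_add, map_smul, map_sum, map_mul]
      simp
    rw [h2]
    exact h1
  have e1 := α.eventually_norm_lift_mul_le φ hone hr hz haD hδ0
  have e2 : Tendsto (fun n => ξ g • (a - o n * a)) atTop (𝓝 0) := by
    simpa using ((tendsto_const_nhds (x := a)).sub (hone o ho a haD)).const_smul (ξ g)
  -- `α_g(y_i)` lifts `φ(Lt_g k_i)` and so asymptotically commutes with `a`. This moves `a` to the
  -- left, where `x_i a` is the first coefficient.
  have e3 : Tendsto (fun n => ∑ i, x i n * (α g (y i n) * a - a * α g (y i n))) atTop (𝓝 0) := by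
    rw [← Finset.sum_const_zero (s := (Finset.univ : Finset (Fin m)))]
    refine tendsto_finsetSum _ fun i _ => ?_
    have h : Tendsto (fun n => α g (y i n) * a - a * α g (y i n)) atTop (𝓝 0) :=
      (hyg i).tendsto_commute haD
    have h3 : Tendsto (fun n => ‖x i‖ * ‖α g (y i n) * a - a * α g (y i n)‖) atTop (𝓝 0) := by
      simpa using (h.norm.const_mul ‖x i‖ :)
    exact squeeze_zero_norm (fun n => (norm_mul_le _ _).trans (mul_le_mul_of_nonneg_right
      (lp.norm_apply_le_norm ENNReal.top_ne_zero (x i) n) (norm_nonneg _))) h3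
  filter_upwards [e1, e2.norm.eventually_lt_const (by simpa using hδ0 : ‖(0 : A)‖ < δ),
    e3.norm.eventually_lt_const (by simpa using hδ0 : ‖(0 : A)‖ < δ)] with n h1 h2 h3
  have hsum : ∀ w : Fin m → EllInfty A, (∑ i, w i : EllInfty A) n = ∑ i, w i n := fun w => by
    rw [lp.coeFn_sum, Finset.sum_apply]
  have hzn : z n = ξ g • o n - ∑ i, x i n * α g (y i n) := by
    change ξ g • o n + (-1 : ℂ) • (∑ i, x i * α.ellInftyHom g (y i) : EllInfty A) n = _
    rw [hsum, neg_one_smul, sub_eq_add_neg]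
    rfl
  have key : ξ g • (a * v) - ∑ i, x i n * a * α g (y i n * v) =
      (z n * a + ξ g • (a - o n * a) +
        ∑ i, x i n * (α g (y i n) * a - a * α g (y i n))) * v := by
    have h4 : ∀ i, x i n * a * α g (y i n * v) = x i n * a * α g (y i n) * v := fun i => by
      rw [map_mul, hv g, mul_assoc (x i n * a)]
    simp only [h4, hzn, sub_mul, smul_mul_assoc, smul_sub, mul_sub, Finset.sum_sub_distrib,
      Finset.sum_mul, add_mul, mul_assoc]
    abel
  rw [key]
  refine (norm_mul_le _ _).trans ((mul_le_of_le_one_right (norm_nonneg _) hv1).trans ?_)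
  refine (norm_add₃_le).trans ?_
  have : δ * ‖a‖ + δ + δ + δ = c := by rw [hδ]; field_simp; ring
  linarith

variable [SecondCountableTopology G] [MeasurableSpace G] [BorelSpace G]

/-- The function `s ↦ ξ(s) a`, as an element of the convolution algebra. -/
def tensorConv (ξ : C(G, ℂ)) (a : A) : α.Conv := (⟨fun s => ξ s • a, by fun_prop⟩ : C(G, A))

lemma Conv.sum_apply {ι : Type*} (s : Finset ι) (f : ι → α.Conv) (g : G) :
    (∑ i ∈ s, f i) g = ∑ i ∈ s, f i g := by
  classical
  induction s using Finset.induction_on with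
  | empty => rfl
  | insert i s hi ih => rw [Finset.sum_insert hi, Finset.sum_insert hi, Conv.add_apply, ih]

/-- The closed span of the functions `f_{a,b}` in the crossed product. -/
def coeffSpan : Submodule ℂ α.CrossedProduct :=
  (Submodule.span ℂ {x : α.CrossedProduct |
    ∃ a b : A, x = α.toCrossedProduct (α.coeff a b)}).topologicalClosure

lemma isClosed_coeffSpan : IsClosed (α.coeffSpan : Set α.CrossedProduct) :=
  Submodule.isClosed_topologicalClosure _

lemma ofConv_coeffConv_mem (a b : A) : α.ofConv (α.coeffConv a b) ∈ α.coeffSpan :=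
  Submodule.le_topologicalClosure _ (Submodule.subset_span ⟨a, b, rfl⟩)

/-- A function that is approximated in the `L¹`-norm by elements of a closed subspace lies in it. -/
lemma ofConv_mem_of_approx {S : Submodule ℂ α.CrossedProduct}
    (hS : IsClosed (S : Set α.CrossedProduct)) {f : α.Conv}
    (h : ∀ ε > 0, ∃ k : α.Conv, α.ofConv k ∈ S ∧ Conv.normL1 (f - k) < ε) : α.ofConv f ∈ S := by
  rw [← SetLike.mem_coe, ← hS.closure_eq, Metric.mem_closure_iff]
  intro ε hε
  obtain ⟨k, hk, hlt⟩ := h ε hε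
  refine ⟨_, hk, ?_⟩
  rw [dist_eq_norm, ← map_sub]
  exact (α.norm_ofConv_le _).trans_lt hlt

lemma normL1_lt_of_forall_le {f : α.Conv} {c ε : ℝ} (hc : c < ε) (h : ∀ g, ‖f g‖ ≤ c) :
    Conv.normL1 f < ε := by
  refine lt_of_le_of_lt ?_ hc
  have := norm_integral_le_of_norm_le_const (μ := haarProb G) (f := fun g => ‖f g‖) (C := c)
    (ae_of_all _ fun g => by rw [norm_norm]; exact h g)
  rw [probReal_univ, mul_one] at this
  exact (Real.le_norm_self _).trans this

/-- The sums approximate `ξ(g) a v` only at each `g` separately, but they are bounded uniformly in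
`n` and `g`. Their `L¹` distance is therefore small for some `n`. -/
lemma ofConv_tensorConv_mul_mem (hα : α.HasRokhlinProperty)
    (hA : ∃ u : ℕ → A, (∀ n, u n ∈ α.fixedPoints) ∧ (∀ n, ‖u n‖ ≤ 1) ∧
      (∀ a, Tendsto (fun n => u n * a) atTop (𝓝 a)) ∧
      (∀ a, Tendsto (fun n => a * u n) atTop (𝓝 a)))
    (ξ : C(G, ℂ)) (a : A) {v : A} (hv : v ∈ α.fixedPoints) (hv1 : ‖v‖ ≤ 1) :
    α.ofConv (α.tensorConv ξ (a * v)) ∈ α.coeffSpan := by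
  refine α.ofConv_mem_of_approx α.isClosed_coeffSpan fun ε hε => ?_
  obtain ⟨m, x, y, h⟩ := hα.exists_sum_coeff_approx α hA ξ a hv hv1 (half_pos hε)
  let k : ℕ → α.Conv := fun n => ∑ i, α.coeffConv (x i n * a) (y i n * v)
  have hk : ∀ n g, (α.tensorConv ξ (a * v) - k n) g =
      ξ g • (a * v) - ∑ i, x i n * a * α g (y i n * v) := fun n g => by
    change ξ g • (a * v) - (∑ i, α.coeffConv (x i n * a) (y i n * v)) g = _
    rw [Conv.sum_apply]
    rfl
  have hM : ∀ n g, ‖(α.tensorConv ξ (a * v) - k n) g‖ ≤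
      ‖ξ‖ * ‖a * v‖ + ∑ i, ‖x i‖ * ‖a‖ * (‖y i‖ * ‖v‖) := fun n g => by
    rw [hk]
    refine (norm_sub_le _ _).trans (add_le_add ?_ (norm_sum_le_of_le _ fun i _ => ?_))
    · rw [norm_smul]
      exact mul_le_mul_of_nonneg_right (ξ.norm_coe_le_norm g) (norm_nonneg _)
    · have hx := lp.norm_apply_le_norm ENNReal.top_ne_zero (x i) n
      have hy := lp.norm_apply_le_norm ENNReal.top_ne_zero (y i) n
      refine (norm_mul_le _ _).trans ?_
      rw [norm_apply]
      refine mul_le_mul ((norm_mul_le _ _).trans ?_) ((norm_mul_le _ _).trans ?_)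
        (norm_nonneg _) (by positivity)
      · exact mul_le_mul_of_nonneg_right hx (norm_nonneg _)
      · exact mul_le_mul_of_nonneg_right hy (norm_nonneg _)
  -- One half of `ε` is the pointwise error and the other half is the slack in the integral.
  obtain ⟨n, hn⟩ := exists_integral_lt (μ := haarProb G)
    (F := fun n g => ‖(α.tensorConv ξ (a * v) - k n) g‖) (fun n => (Conv.continuous _).norm)
    (fun n g => norm_nonneg _) hM (half_pos hε).le
    (fun g => (h g).mono fun n hn => by rw [hk]; exact hn) (half_pos hε)
  refine ⟨k n, ?_, by rw [add_halves] at hn; exact hn⟩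
  rw [map_sum]
  exact sum_mem fun i _ => α.ofConv_coeffConv_mem _ _

/-- Actions with the Rokhlin property on σ-unital C⋆-algebras are saturated. -/
lemma HasRokhlinProperty.isSaturated (hA : IsSigmaUnital A) (hα : α.HasRokhlinProperty) :
    α.IsSaturated := by
  have hu := α.exists_fixed_approximateUnit hA
  -- Replace `a` by `a u_n` for an invariant approximate unit; next, `h2` reaches arbitrary
  -- functions through sums of elementary tensors.
  have h1 : ∀ ξ a, α.ofConv (α.tensorConv ξ a) ∈ α.coeffSpan := fun ξ a => by
    obtain ⟨u, huf, hu1, -, hur⟩ := α.exists_fixed_approximateUnit hA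
    refine α.ofConv_mem_of_approx α.isClosed_coeffSpan fun ε hε => ?_
    have ht : Tendsto (fun n => ‖ξ‖ * ‖a - a * u n‖) atTop (𝓝 0) := by
      simpa using ((tendsto_const_nhds (x := a)).sub (hur a)).norm.const_mul ‖ξ‖
    obtain ⟨n, hn⟩ := (ht.eventually_lt_const hε).exists
    refine ⟨_, α.ofConv_tensorConv_mul_mem hα hu ξ a (huf n) (hu1 n),
      α.normL1_lt_of_forall_le hn fun g => ?_⟩
    change ‖ξ g • a - ξ g • (a * u n)‖ ≤ _
    rw [← smul_sub, norm_smul]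
    exact mul_le_mul_of_nonneg_right (ξ.norm_coe_le_norm g) (norm_nonneg _)
  have h2 : ∀ f, α.ofConv f ∈ α.coeffSpan := fun f => by
    refine α.ofConv_mem_of_approx α.isClosed_coeffSpan fun ε hε => ?_
    obtain ⟨n, ξ, v, h⟩ := exists_sum_smul_approx f.continuous (half_pos hε)
    refine ⟨∑ i, α.tensorConv (ξ i) (v i), ?_, α.normL1_lt_of_forall_le (half_lt_self hε)
      fun g => ?_⟩
    · rw [map_sum]
      exact sum_mem fun i _ => h1 _ _
    · change ‖f g - (∑ i, α.tensorConv (ξ i) (v i)) g‖ ≤ _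
      rw [Conv.sum_apply]
      exact h g
  intro x
  change x ∈ α.coeffSpan
  exact α.denseRange_ofConv.induction_on (p := fun x => x ∈ α.coeffSpan) x α.isClosed_coeffSpan h2

end Saturation
end CStarAction

/-! ### Stabilizations -/

section Extension

/-- An isometric ⋆-homomorphism on a dense ⋆-subalgebra extends to the closure. -/
lemma exists_starAlgHom_extension {V S S' : Type*} [NonUnitalRing V] [StarRing V] [Module ℂ V]
    [NonUnitalCStarAlgebra S] [NonUnitalCStarAlgebra S'] (u : V →⋆ₙₐ[ℂ] S) (v : V →⋆ₙₐ[ℂ] S')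
    (hu : DenseRange u) (h : ∀ x, ‖v x‖ = ‖u x‖) :
    ∃ ψ : S →⋆ₙₐ[ℂ] S', Function.Injective ψ ∧ ∀ x, ψ (u x) = v x := by
  let u' : V →ₗ[ℂ] S := { toFun := u, map_add' := map_add u, map_smul' := map_smul u }
  let v' : V →ₗ[ℂ] S' := { toFun := v, map_add' := map_add v, map_smul' := map_smul v }
  let e : S →L[ℂ] S' := v'.extendOfNorm u'
  have he : ∀ x, e (u x) = v x :=
    LinearMap.extendOfNorm_eq (f := v') (e := u') hu ⟨1, fun x => by rw [one_mul]; exact (h x).le⟩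
  have hnorm : ∀ x, ‖e x‖ = ‖x‖ := fun x => by
    refine hu.induction_on (p := fun x => ‖e x‖ = ‖x‖) x
      (isClosed_eq e.continuous.norm continuous_norm) fun y => ?_
    rw [he, h]
  refine ⟨{ toFun := e
            map_smul' := map_smul e
            map_zero' := map_zero e
            map_add' := map_add e
            map_mul' := fun x y => ?_
            map_star' := fun x => ?_ },
    (injective_iff_map_eq_zero e).2 fun x hx => by rw [← norm_eq_zero, ← hnorm, hx, norm_zero], he⟩
  · refine hu.induction_on₂ (p := fun x y => e (x * y) = e x * e y) ?_ ?_ x y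
    · exact isClosed_eq (e.continuous.comp continuous_mul)
        ((e.continuous.comp continuous_fst).mul (e.continuous.comp continuous_snd))
    · intro c d
      rw [← map_mul u, he, he, he, map_mul]
  · refine hu.induction_on (p := fun x => e (star x) = star (e x)) x ?_ ?_
    · exact isClosed_eq (e.continuous.comp continuous_star) (continuous_star.comp e.continuous)
    · intro c
      rw [← map_star u, he, he, map_star]

end Extension

/-! ### Finite matrices and their corners -/

namespace FiniteMatrix
variable {B C : Type*} [NonUnitalCStarAlgebra B] [NonUnitalCStarAlgebra C]

/-- All entries of `M` outside the upper left `n × n` corner vanish. -/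
def IsBound (M : FiniteMatrix B) (n : ℕ) : Prop := ∀ i j, n ≤ i ∨ n ≤ j → M.entry i j = 0

lemma IsBound.mono {M : FiniteMatrix B} {m n : ℕ} (h : M.IsBound m) (hmn : m ≤ n) : M.IsBound n :=
  fun i j hij => h i j (by omega)

lemma IsBound.add {M M' : FiniteMatrix B} {n : ℕ} (h : M.IsBound n) (h' : M'.IsBound n) :
    (M + M').IsBound n := fun i j hij => by rw [entry_add, h i j hij, h' i j hij, add_zero]

lemma IsBound.smul (c : ℂ) {M : FiniteMatrix B} {n : ℕ} (h : M.IsBound n) :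
    (c • M).IsBound n := fun i j hij => by rw [entry_smul, h i j hij, smul_zero]

lemma IsBound.star {M : FiniteMatrix B} {n : ℕ} (h : M.IsBound n) : (star M).IsBound n :=
  fun i j hij => by rw [entry_star, h j i hij.symm, star_zero]

lemma IsBound.mul {M M' : FiniteMatrix B} {n : ℕ} (h : M.IsBound n) (h' : M'.IsBound n) :
    (M * M').IsBound n := fun i j hij => by
  rw [entry_mul_of_le (Or.inl h)]
  refine Finset.sum_eq_zero fun k _ => ?_
  rcases hij with hij | hij
  · rw [h i k (Or.inl hij), zero_mul]
  · rw [h' k j (Or.inr hij), mul_zero]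

lemma exists_common_bound (M M' : FiniteMatrix B) : ∃ n, M.IsBound n ∧ M'.IsBound n := by
  obtain ⟨n, hn⟩ := M.exists_bound
  obtain ⟨m, hm⟩ := M'.exists_bound
  exact ⟨max n m, IsBound.mono hn (le_max_left _ _), IsBound.mono hm (le_max_right _ _)⟩

/-- The matrix with the single entry `b` in position `(k, l)`. -/
def single (k l : ℕ) (b : B) : FiniteMatrix B :=
  ⟨fun i j => if i = k ∧ j = l then b else 0, max k l + 1, fun i j h => if_neg (by omega)⟩

lemma entry_single (k l : ℕ) (b : B) (i j : ℕ) :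
    (single k l b).entry i j = if i = k ∧ j = l then b else 0 := rfl

lemma single_add (k l : ℕ) (b c : B) : single k l (b + c) = single k l b + single k l c := by
  ext i j
  simp only [entry_single, entry_add]
  split_ifs <;> simp

lemma single_smul (k l : ℕ) (z : ℂ) (b : B) : single k l (z • b) = z • single k l b := by
  ext i j
  simp only [entry_single, entry_smul]
  split_ifs <;> simp

lemma star_single (k l : ℕ) (b : B) : star (single k l b) = single l k (star b) := by
  ext i j
  simp only [entry_single, entry_star]
  split_ifs <;> first | rfl | simp_all

lemma single_mul_single (k l n : ℕ) (b c : B) :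
    single k l b * single l n c = single k n (b * c) := by
  ext i j
  rw [entry_mul, finsum_eq_single _ l (fun m hm => by simp [entry_single, hm])]
  simp only [entry_single]
  split_ifs <;> simp_all

lemma single_mul_single_of_ne {l m : ℕ} (h : l ≠ m) (k n : ℕ) (b c : B) :
    single k l b * single m n c = 0 := by
  ext i j
  rw [entry_mul, entry_zero]
  refine (finsum_congr fun x => ?_).trans finsum_zero
  simp only [entry_single]
  split_ifs <;> simp_all

lemma isBound_single {k l n : ℕ} (hk : k < n) (hl : l < n) (b : B) : (single k l b).IsBound n :=
  fun i j h => if_neg (by omega)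

lemma normSum_eq {M : FiniteMatrix B} {n : ℕ} (h : M.IsBound n) :
    normSum M = ∑ ij ∈ Finset.range n ×ˢ Finset.range n, ‖M.entry ij.1 ij.2‖ := by
  refine finsum_eq_sum_of_support_subset _ fun ij hij => ?_
  by_contra hcon
  refine hij ?_
  change ‖M.entry ij.1 ij.2‖ = 0
  rw [h _ _ (by simp at hcon; omega), norm_zero]

lemma normSum_single (k l : ℕ) (b : B) : normSum (single k l b) = ‖b‖ := by
  refine (finsum_eq_single _ (k, l) fun ij hij => ?_).trans ?_
  · have : ¬(ij.1 = k ∧ ij.2 = l) := fun h => hij (Prod.ext h.1 h.2)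
    rw [entry_single, if_neg this, norm_zero]
  · rw [entry_single, if_pos ⟨rfl, rfl⟩]

lemma normSum_nonneg (M : FiniteMatrix B) : 0 ≤ normSum M := finsum_nonneg fun _ => norm_nonneg _

lemma eq_sum_single {M : FiniteMatrix B} {n : ℕ} (h : M.IsBound n) :
    M = ∑ ij ∈ Finset.range n ×ˢ Finset.range n, single ij.1 ij.2 (M.entry ij.1 ij.2) := by
  have hs : ∀ (s : Finset (ℕ × ℕ)) (f : ℕ × ℕ → FiniteMatrix B) (i j : ℕ),
      (∑ x ∈ s, f x).entry i j = ∑ x ∈ s, (f x).entry i j := fun s f i j => by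
    classical
    induction s using Finset.induction_on with
    | empty => rfl
    | insert x s hx ih => rw [Finset.sum_insert hx, Finset.sum_insert hx, entry_add, ih]
  ext i j
  rw [hs]
  simp only [entry_single]
  rw [Finset.sum_eq_single (i, j)]
  · simp
  · rintro ⟨k, l⟩ - hkl
    exact if_neg fun h => hkl (Prod.ext h.1.symm h.2.symm)
  · intro hij
    rw [if_pos ⟨rfl, rfl⟩]
    exact h i j (by simp at hij; omega)

/-- The upper left `n × n` corner of a matrix. -/
def corner (n : ℕ) (M : FiniteMatrix B) : CStarMatrix (Fin n) (Fin n) B :=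
  CStarMatrix.ofMatrix fun i j => M.entry i j

lemma corner_apply (n : ℕ) (M : FiniteMatrix B) (i j : Fin n) :
    corner n M i j = M.entry i j := rfl

lemma corner_add (n : ℕ) (M M' : FiniteMatrix B) :
    corner n (M + M') = corner n M + corner n M' := rfl

lemma corner_smul (n : ℕ) (c : ℂ) (M : FiniteMatrix B) : corner n (c • M) = c • corner n M := rfl

lemma corner_star (n : ℕ) (M : FiniteMatrix B) : corner n (star M) = star (corner n M) := rfl

lemma corner_mul {n : ℕ} {M M' : FiniteMatrix B} (h : M.IsBound n) :
    corner n (M * M') = corner n M * corner n M' := by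
  ext i j
  rw [corner_apply, entry_mul_of_le (Or.inl h), CStarMatrix.mul_apply, Finset.sum_range]
  rfl

/-- The embedding of `Mₙ(B)` in `M_∞(B)` as the upper left corner. -/
def ofCorner (n : ℕ) (N : CStarMatrix (Fin n) (Fin n) B) : FiniteMatrix B :=
  ⟨fun i j => if h : i < n ∧ j < n then N ⟨i, h.1⟩ ⟨j, h.2⟩ else 0, n,
    fun i j h => dif_neg (by omega)⟩

lemma entry_ofCorner (n : ℕ) (N : CStarMatrix (Fin n) (Fin n) B) (i j : ℕ) :
    (ofCorner n N).entry i j = if h : i < n ∧ j < n then N ⟨i, h.1⟩ ⟨j, h.2⟩ else 0 := rfl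

lemma isBound_ofCorner (n : ℕ) (N : CStarMatrix (Fin n) (Fin n) B) : (ofCorner n N).IsBound n :=
  fun i j h => dif_neg (by omega)

lemma corner_ofCorner (n : ℕ) (N : CStarMatrix (Fin n) (Fin n) B) :
    corner n (ofCorner n N) = N := by
  ext i j
  rw [corner_apply, entry_ofCorner, dif_pos ⟨i.2, j.2⟩]

lemma corner_inj {n : ℕ} {M M' : FiniteMatrix B} (h : M.IsBound n) (h' : M'.IsBound n)
    (e : corner n M = corner n M') : M = M' := by
  ext i j
  by_cases hij : n ≤ i ∨ n ≤ j
  · rw [h i j hij, h' i j hij]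
  · push Not at hij
    exact congrFun (congrFun e ⟨i, hij.1⟩) ⟨j, hij.2⟩

lemma ofCorner_corner {n : ℕ} {M : FiniteMatrix B} (h : M.IsBound n) :
    ofCorner n (corner n M) = M :=
  corner_inj (isBound_ofCorner n _) h (corner_ofCorner n _)

/-- `ofCorner` as a ⋆-homomorphism. -/
def ofCornerHom (n : ℕ) : CStarMatrix (Fin n) (Fin n) B →⋆ₙₐ[ℂ] FiniteMatrix B where
  toFun := ofCorner n
  map_smul' c N := corner_inj (isBound_ofCorner n _) ((isBound_ofCorner n _).smul c) (by
    rw [corner_smul, corner_ofCorner, corner_ofCorner]; rfl)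
  map_zero' := corner_inj (isBound_ofCorner n _) (fun _ _ _ => rfl) (corner_ofCorner n _)
  map_add' N N' := corner_inj (isBound_ofCorner n _)
    ((isBound_ofCorner n _).add (isBound_ofCorner n _)) (by
      rw [corner_add, corner_ofCorner, corner_ofCorner, corner_ofCorner])
  map_mul' N N' := corner_inj (isBound_ofCorner n _)
    ((isBound_ofCorner n _).mul (isBound_ofCorner n _)) (by
      rw [corner_mul (isBound_ofCorner n _), corner_ofCorner, corner_ofCorner, corner_ofCorner])
  map_star' N := corner_inj (isBound_ofCorner n _) (isBound_ofCorner n _).star (by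
    rw [corner_star, corner_ofCorner, corner_ofCorner])

/-! ### The C⋆-norm on finite matrices -/

section Norm
variable [PartialOrder B] [StarOrderedRing B]

/-- The inclusion of the `m × m` matrices into the `n × n` matrices is an injective ⋆-homomorphism
of C⋆-algebras, hence isometric. So the norm of a matrix does not depend on the corner chosen to
contain it. -/
lemma norm_corner_eq {M : FiniteMatrix B} {m n : ℕ} (hm : M.IsBound m) (hmn : m ≤ n) :
    ‖corner n M‖ = ‖corner m M‖ := by
  let θ : CStarMatrix (Fin m) (Fin m) B →⋆ₙₐ[ℂ] CStarMatrix (Fin n) (Fin n) B :=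
    { toFun := fun N => corner n (ofCornerHom m N)
      map_smul' := fun c N => by rw [map_smul, corner_smul]; rfl
      map_zero' := by rw [map_zero]; rfl
      map_add' := fun N N' => by rw [map_add, corner_add]
      map_mul' := fun N N' => by rw [map_mul, corner_mul (M := ofCornerHom m N)
        ((isBound_ofCorner m N).mono hmn)]
      map_star' := fun N => by rw [map_star, corner_star] }
  have hθ : Function.Injective θ := fun N N' h => by
    rw [← corner_ofCorner m N, ← corner_ofCorner m N',
      corner_inj ((isBound_ofCorner m N).mono hmn) ((isBound_ofCorner m N').mono hmn) h]
  have := NonUnitalStarAlgHom.norm_map θ hθ (corner m M)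
  rw [← this]
  change _ = ‖corner n (ofCorner m (corner m M))‖
  rw [ofCorner_corner hm]

/-- The C⋆-norm of a matrix with finitely many nonzero entries. -/
def cornerNorm (M : FiniteMatrix B) : ℝ := ‖corner M.exists_bound.choose M‖

lemma cornerNorm_eq {M : FiniteMatrix B} {n : ℕ} (hn : M.IsBound n) :
    cornerNorm M = ‖corner n M‖ := by
  have h : M.IsBound M.exists_bound.choose := M.exists_bound.choose_spec
  rcases le_total n M.exists_bound.choose with hle | hle
  · exact norm_corner_eq hn hle
  · exact (norm_corner_eq h hle).symm

/-- The C⋆-norm of `M_∞(B)`. -/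
def cornerSeminorm : CStarSeminorm (FiniteMatrix B) where
  toSeminorm := Seminorm.of cornerNorm
    (fun M M' => by
      obtain ⟨n, h, h'⟩ := exists_common_bound M M'
      rw [cornerNorm_eq h, cornerNorm_eq h', cornerNorm_eq (h.add h'), corner_add]
      exact norm_add_le _ _)
    (fun c M => by
      obtain ⟨n, h, -⟩ := exists_common_bound M M
      rw [cornerNorm_eq h, cornerNorm_eq (h.smul c), corner_smul, norm_smul])
  mul_le' M M' := by
    obtain ⟨n, h, h'⟩ := exists_common_bound M M'
    change cornerNorm (M * M') ≤ cornerNorm M * cornerNorm M'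
    rw [cornerNorm_eq h, cornerNorm_eq h', cornerNorm_eq (h.mul h'), corner_mul h]
    exact norm_mul_le _ _
  star_mul_self' M := by
    obtain ⟨n, h, -⟩ := exists_common_bound M M
    change cornerNorm (star M * M) = cornerNorm M ^ 2
    rw [cornerNorm_eq h, cornerNorm_eq (h.star.mul h), corner_mul h.star, corner_star,
      CStarRing.norm_star_mul_self, sq]

/-- The C⋆-identity replaces `e_{kl}(b)` by the diagonal `e_{ll}(b⋆ b)`, and `c ↦ e_{ll}(c)` is a
⋆-homomorphism into the corner of size `l + 1`, hence contractive. -/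
lemma cornerSeminorm_single_le (k l : ℕ) (b : B) : cornerSeminorm (single k l b) ≤ ‖b‖ := by
  let θ : B →⋆ₙₐ[ℂ] CStarMatrix (Fin (l + 1)) (Fin (l + 1)) B :=
    { toFun := fun c => corner (l + 1) (single l l c)
      map_smul' := fun c N => by rw [single_smul, corner_smul]; rfl
      map_zero' := by
        have := single_smul l l 0 (0 : B)
        rw [zero_smul, zero_smul] at this
        rw [this]; rfl
      map_add' := fun N N' => by rw [single_add, corner_add]
      map_mul' := fun N N' => by
        rw [← single_mul_single l l l, corner_mul (isBound_single l.lt_succ_self l.lt_succ_self _)]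
      map_star' := fun N => by rw [← star_single, corner_star] }
  refine abs_le_of_sq_le_sq' ?_ (norm_nonneg b) |>.2
  rw [← cornerSeminorm.star_mul_self, star_single, single_mul_single]
  change cornerNorm _ ≤ _
  rw [cornerNorm_eq (isBound_single l.lt_succ_self l.lt_succ_self _), sq,
    ← CStarRing.norm_star_mul_self]
  exact NonUnitalStarAlgHom.norm_apply_le θ _

/-- This bound admits the corner norm to the supremum that defines the stabilization. -/
lemma cornerSeminorm_le (M : FiniteMatrix B) : cornerSeminorm M ≤ normSum M := by
  obtain ⟨n, hn⟩ := M.exists_bound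
  rw [normSum_eq hn]
  conv_lhs => rw [eq_sum_single hn]
  refine (Finset.le_sum_of_subadditive cornerSeminorm.toSeminorm (map_zero _).le
    (map_add_le_add _) _ _).trans ?_
  exact Finset.sum_le_sum fun ij _ => cornerSeminorm_single_le _ _ _

lemma eq_zero_of_cornerSeminorm {M : FiniteMatrix B} (h : cornerSeminorm M ≤ 0) : M = 0 := by
  obtain ⟨n, hn⟩ := M.exists_bound
  change cornerNorm M ≤ 0 at h
  rw [cornerNorm_eq hn] at h
  exact corner_inj hn (fun _ _ _ => rfl) ((norm_le_zero_iff.1 h).trans rfl)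

end Norm

/-! ### Embedding in the stabilization and functoriality -/

/-- The canonical ⋆-homomorphism `M_∞(B) → B ⊗ 𝒦`. -/
def toStab : FiniteMatrix B →⋆ₙₐ[ℂ] Stabilization B where
  toFun := CStarSeminorm.Completion.of _
  map_smul' := CStarSeminorm.Completion.of_smul _
  map_zero' := by
    have := CStarSeminorm.Completion.of_smul
      (CStarSeminorm.largest (normSum : FiniteMatrix B → ℝ)) 0 0
    rwa [zero_smul, zero_smul] at this
  map_add' := CStarSeminorm.Completion.of_add _
  map_mul' := CStarSeminorm.Completion.of_mul _
  map_star' := CStarSeminorm.Completion.of_star _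

lemma denseRange_toStab : DenseRange (toStab : FiniteMatrix B → Stabilization B) :=
  CStarSeminorm.Completion.denseRange_of _

lemma norm_toStab_le (M : FiniteMatrix B) : ‖toStab M‖ ≤ normSum M :=
  (CStarSeminorm.Completion.norm_of _ M).le.trans
    (Real.iSup_le (fun p => p.2 M) (normSum_nonneg M))

/-- The norm of the stabilization is at least the corner norm, which vanishes only at zero. -/
lemma toStab_injective : Function.Injective (toStab : FiniteMatrix B → Stabilization B) := by
  let _ := CStarAlgebra.spectralOrder B
  let _ := CStarAlgebra.spectralOrderedRing B
  refine (injective_iff_map_eq_zero toStab).2 fun M hM => eq_zero_of_cornerSeminorm ?_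
  have h : cornerSeminorm M ≤ ‖toStab M‖ :=
    (CStarSeminorm.le_sup _ ⟨cornerSeminorm, cornerSeminorm_le⟩ M).trans
      (CStarSeminorm.Completion.norm_of
        (CStarSeminorm.largest (normSum : FiniteMatrix B → ℝ)) M).ge
  rwa [hM, norm_zero] at h

/-- Entrywise application of a ⋆-homomorphism. -/
def mapEntries (φ : C →⋆ₙₐ[ℂ] B) (M : FiniteMatrix C) : FiniteMatrix B :=
  ⟨fun i j => φ (M.entry i j), by
    obtain ⟨n, hn⟩ := M.exists_bound
    exact ⟨n, fun i j h => (congrArg φ (hn i j h)).trans (map_zero φ)⟩⟩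

lemma entry_mapEntries (φ : C →⋆ₙₐ[ℂ] B) (M : FiniteMatrix C) (i j : ℕ) :
    (mapEntries φ M).entry i j = φ (M.entry i j) := rfl

lemma mapEntries_mul (φ : C →⋆ₙₐ[ℂ] B) (M M' : FiniteMatrix C) :
    mapEntries φ (M * M') = mapEntries φ M * mapEntries φ M' := ext fun i j => by
  obtain ⟨n, hn⟩ := M.exists_bound
  rw [entry_mapEntries, entry_mul_of_le (Or.inl hn), map_sum,
    entry_mul_of_le (n := n) (Or.inl fun i j h => ?_)]
  · simp only [map_mul, entry_mapEntries]
  · exact (congrArg φ (hn i j h)).trans (map_zero φ)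

/-- Entrywise application of a ⋆-homomorphism, as a ⋆-homomorphism. -/
def mapHom (φ : C →⋆ₙₐ[ℂ] B) : FiniteMatrix C →⋆ₙₐ[ℂ] FiniteMatrix B where
  toFun := mapEntries φ
  map_smul' c _ := ext fun _ _ => map_smul φ c _
  map_zero' := ext fun _ _ => map_zero φ
  map_add' _ _ := ext fun _ _ => map_add φ _ _
  map_mul' := mapEntries_mul φ
  map_star' _ := ext fun _ _ => map_star φ _

lemma entry_mapHom (φ : C →⋆ₙₐ[ℂ] B) (M : FiniteMatrix C) (i j : ℕ) :
    (mapHom φ M).entry i j = φ (M.entry i j) := rfl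

lemma mapHom_single (φ : C →⋆ₙₐ[ℂ] B) (k l : ℕ) (c : C) :
    mapHom φ (single k l c) = single k l (φ c) := by
  ext i j
  rw [entry_mapHom, entry_single, entry_single]
  split_ifs <;> simp

lemma mapHom_injective {φ : C →⋆ₙₐ[ℂ] B} (hφ : Function.Injective φ) :
    Function.Injective (mapHom φ) := fun M M' h => ext fun i j => hφ (by
  rw [← entry_mapHom, h, entry_mapHom])

/-- An injective ⋆-homomorphism of C⋆-algebras induces an injective ⋆-homomorphism of their
stabilizations. -/
lemma exists_stabilization_map {φ : C →⋆ₙₐ[ℂ] B} (hφ : Function.Injective φ) :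
    ∃ ψ : Stabilization C →⋆ₙₐ[ℂ] Stabilization B, Function.Injective ψ ∧
      ∀ M, ψ (toStab M) = toStab (mapHom φ M) := by
  refine exists_starAlgHom_extension toStab (toStab.comp (mapHom φ)) denseRange_toStab fun M => ?_
  let _ := CStarAlgebra.spectralOrder C
  let _ := CStarAlgebra.spectralOrderedRing C
  obtain ⟨n, hn⟩ := M.exists_bound
  have hinj : Function.Injective (ofCornerHom (B := C) n) := fun N N' h => by
    rw [← corner_ofCorner n N, ← corner_ofCorner n N']
    exact congrArg (corner n) h
  -- Restricted to one corner, both maps into stabilizations are injective ⋆-homomorphisms of the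
  -- same C⋆-algebra. Both norms equal the norm of the corner, and the two suprema need not be
  -- compared.
  have h1 := NonUnitalStarAlgHom.norm_map (toStab.comp (ofCornerHom (B := C) n))
    (toStab_injective.comp hinj) (corner n M)
  have h2 := NonUnitalStarAlgHom.norm_map (toStab.comp ((mapHom φ).comp (ofCornerHom (B := C) n)))
    (toStab_injective.comp ((mapHom_injective hφ).comp hinj)) (corner n M)
  have e : ofCornerHom n (corner n M) = M := ofCorner_corner hn
  simp only [NonUnitalStarAlgHom.comp_apply, e] at h1 h2 ⊢
  rw [h1, h2]

end FiniteMatrix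

/-! ### Stable isomorphism -/

/-- A closed set that contains all products is everything. -/
lemma mem_of_isClosed_of_mul_mem {C : Type*} [NonUnitalCStarAlgebra C] {P : Set C}
    (hP : IsClosed P) (h : ∀ a b, a * b ∈ P) (c : C) : c ∈ P := by
  let _ := CStarAlgebra.spectralOrder C
  let _ := CStarAlgebra.spectralOrderedRing C
  exact hP.mem_of_tendsto ((CStarAlgebra.increasingApproximateUnit C).tendsto_mul_left c)
    (Eventually.of_forall fun u => h c u)

lemma norm_tsum_le_of_geometric {S : Type*} [NormedAddCommGroup S] [CompleteSpace S] {f : ℕ → S}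
    {K : ℝ} (h : ∀ m, ‖f m‖ ≤ K * (1 / 2) ^ m) : ‖∑' m, f m‖ ≤ K * 2 :=
  tsum_of_norm_bounded (hasSum_geometric_two.mul_left K) h

lemma summable_of_geometric {S : Type*} [NormedAddCommGroup S] [CompleteSpace S] {f : ℕ → S}
    {K : ℝ} (h : ∀ m, ‖f m‖ ≤ K * (1 / 2) ^ m) : Summable f :=
  Summable.of_norm_bounded (hasSum_geometric_two.mul_left K).summable h

/-! ### Weights, the tree and matrix units -/

namespace StableIso

/-- Rapidly decreasing weights. -/
def weight (n : ℕ) : ℝ := (1 / 2) ^ n ^ 2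

lemma weight_pos (n : ℕ) : 0 < weight n := by unfold weight; positivity

/-- Square exponents leave room for two geometric factors between the weights of a vertex and of its
children: one makes the error vanish far out in the tree, the other makes it summable over the
children. -/
lemma weight_le_of_le {a b c d : ℕ} (h : b ^ 2 + c + d ≤ a ^ 2) :
    weight a ≤ weight b * (1 / 2) ^ c * (1 / 2) ^ d := by
  unfold weight
  rw [← pow_add, ← pow_add]
  exact pow_le_pow_of_le_one (by norm_num) (by norm_num) h

lemma weight_le (n : ℕ) : weight (2 * n + 1) ≤ (1 / 2) ^ n := by
  unfold weight
  exact pow_le_pow_of_le_one (by norm_num) (by norm_num) (by nlinarith)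

lemma weight_le' (n : ℕ) : weight (2 * n + 2) ≤ (1 / 2) ^ n := by
  unfold weight
  exact pow_le_pow_of_le_one (by norm_num) (by norm_num) (by nlinarith)

/-- The parent of a vertex in a tree in which every vertex has infinitely many children of every
label. -/
def parent (j : ℕ) : ℕ := j.unpair.1

/-- The label of a vertex. -/
def label (j : ℕ) : ℕ := j.unpair.2.unpair.1

/-- Order the vertices as row 0, column 0, row 1, column 1, and so on. The parent of column `j` is
row `parent j`, and the parent of row `j + 1` is column `parent j`, so parents precede children.
Each edge carries the weight indexed by the position of its child, `2j + 1` or `2j + 2`. -/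
lemma parent_le (j : ℕ) : parent j ≤ j := Nat.unpair_left_le j

/-- The `r`-th child of `i` with label `n`. -/
def child (i n r : ℕ) : ℕ := Nat.pair i (Nat.pair n r)

@[simp] lemma parent_child (i n r : ℕ) : parent (child i n r) = i := by simp [parent, child]
@[simp] lemma label_child (i n r : ℕ) : label (child i n r) = n := by simp [label, child]

lemma le_child (i n r : ℕ) : r ≤ child i n r :=
  (Nat.right_le_pair n r).trans (Nat.right_le_pair i _)

lemma tendsto_child (i n : ℕ) : Tendsto (child i n) atTop atTop :=
  tendsto_atTop_mono (le_child i n) tendsto_id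

variable {B : Type*} [NonUnitalCStarAlgebra B]

/-- The matrix units `e_{kl}(b)` of the stabilization. -/
def stabSingle (k l : ℕ) : B →L[ℂ] Stabilization B :=
  LinearMap.mkContinuous
    { toFun := fun b => FiniteMatrix.toStab (FiniteMatrix.single k l b)
      map_add' := fun b c => by rw [FiniteMatrix.single_add, map_add]
      map_smul' := fun z b => by rw [FiniteMatrix.single_smul, map_smul]; rfl } 1 fun b => by
    rw [one_mul, ← FiniteMatrix.normSum_single k l b]
    exact FiniteMatrix.norm_toStab_le _

lemma stabSingle_apply (k l : ℕ) (b : B) :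
    stabSingle k l b = FiniteMatrix.toStab (FiniteMatrix.single k l b) := rfl

lemma norm_stabSingle_le (k l : ℕ) (b : B) : ‖stabSingle k l b‖ ≤ ‖b‖ := by
  rw [← FiniteMatrix.normSum_single k l b]
  exact FiniteMatrix.norm_toStab_le _

lemma star_stabSingle (k l : ℕ) (b : B) : star (stabSingle k l b) = stabSingle l k (star b) := by
  rw [stabSingle_apply, ← map_star, FiniteMatrix.star_single, stabSingle_apply]

lemma stabSingle_mul (k l n : ℕ) (b c : B) :
    stabSingle k l b * stabSingle l n c = stabSingle k n (b * c) := by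
  rw [stabSingle_apply, stabSingle_apply, ← map_mul, FiniteMatrix.single_mul_single,
    stabSingle_apply]

lemma stabSingle_mul_of_ne {l m : ℕ} (h : l ≠ m) (k n : ℕ) (b c : B) :
    stabSingle k l b * stabSingle m n c = 0 := by
  rw [stabSingle_apply, stabSingle_apply, ← map_mul, FiniteMatrix.single_mul_single_of_ne h,
    map_zero]

/-- A closed subspace of `B ⊗ 𝒦` that contains all `e_{kl}(b)` is everything. -/
lemma mem_of_stabSingle_mem {S : Submodule ℂ (Stabilization B)}
    (hS : IsClosed (S : Set (Stabilization B))) (h : ∀ k l b, stabSingle k l b ∈ S)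
    (s : Stabilization B) : s ∈ S := by
  refine FiniteMatrix.denseRange_toStab.induction_on (p := fun s => s ∈ S) s hS fun M => ?_
  obtain ⟨n, hn⟩ := M.exists_bound
  rw [FiniteMatrix.eq_sum_single hn, map_sum]
  exact sum_mem fun ij _ => h _ _ _

/-! ### The weighted tree operator -/

section Operator
variable (x : ℕ → B)

/-- The first half of the operator `t`: vertices `j` of the second kind. -/
def term₁ (j : ℕ) : Stabilization B :=
  (weight (2 * j + 1) : ℂ) • stabSingle (parent j) j (x (label j))

/-- The second half of the operator `t`: vertices `j + 1` of the first kind. -/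
def term₂ (j : ℕ) : Stabilization B :=
  (weight (2 * j + 2) : ℂ) • stabSingle (j + 1) (parent j) (x (label j))

/-- The operator `t`, the weighted adjacency matrix of a bipartite tree with edges labelled by
`x`. -/
def op : Stabilization B := ∑' j, term₁ x j + ∑' j, term₂ x j

variable {x} (hx : ∀ n, ‖x n‖ ≤ 1)

lemma norm_weight_smul {S : Type*} [NormedAddCommGroup S] [NormedSpace ℂ S] (n : ℕ) (s : S) :
    ‖(weight n : ℂ) • s‖ = weight n * ‖s‖ := by
  rw [norm_smul, Complex.norm_real, Real.norm_of_nonneg (weight_pos n).le]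

include hx

lemma norm_term₁_le (j : ℕ) : ‖term₁ x j‖ ≤ 1 * (1 / 2) ^ j := by
  rw [term₁, norm_weight_smul, one_mul]
  exact (mul_le_of_le_one_right (weight_pos _).le ((norm_stabSingle_le _ _ _).trans (hx _))).trans
    (weight_le j)

lemma norm_term₂_le (j : ℕ) : ‖term₂ x j‖ ≤ 1 * (1 / 2) ^ j := by
  rw [term₂, norm_weight_smul, one_mul]
  exact (mul_le_of_le_one_right (weight_pos _).le ((norm_stabSingle_le _ _ _).trans (hx _))).trans
    (weight_le' j)

lemma summable_term₁ : Summable (term₁ x) := summable_of_geometric (norm_term₁_le hx)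

lemma summable_term₂ : Summable (term₂ x) := summable_of_geometric (norm_term₂_le hx)

/-- Column `j` of `t` has one entry from the edge to its parent row and further entries from its
child rows `m + 1` with `parent m = j`. The latter have `m ≥ j`, so their total weight is at most `2
· (1/2)^j` times that of the parent edge. -/
lemma norm_op_mul_sub_le (j k : ℕ) (b : B) :
    ‖op x * stabSingle j k b -
      (weight (2 * j + 1) : ℂ) • stabSingle (parent j) k (x (label j) * b)‖ ≤
      weight (2 * j + 1) * (1 / 2) ^ j * ‖b‖ * 2 := by
  have h1 : (∑' m, term₁ x m) * stabSingle j k b =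
      (weight (2 * j + 1) : ℂ) • stabSingle (parent j) k (x (label j) * b) := by
    rw [← (summable_term₁ hx).tsum_mul_right, tsum_eq_single j]
    · rw [term₁, smul_mul_assoc, stabSingle_mul]
    · intro m hm
      rw [term₁, smul_mul_assoc, stabSingle_mul_of_ne hm, smul_zero]
  rw [op, add_mul, h1, add_sub_cancel_left, ← (summable_term₂ hx).tsum_mul_right]
  refine norm_tsum_le_of_geometric fun m => ?_
  by_cases hm : parent m = j
  · rw [term₂, hm, smul_mul_assoc, stabSingle_mul, norm_weight_smul]
    have hjm : j ≤ m := hm ▸ parent_le m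
    have hw : weight (2 * m + 2) ≤ weight (2 * j + 1) * (1 / 2) ^ j * (1 / 2) ^ m :=
      weight_le_of_le (by nlinarith)
    have hb : ‖stabSingle (m + 1) k (x (label m) * b)‖ ≤ ‖b‖ :=
      (norm_stabSingle_le _ _ _).trans ((norm_mul_le _ _).trans
        (mul_le_of_le_one_left (norm_nonneg b) (hx _)))
    calc _ ≤ weight (2 * j + 1) * (1 / 2) ^ j * (1 / 2) ^ m * ‖b‖ :=
          mul_le_mul hw hb (norm_nonneg _) ((weight_pos _).le.trans hw)
      _ = _ := by ring
  · rw [term₂, smul_mul_assoc, stabSingle_mul_of_ne hm, smul_zero, norm_zero]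
    have := weight_pos (2 * j + 1)
    positivity

/-- The same estimate for row `j + 1`: its children are columns `m` with `m ≥ j + 1`, still later in
the order. Row 0, the root, has no parent and is left out. -/
lemma norm_star_op_mul_sub_le (j k : ℕ) (b : B) :
    ‖star (op x) * stabSingle (j + 1) k b -
      (weight (2 * j + 2) : ℂ) • stabSingle (parent j) k (star (x (label j)) * b)‖ ≤
      weight (2 * j + 2) * (1 / 2) ^ j * ‖b‖ * 2 := by
  have h1 : star (∑' m, term₂ x m) * stabSingle (j + 1) k b =
      (weight (2 * j + 2) : ℂ) • stabSingle (parent j) k (star (x (label j)) * b) := by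
    rw [tsum_star, ← (summable_term₂ hx).star.tsum_mul_right, tsum_eq_single j]
    · rw [term₂, star_smul, star_stabSingle, smul_mul_assoc, stabSingle_mul, Complex.star_def,
        Complex.conj_ofReal]
    · intro m hm
      rw [term₂, star_smul, star_stabSingle, smul_mul_assoc,
        stabSingle_mul_of_ne (by simpa using hm), smul_zero]
  rw [op, star_add, add_mul, h1, add_sub_cancel_right, tsum_star,
    ← (summable_term₁ hx).star.tsum_mul_right]
  refine norm_tsum_le_of_geometric fun m => ?_
  rw [term₁, star_smul, star_stabSingle, smul_mul_assoc, Complex.star_def, Complex.conj_ofReal]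
  by_cases hm : parent m = j + 1
  · rw [hm, stabSingle_mul, norm_weight_smul]
    have hjm : j + 1 ≤ m := hm ▸ parent_le m
    have hw : weight (2 * m + 1) ≤ weight (2 * j + 2) * (1 / 2) ^ j * (1 / 2) ^ m :=
      weight_le_of_le (by nlinarith)
    have hb : ‖stabSingle m k (star (x (label m)) * b)‖ ≤ ‖b‖ :=
      (norm_stabSingle_le _ _ _).trans ((norm_mul_le _ _).trans
        (mul_le_of_le_one_left (norm_nonneg b) (by rw [norm_star]; exact hx _)))
    calc _ ≤ weight (2 * j + 2) * (1 / 2) ^ j * (1 / 2) ^ m * ‖b‖ :=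
          mul_le_mul hw hb (norm_nonneg _) ((weight_pos _).le.trans hw)
      _ = _ := by ring
  · rw [stabSingle_mul_of_ne hm, smul_zero, norm_zero]
    have := weight_pos (2 * j + 2)
    positivity

omit hx in
/-- If `s_r` is within a small multiple of `w_r` of `w_r • y` then `w_r⁻¹ • s_r → y`. -/
lemma tendsto_inv_weight_smul {S : Type*} [NormedAddCommGroup S] [NormedSpace ℂ S] {y : S}
    {s : ℕ → S} {w j : ℕ → ℕ} {K : ℝ} (hj : Tendsto j atTop atTop)
    (h : ∀ r, ‖s r - (weight (w r) : ℂ) • y‖ ≤ weight (w r) * (1 / 2) ^ j r * K * 2) :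
    Tendsto (fun r => (weight (w r) : ℂ)⁻¹ • s r) atTop (𝓝 y) := by
  rw [tendsto_iff_norm_sub_tendsto_zero]
  have h1 : Tendsto (fun r => (1 / 2 : ℝ) ^ j r * K * 2) atTop (𝓝 0) := by
    have := ((tendsto_pow_atTop_nhds_zero_of_lt_one (r := (1 / 2 : ℝ)) (by norm_num)
      (by norm_num)).comp hj).mul_const K |>.mul_const 2
    simpa using this
  refine squeeze_zero (fun _ => norm_nonneg _) (fun r => ?_) h1
  have hw := weight_pos (w r)
  have hw' : (weight (w r) : ℂ) ≠ 0 := Complex.ofReal_ne_zero.2 hw.ne'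
  have e : (weight (w r) : ℂ)⁻¹ • s r - y =
      (weight (w r) : ℂ)⁻¹ • (s r - (weight (w r) : ℂ) • y) := by
    rw [smul_sub, inv_smul_smul₀ hw']
  rw [e, norm_smul, norm_inv, Complex.norm_real, Real.norm_of_nonneg hw.le,
    inv_mul_le_iff₀ hw]
  exact (h r).trans (le_of_eq (by ring))

/-- Row `i` has infinitely many child columns with label `n`. Along these, dividing by the parent
weight leaves an error tending to zero. -/
lemma tendsto_op_mul (i n k : ℕ) (b : B) :
    Tendsto (fun r => op x * ((weight (2 * child i n r + 1) : ℂ)⁻¹ •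
      stabSingle (child i n r) k b)) atTop (𝓝 (stabSingle i k (x n * b))) := by
  simp only [mul_smul_comm]
  refine tendsto_inv_weight_smul (K := ‖b‖) (tendsto_child i n) fun r => ?_
  have := norm_op_mul_sub_le hx (child i n r) k b
  rwa [parent_child, label_child] at this

lemma tendsto_star_op_mul (i n k : ℕ) (b : B) :
    Tendsto (fun r => star (op x) * ((weight (2 * child i n r + 2) : ℂ)⁻¹ •
      stabSingle (child i n r + 1) k b)) atTop (𝓝 (stabSingle i k (star (x n) * b))) := by
  simp only [mul_smul_comm]
  refine tendsto_inv_weight_smul (K := ‖b‖) (tendsto_child i n) fun r => ?_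
  have := norm_star_op_mul_sub_le hx (child i n r) k b
  rwa [parent_child, label_child] at this

omit hx in
/-- The operator `t` lies in every closed subspace that contains all `e_{ij}(x_n)`. -/
lemma op_mem (hx : ∀ n, ‖x n‖ ≤ 1) {S : Submodule ℂ (Stabilization B)}
    (hS : IsClosed (S : Set (Stabilization B)))
    (h : ∀ i j n, stabSingle i j (x n) ∈ S) : op x ∈ S := by
  refine add_mem ?_ ?_
  · exact hS.mem_of_tendsto (summable_term₁ hx).hasSum
      (Eventually.of_forall fun s => sum_mem fun j _ => S.smul_mem _ (h _ _ _))
  · exact hS.mem_of_tendsto (summable_term₂ hx).hasSum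
      (Eventually.of_forall fun s => sum_mem fun j _ => S.smul_mem _ (h _ _ _))

end Operator

/-- Let `C ⊆ B` be an inclusion of C⋆-algebras, and let `(x_n)` be a sequence in `B` with
`x_n B x_m⋆ ⊆ C`, with `C` contained in the closed span of the `x_n B`, and with `B` the closed span
of the `x_n⋆ x_m B`. Then `C` and `B` are stably isomorphic. -/
theorem stablyIsomorphic {C : Type*} [NonUnitalCStarAlgebra C] (ι : C →⋆ₙₐ[ℂ] B)
    (hι : Function.Injective ι) {x : ℕ → B} (hx : ∀ n, ‖x n‖ ≤ 1)
    (h1 : ∀ n m b, x n * b * star (x m) ∈ Set.range ι)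
    (h2 : ∀ S : Submodule ℂ B, IsClosed (S : Set B) → (∀ n b, x n * b ∈ S) → ∀ c, ι c ∈ S)
    (h3 : ∀ S : Submodule ℂ B, IsClosed (S : Set B) →
      (∀ n m b, star (x n) * (x m * b) ∈ S) → ∀ b, b ∈ S) :
    StablyIsomorphic C B := by
  obtain ⟨ψ, hψ, hψM⟩ := FiniteMatrix.exists_stabilization_map hι
  have hiso : Isometry ψ := NonUnitalStarAlgHom.isometry ψ hψ
  have hψs : ∀ k l c, ψ (stabSingle k l c) = stabSingle k l (ι c) := fun k l c => by
    rw [stabSingle_apply, hψM, FiniteMatrix.mapHom_single, stabSingle_apply]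
  set t := op x with ht
  -- `R` is the closure of `t S`. It contains every `e_{ik}(x_n b)`, hence by `h2` all matrices over
  -- `C`.
  let R : Submodule ℂ (Stabilization B) :=
    (LinearMap.range (LinearMap.mulLeft ℂ t)).topologicalClosure
  have hR : IsClosed (R : Set (Stabilization B)) := Submodule.isClosed_topologicalClosure _
  have hRs : ∀ s, t * s ∈ R := fun s => Submodule.le_topologicalClosure _ ⟨s, rfl⟩
  have hR1 : ∀ i k n b, stabSingle i k (x n * b) ∈ R := fun i k n b =>
    hR.mem_of_tendsto (tendsto_op_mul hx i n k b) (Eventually.of_forall fun r => hRs _)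
  have hR2 : ∀ i k c, stabSingle i k (ι c) ∈ R := fun i k c =>
    h2 (R.comap (stabSingle i k).toLinearMap) (hR.preimage (stabSingle i k).continuous)
      (hR1 i k) c
  have hRind : ∀ {P : Set (Stabilization B)}, IsClosed P → (∀ s, t * s ∈ P) → ∀ y ∈ R, y ∈ P :=
    fun hP h y hy => closure_minimal (by rintro _ ⟨s, rfl⟩; exact h s) hP hy
  have hequiv : Nonempty (Stabilization B ≃⋆ₐ[ℂ] Stabilization C) := by
    refine nonempty_starAlgEquiv_of_dense t ?_ ψ hψ ?_ ?_
    -- The closure of `t⋆ t S` contains `t⋆ R`. Since `R` contains all `e_{jk}(x_m b)`, rescaling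
    -- yields `e_{ik}(x_n⋆ x_m b)`, and these generate everything by `h3`.
    · let E : Submodule ℂ (Stabilization B) :=
        (LinearMap.range (LinearMap.mulLeft ℂ (star t * t))).topologicalClosure
      have hE : IsClosed (E : Set (Stabilization B)) := Submodule.isClosed_topologicalClosure _
      have hE1 : ∀ y ∈ R, star t * y ∈ E := by
        refine hRind (P := {y | star t * y ∈ E}) (hE.preimage (continuous_const_mul _)) fun s => ?_
        exact Submodule.le_topologicalClosure _ ⟨s, mul_assoc _ _ _⟩
      have hE2 : ∀ i k n m b, stabSingle i k (star (x n) * (x m * b)) ∈ E := fun i k n m b =>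
        hE.mem_of_tendsto (tendsto_star_op_mul hx i n k (x m * b))
          (Eventually.of_forall fun r => hE1 _ (R.smul_mem _ (hR1 _ _ _ _)))
      have hE3 : ∀ i k b, stabSingle i k b ∈ E := fun i k =>
        h3 (E.comap (stabSingle i k).toLinearMap) (hE.preimage (stabSingle i k).continuous)
          (hE2 i k)
      exact fun s => mem_of_stabSingle_mem hE hE3 s
    -- To place `t s t⋆` in `C ⊗ 𝒦`, replace each factor `t` by matrix units over the `x_n`, using
    -- `op_mem` on the left and, after passing to adjoints, on the right. What remains are entries
    -- `x_r b x_n⋆`, which lie in `C` by `h1`.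
    · let Q : Submodule ℂ (Stabilization B) := LinearMap.range
        ({ toFun := ψ, map_add' := map_add ψ, map_smul' := map_smul ψ } :
          Stabilization C →ₗ[ℂ] Stabilization B)
      have hQ : IsClosed (Q : Set (Stabilization B)) := hiso.isClosedEmbedding.isClosed_range
      have hQ1 : ∀ i j k l n b,
          stabSingle i j (x n) * stabSingle k l b * star t ∈ Q := by
        intro i j k l n b
        have hstar : ∀ y : Stabilization B, star y ∈ Q → y ∈ Q := by
          rintro y ⟨z, hz⟩
          refine ⟨star z, ?_⟩
          change ψ (star z) = y
          rw [map_star, ← star_star y]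
          exact congrArg star hz
        refine hstar _ ?_
        rw [star_mul, star_star]
        refine op_mem (S := Q.comap (LinearMap.mulRight ℂ _)) hx
          (hQ.preimage (continuous_mul_const _)) fun p q r => ?_
        change stabSingle p q (x r) * star (stabSingle i j (x n) * stabSingle k l b) ∈ Q
        by_cases hjk : j = k
        · subst hjk
          rw [stabSingle_mul, star_stabSingle]
          by_cases hql : q = l
          · subst hql
            rw [stabSingle_mul]
            obtain ⟨c, hc⟩ := h1 r n (star b)
            exact ⟨stabSingle p i c, (hψs _ _ _).trans (by rw [hc, star_mul, mul_assoc])⟩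
          · rw [stabSingle_mul_of_ne hql]
            exact zero_mem _
        · rw [stabSingle_mul_of_ne hjk, star_zero, mul_zero]
          exact zero_mem _
      intro s
      have hQ2 : t * s * star t ∈ Q := by
        refine mem_of_stabSingle_mem
          (S := Q.comap ((LinearMap.mulRight ℂ (star t)).comp (LinearMap.mulLeft ℂ t)))
          (hQ.preimage ((continuous_mul_const _).comp (continuous_const_mul _)))
          (fun k l b => ?_) s
        change t * stabSingle k l b * star t ∈ Q
        rw [mul_assoc]
        refine op_mem (S := Q.comap (LinearMap.mulRight ℂ _)) hx
          (hQ.preimage (continuous_mul_const _)) fun i j n => ?_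
        change stabSingle i j (x n) * (stabSingle k l b * star t) ∈ Q
        rw [← mul_assoc]
        exact hQ1 i j k l n b
      exact hQ2
    -- The closure of `t S t⋆` contains `y s z⋆` for all `y`, `z` in `R`, so matrices over `C` may
    -- be used on both sides.
    · let E : Submodule ℂ (Stabilization B) :=
        (LinearMap.range ((LinearMap.mulRight ℂ (star t)).comp
          (LinearMap.mulLeft ℂ t))).topologicalClosure
      have hE : IsClosed (E : Set (Stabilization B)) := Submodule.isClosed_topologicalClosure _
      have hE1 : ∀ s, t * s * star t ∈ E := fun s => Submodule.le_topologicalClosure _ ⟨s, rfl⟩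
      have hE2 : ∀ y ∈ R, ∀ s, y * s * star t ∈ E := fun y hy s => by
        refine hRind (P := {y | y * s * star t ∈ E})
          (hE.preimage ((continuous_mul_const _).comp (continuous_mul_const _))) (fun r => ?_) y hy
        change t * r * s * star t ∈ E
        rw [mul_assoc t]
        exact hE1 _
      have hE3 : ∀ y ∈ R, ∀ z ∈ R, ∀ s, y * s * star z ∈ E := fun y hy z hz s => by
        refine hRind (P := {z | y * s * star z ∈ E})
          (hE.preimage ((continuous_const_mul _).comp continuous_star)) (fun r => ?_) z hz
        change y * s * star (t * r) ∈ E
        rw [star_mul, ← mul_assoc, mul_assoc y]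
        exact hE2 y hy _
      have hE4 : ∀ k l c, stabSingle k l (ι c) ∈ E := by
        intro k l
        have hP : IsClosed {c | stabSingle k l (ι c) ∈ E} := hE.preimage
          ((stabSingle k l).continuous.comp (NonUnitalStarAlgHom.isometry ι hι).continuous)
        -- Triple products suffice by an approximate unit, and `e_{kl}(a b c) = e_{k0}(a) e_{00}(b)
        -- e_{l0}(c⋆)⋆` has the required form.
        refine mem_of_isClosed_of_mul_mem hP fun a => ?_
        refine mem_of_isClosed_of_mul_mem (P := {b | a * b ∈ {c | stabSingle k l (ι c) ∈ E}})
          (hP.preimage (continuous_const_mul a)) fun b c => ?_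
        change stabSingle k l (ι (a * (b * c))) ∈ E
        have := hE3 _ (hR2 k 0 a) _ (hR2 l 0 (star c)) (stabSingle 0 0 (ι b))
        rwa [star_stabSingle, stabSingle_mul, stabSingle_mul, map_star, star_star, ← map_mul,
          ← map_mul, mul_assoc] at this
      rintro _ ⟨s, rfl⟩
      refine mem_of_stabSingle_mem (S := E.comap
        ({ toFun := ψ, map_add' := map_add ψ, map_smul' := map_smul ψ } :
          Stabilization C →ₗ[ℂ] Stabilization B)) (hE.preimage hiso.continuous)
        (fun k l c => ?_) s
      change ψ (stabSingle k l c) ∈ E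
      rw [hψs]
      exact hE4 k l c
  exact hequiv.map StarAlgEquiv.symm

end StableIso

namespace CStarAction

/-! ### Stable isomorphism for saturated actions -/

section Stable
set_option linter.unusedSectionVars false
variable {G : Type*} [Group G] [TopologicalSpace G] [IsTopologicalGroup G] [CompactSpace G]
  [T2Space G] [SecondCountableTopology G]
  [MeasurableSpace G] [BorelSpace G] {A : Type*} [NonUnitalCStarAlgebra A] (α : CStarAction G A)

lemma norm_orbitMap_le (a : A) : ‖α.orbitMap a‖ ≤ ‖a‖ :=
  (α.orbitMap.le_of_opNorm_le (LinearMap.mkContinuous_norm_le _ zero_le_one _) a).trans_eq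
    (one_mul _)

/-- The image of `a` in the crossed product, scaled into the unit ball. -/
def unitOrbit (a : A) : α.CrossedProduct := (((1 + ‖a‖)⁻¹ : ℝ) : ℂ) • α.orbitMap a

lemma norm_unitOrbit_le (a : A) : ‖α.unitOrbit a‖ ≤ 1 := by
  have h : 0 < 1 + ‖a‖ := by positivity
  rw [unitOrbit, norm_smul, Complex.norm_real, Real.norm_of_nonneg (inv_nonneg.2 h.le),
    inv_mul_le_iff₀ h]
  linarith [α.norm_orbitMap_le a]

lemma unitOrbit_mem (a : A) : α.unitOrbit a ∈ α.bimodule :=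
  Submodule.smul_mem _ _ (α.orbitMap_mem a)

lemma orbitMap_eq_smul_unitOrbit (a : A) :
    α.orbitMap a = ((1 + ‖a‖ : ℝ) : ℂ) • α.unitOrbit a := by
  have h : 0 < 1 + ‖a‖ := by positivity
  rw [unitOrbit, smul_smul, ← Complex.ofReal_mul, mul_inv_cancel₀ h.ne', Complex.ofReal_one,
    one_smul]

/-- A closed subspace that contains `unitOrbit (u n) * b` for a dense sequence `u` contains
`orbitMap a * b` for all `a`. -/
lemma orbitMap_mul_mem {u : ℕ → A} (hu : DenseRange u) {S : Submodule ℂ α.CrossedProduct}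
    (hS : IsClosed (S : Set α.CrossedProduct)) {b : α.CrossedProduct}
    (h : ∀ n, α.unitOrbit (u n) * b ∈ S) (a : A) : α.orbitMap a * b ∈ S := by
  refine hu.induction_on (p := fun a => α.orbitMap a * b ∈ S) a
    (hS.preimage (α.orbitMap.continuous.mul_const b)) fun n => ?_
  rw [orbitMap_eq_smul_unitOrbit, smul_mul_assoc]
  exact S.smul_mem _ (h n)

lemma star_orbitMap_mul_mem {u : ℕ → A} (hu : DenseRange u) {S : Submodule ℂ α.CrossedProduct}
    (hS : IsClosed (S : Set α.CrossedProduct)) {b : α.CrossedProduct}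
    (h : ∀ n, star (α.unitOrbit (u n)) * b ∈ S) (a : A) : star (α.orbitMap a) * b ∈ S := by
  refine hu.induction_on (p := fun a => star (α.orbitMap a) * b ∈ S) a
    (hS.preimage (α.orbitMap.continuous.star.mul_const b)) fun n => ?_
  rw [orbitMap_eq_smul_unitOrbit, star_smul, smul_mul_assoc]
  exact S.smul_mem _ (h n)

/-- The fixed point algebra of a saturated action on a separable C⋆-algebra is stably isomorphic to
the crossed product. -/
lemma IsSaturated.stablyIsomorphic [TopologicalSpace.SeparableSpace A] (hα : α.IsSaturated) :
    StablyIsomorphic α.fixedPoints α.CrossedProduct := by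
  have hu : DenseRange (TopologicalSpace.denseSeq A) := TopologicalSpace.denseRange_denseSeq A
  -- The `x_n` are scaled orbit functions of a dense sequence. Then `x_n b x_m⋆` lies in `A^α`,
  -- because the bimodule is a right ideal and its left inner product takes values there.
  refine StableIso.stablyIsomorphic α.fixedIncl α.fixedIncl_injective
    (x := fun n => α.unitOrbit (TopologicalSpace.denseSeq A n)) (fun n => α.norm_unitOrbit_le _)
    (fun n m b => α.mul_star_mem_range (α.bimodule_mul_mem (α.unitOrbit_mem _) b)
      (α.unitOrbit_mem _)) (fun S hS h c => ?_) (fun S hS h b => ?_)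
  -- On fixed elements orbit and constant functions agree, so a product `a c` in `A^α` has the form
  -- `o_a b`.
  · refine mem_of_isClosed_of_mul_mem (P := {c | α.fixedIncl c ∈ S}) (hS.preimage
      (NonUnitalStarAlgHom.isometry α.fixedIncl α.fixedIncl_injective).continuous) (fun a c => ?_) c
    change α.fixedIncl (a * c) ∈ S
    rw [map_mul, ← orbitMap_of_mem]
    exact α.orbitMap_mul_mem hu hS (fun n => h n _) _
  -- By saturation the left factor `y` of a product `y c` may be taken to be some `f_{a,a'}`, and
  -- `f_{a,a'} c = o_{a⋆}⋆ (o_{a'} c)`. Density of the sequence handles both orbit functions.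
  · refine mem_of_isClosed_of_mul_mem hS (fun y c => ?_) b
    refine closure_minimal (t := {y | y * c ∈ S}) ?_ (hS.preimage (continuous_mul_const c))
      (hα y)
    intro y hy
    refine Submodule.span_le (p := S.comap (LinearMap.mulRight ℂ c)).2 ?_ hy
    rintro _ ⟨a, a', rfl⟩
    change α.toCrossedProduct (α.coeff a a') * c ∈ S
    rw [← star_star a, ← star_orbitMap_mul, mul_assoc]
    exact α.star_orbitMap_mul_mem hu hS (fun n => by
      exact α.orbitMap_mul_mem (S := S.comap (LinearMap.mulLeft ℂ _)) hu
        (hS.preimage (continuous_const_mul _)) (fun m => h n m c) a') _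

end Stable
end CStarAction

end

/-! ### The main theorem -/

theorem mainTheorem2 {G : Type*} [Group G] [TopologicalSpace G] [IsTopologicalGroup G]
    [CompactSpace G] [T2Space G] [SecondCountableTopology G] [MeasurableSpace G] [BorelSpace G]
    {A : Type*} [NonUnitalCStarAlgebra A] (hA : IsSigmaUnital A)
    (α : CStarAction G A) (hα : α.HasRokhlinProperty) :
    α.IsSaturated ∧
    MoritaEquivalent α.fixedPoints α.CrossedProduct ∧
    (TopologicalSpace.SeparableSpace A →
      StablyIsomorphic α.fixedPoints α.CrossedProduct) := by
  have hsat := CStarAction.HasRokhlinProperty.isSaturated α hA hα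
  exact ⟨hsat, ⟨α.bimodule, inferInstance, inferInstance, inferInstance,
    ⟨α.imprimitivityBimodule hA hsat⟩⟩, fun _ => CStarAction.IsSaturated.stablyIsomorphic α hsat⟩
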